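/- Let $L$ be the free Lie algebra over a field $F$ on a finite set $X$ of cardinality $m$. Let $L_n$ be the span of all commutators of length $n$ in the elements of $X$, and let $L^{(n)}=L_1\oplus\dots\oplus L_n$. For a subspace $W\subseteq L$ let $g_W(n)=\dim (W\cap L^{(n)})$ be its relative growth function and $g_{L/W}(n)=\dim L^{(n)}/(W\cap L^{(n)})$ its relative cogrowth function. The (exponential) base of a function $f:\mathbb N\to\mathbb N$ is $\lim_{n\to\infty}\sqrt[n]{f(n)}$, if this limit exists; $f$ is exponential if its base exists and is greater than $1$. Write $\beta_H$ for the base of $g_H$ and $\beta_{L/S}$ for the base of $g_{L/S}$. The degree of $u\in L\setminus\{0\}$ is the least $n$ with $u\in L^{(n)}$, and the leading part of $u$ is its component in $L_n$ for this $n$. A set of nonzero elements of $L$ is irreducible if no leading part of any of its elements lies in the subalgebra generated by the leading parts of the remaining elements. (i) If $H$ is a proper nonabelian subalgebra of $L$, then $g_H$ is exponential. (ii) If $H$ is a finitely generated nonabelian subalgebra of $L$, then $\beta_H$ exists, $\beta_H>1$, and $\beta_H$ is an algebraic integer; if $H$ is moreover proper, then $\beta_H<m$. Furthermore, $H$ is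 generated by some finite irreducible set, and for every finite irreducible set $Y$ that generates $H$, with $k_i$ elements of degree $i$ and with maximal degree $d$, the number $\beta_H$ is the unique positive root of $z^d=\sum_{i=1}^{d}k_i z^{d-i}$. (iii) For every real $m_0\in[1,m]$ there is a subalgebra $H$ of $L$ such that $\beta_H$ exists and equals $m_0$. If $m\ge 2$, one can choose $H$ to be a retract of an ideal of codimension $1$ in $L$. (iv) For every real $m_0\in[1,m]$ there are an ideal $M$ of codimension $1$ in $L$ and an ideal $S$ of $M$ (so that $S$ is a $2$-subideal of $L$) such that $M/S$ is a free Lie algebra and $\beta_{L/S}$ exists and equals $m_0$. -/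

import Mathlib

open Filter Topology

namespace FreeLieGrowth

section Functions

/-- `b` is the (exponential) base of `f`: the limit of the `n`-th roots of `f n`. -/
def HasBase (f : ℕ → ℕ) (b : ℝ) : Prop :=
  Tendsto (fun n : ℕ => ((f n : ℕ) : ℝ) ^ (1 / (n : ℝ))) atTop (𝓝 b)

/-- `f` is exponential: its base exists and is greater than `1`. -/
def IsExponential (f : ℕ → ℕ) : Prop :=
  ∃ b : ℝ, 1 < b ∧ HasBase f b

end Functions

section Filtration

variable {F X : Type*} [Field F]

/-- `IsCommutator n c`: the element `c` of the free Lie algebra on `X` is a commutator of length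
`n` in the free generators, with arbitrary bracketing. -/
inductive IsCommutator : ℕ → FreeLieAlgebra F X → Prop
  | of (x : X) : IsCommutator 1 (FreeLieAlgebra.of F x)
  | lie {k l : ℕ} {c d : FreeLieAlgebra F X} :
      IsCommutator k c → IsCommutator l d → IsCommutator (k + l) ⁅c, d⁆

variable (F X)

/-- The homogeneous component `L_n`. -/
noncomputable def homogeneous (n : ℕ) : Submodule F (FreeLieAlgebra F X) :=
  Submodule.span F {c | IsCommutator n c}

/-- The degree filtration `L^{(n)} = L_1 + ⋯ + L_n` (note that `L_0 = 0`). -/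
noncomputable def filtration (n : ℕ) : Submodule F (FreeLieAlgebra F X) :=
  ⨆ k ∈ Set.Iic n, homogeneous F X k

variable {F X}

/-- The relative growth function `n ↦ dim (W ∩ L^{(n)})` of a subspace `W`. -/
noncomputable def growth (W : Submodule F (FreeLieAlgebra F X)) (n : ℕ) : ℕ :=
  Module.finrank F ↥(W ⊓ filtration F X n)

/-- The relative cogrowth function `n ↦ dim (L^{(n)} / (W ∩ L^{(n)}))` of a subspace `W`. -/
noncomputable def cogrowth (W : Submodule F (FreeLieAlgebra F X)) (n : ℕ) : ℕ :=
  Module.finrank F (↥(filtration F X n) ⧸ W.submoduleOf (filtration F X n))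

/-- The degree of `u`: the least `n` with `u ∈ L^{(n)}` (so the degree of `0` is `0`). -/
noncomputable def degree (u : FreeLieAlgebra F X) : ℕ :=
  sInf {n | u ∈ filtration F X n}

/-- `v` is the leading part of the nonzero element `u`: its homogeneous component of greatest
degree among the nonzero ones. -/
def IsLeadingPart (u v : FreeLieAlgebra F X) : Prop :=
  ∃ n : ℕ, v ∈ homogeneous F X (n + 1) ∧ v ≠ 0 ∧ u - v ∈ filtration F X n

/-- A set of nonzero elements is irreducible if no leading part of any of its elements belongs to
the subalgebra generated by the leading parts of the remaining elements. -/
def IsIrreducible (S : Set (FreeLieAlgebra F X)) : Prop :=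
  ∀ u ∈ S, u ≠ 0 ∧ ∀ v, IsLeadingPart u v →
    v ∉ LieSubalgebra.lieSpan F (FreeLieAlgebra F X) {w | ∃ s ∈ S \ {u}, IsLeadingPart s w}

end Filtration

section Algebras

variable (F : Type*) [Field F] {G : Type*} [LieRing G] [LieAlgebra F G]

/-- `B` is a free basis of the Lie algebra `G`. -/
def IsFreeBasis (B : Set G) : Prop :=
  Function.Bijective (FreeLieAlgebra.lift F (fun b : B => (b : G)))

variable (G) in
/-- `G` is a free Lie algebra over `F`. -/
def IsFree : Prop :=
  ∃ B : Set G, IsFreeBasis F B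

variable {F}

/-- `H` is finitely generated as a Lie algebra. -/
def IsFinitelyGenerated (H : LieSubalgebra F G) : Prop :=
  ∃ s : Finset G, LieSubalgebra.lieSpan F G (s : Set G) = H

/-- The subalgebra `H` is a retract of the ideal `I`: it is contained in `I`, and there is a
homomorphism of Lie algebras `I → H` that is the identity on `H`. -/
def IsRetractOf (H : LieSubalgebra F G) (I : LieIdeal F G) : Prop :=
  ∃ (h : ∀ x ∈ H, x ∈ I) (ρ : I →ₗ⁅F⁆ H), ∀ x : H, ρ ⟨x, h x x.2⟩ = x

/-- The ideal `I` has codimension one. -/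
def HasCodimOne (I : LieIdeal F G) : Prop :=
  Module.finrank F (G ⧸ I) = 1

/-- An ideal `S` of an ideal `M` of `G` (that is, a `2`-subideal of `G`), viewed as a subspace
of `G`. -/
def subidealSubspace (M : LieIdeal F G) (S : LieIdeal F M) : Submodule F G :=
  S.toSubmodule.map M.toSubmodule.subtype

end Algebras

end FreeLieGrowth

/-! The subalgebra `gr H` spanned by the leading parts of `H` has the same growth function as `H`,
so homogeneous subalgebras suffice. The engine is elimination: if a functional φ on a free Lie
algebra kills brackets and φ(b₀) = 1, its kernel is free on the elements ad(b₀)^j (b_i − φ(b_i) b₀)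
with b_i ≠ b₀. For homogeneous data of degree n, this splits a factor 1 − tⁿ off 1 − W(t), where W
is the generating function of the weights (`FreeFamily.exists_step`). Repeated in the least degree
where the free algebra still exceeds a given homogeneous subalgebra, it reaches that subalgebra up
to any degree N (`FreeFamily.exists_chain`). Descending to 0 gives Witt's formula 1 − Σ k_n tⁿ = ∏
(1 − tⁱ)^{ℓ_i}. Descending to `gr H` gives Kraft's inequality Σ k_n m⁻ⁿ ≤ 1, with partial sums below
1 if `H` is proper. Truncated statements are enough, so freeness of `H` itself is never needed.

Let a_n be the coefficients of 1/(1 − Σ k_n tⁿ), which count words of weight n. Witt's formula and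
its logarithmic derivative give ℓ_n ≤ a_n ≤ n(ℓ_1 + … + ℓ_n), so growth and word counts have the
same exponential rate (`IsWitt.hasBase`). Concatenation makes a_n supermultiplicative, and Kraft's
inequality gives a_n ≤ mⁿ; hence the rate exists. It exceeds 1 because a nonabelian `H` forces two
generators. If Σ k_n r⁻ⁿ = 1, the rate is r.

The leading parts of a finite irreducible set freely generate `gr H` (`freeFamily_of_irreducible`,
`gr_eq_of_free_lead`), so k_i counts its elements of degree i and the base solves the characteristic
equation.

To realize a base r when m ≥ 2, eliminate one generator: this gives an ideal of codimension one,
free on m − 1 generators in every degree. Write 1 = Σ e_n r⁻ⁿ with digits e_n ≤ m − 1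
(`exists_digits`) and keep e_n generators of degree n. They generate a retract of base r, and the
kernel of the retraction has cogrowth 1 + growth of the retract (`exists_retract`). -/

namespace FreeLieGrowth

/-! ### Generators, induction and functionals on a free Lie algebra. -/

section FreeBasics

open FreeLieAlgebra (of lift)

variable {F : Type*} [Field F] {ι : Type*} {G : Type*} [LieRing G] [LieAlgebra F G]

theorem lieSpan_range_of :
    LieSubalgebra.lieSpan F (FreeLieAlgebra F ι) (Set.range (of F)) = ⊤ := by
  set S := LieSubalgebra.lieSpan F (FreeLieAlgebra F ι) (Set.range (of F))
  let f : FreeLieAlgebra F ι →ₗ⁅F⁆ S :=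
    lift F (fun i => ⟨of F i, LieSubalgebra.subset_lieSpan ⟨i, rfl⟩⟩)
  have h : S.incl.comp f = LieHom.id := by
    ext i
    simp [f]
  refine eq_top_iff.2 fun x _ => ?_
  have hx : ((f x : S) : FreeLieAlgebra F ι) = x := LieHom.congr_fun h x
  rw [← hx]
  exact (f x).2

/-- Induction principle for free Lie algebras. -/
theorem free_induction {P : FreeLieAlgebra F ι → Prop} (mem : ∀ i, P (of F i)) (zero : P 0)
    (add : ∀ x y, P x → P y → P (x + y)) (smul : ∀ (a : F) x, P x → P (a • x))
    (lie : ∀ x y, P x → P y → P ⁅x, y⁆) (x : FreeLieAlgebra F ι) : P x := by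
  have hx : x ∈ LieSubalgebra.lieSpan F (FreeLieAlgebra F ι) (Set.range (of F)) := by
    rw [lieSpan_range_of]; trivial
  induction hx using LieSubalgebra.lieSpan_induction with
  | mem y hy => obtain ⟨i, rfl⟩ := hy; exact mem i
  | zero => exact zero
  | add _ _ _ _ hu hv => exact add _ _ hu hv
  | smul t _ _ hu => exact smul _ _ hu
  | lie _ _ _ _ hu hv => exact lie _ _ hu hv

theorem range_lift (b : ι → G) :
    (lift F b).range = LieSubalgebra.lieSpan F G (Set.range b) := by
  apply le_antisymm
  · rintro _ ⟨x, rfl⟩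
    change lift F b x ∈ _
    induction x using free_induction with
    | mem i => rw [FreeLieAlgebra.lift_of_apply]; exact LieSubalgebra.subset_lieSpan ⟨i, rfl⟩
    | zero => rw [map_zero]; exact zero_mem _
    | add x y hx hy => rw [map_add]; exact add_mem hx hy
    | smul a x hx => rw [map_smul]; exact SMulMemClass.smul_mem a hx
    | lie x y hx hy => rw [LieHom.map_lie]; exact LieSubalgebra.lie_mem _ hx hy
  · rw [LieSubalgebra.lieSpan_le]
    rintro _ ⟨i, rfl⟩
    exact ⟨of F i, FreeLieAlgebra.lift_of_apply b i⟩

section Functional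

attribute [local instance] LieRing.ofAssociativeRing

/-- A field with its commutator bracket is an abelian Lie algebra, so the universal property itself
yields functionals that kill brackets. They detect independence of generators modulo brackets and
cut out the ideals of codimension one. -/
theorem exists_functional (c : ι → F) :
    ∃ φ : FreeLieAlgebra F ι →ₗ[F] F, (∀ i, φ (of F i) = c i) ∧ ∀ x y : FreeLieAlgebra F ι, φ ⁅x, y⁆ = 0 := by
  refine ⟨(lift F c : FreeLieAlgebra F ι →ₗ⁅F⁆ F), fun i => ?_, fun x y => ?_⟩
  · exact FreeLieAlgebra.lift_of_apply c i
  · change (lift F c : FreeLieAlgebra F ι →ₗ⁅F⁆ F) ⁅x, y⁆ = 0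
    rw [LieHom.map_lie, LieRing.of_associative_ring_bracket, mul_comm, sub_self]

end Functional

theorem of_linearIndependent : LinearIndependent F (of F : ι → FreeLieAlgebra F ι) := by
  classical
  rw [linearIndependent_iff']
  intro s g hg i hi
  obtain ⟨φ, hφ, -⟩ := exists_functional (F := F) (fun j => if j = i then (1 : F) else 0)
  have := congrArg φ hg
  simpa [map_sum, hφ, Finset.sum_ite_eq', hi] using this

theorem of_injective : Function.Injective (of F : ι → FreeLieAlgebra F ι) :=
  of_linearIndependent.injective

end FreeBasics

/-! ### Positive gradings and homogeneous subalgebras. -/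

section Grading

variable {F : Type*} [Field F] {G : Type*} [LieRing G] [LieAlgebra F G]

/-- The projections `p n` onto the homogeneous components of a positive grading of a Lie algebra
with finite-dimensional components. -/
structure IsGrading (p : ℕ → G →ₗ[F] G) : Prop where
  proj_self : ∀ n x, p n (p n x) = p n x
  proj_of_ne : ∀ i j x, i ≠ j → p i (p j x) = 0
  iSup_range : ⨆ n, LinearMap.range (p n) = ⊤
  proj_lie : ∀ n x y, p n ⁅x, y⁆ = ∑ ij ∈ Finset.HasAntidiagonal.antidiagonal n, ⁅p ij.1 x, p ij.2 y⁆
  proj_zero : ∀ x, p 0 x = 0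
  finite : ∀ n, FiniteDimensional F (LinearMap.range (p n))

namespace IsGrading

variable {p : ℕ → G →ₗ[F] G}

theorem proj_proj (hp : IsGrading p) (i j : ℕ) (x : G) :
    p i (p j x) = if i = j then p j x else 0 := by
  split_ifs with h
  · rw [h, hp.proj_self]
  · exact hp.proj_of_ne i j x h

theorem proj_eq_zero (hp : IsGrading p) {i j : ℕ} {x : G} (hx : p j x = x) (h : i ≠ j) :
    p i x = 0 := by
  rw [← hx, hp.proj_of_ne i j x h]

theorem exists_bound (hp : IsGrading p) (x : G) :
    ∃ N, (∀ n, N ≤ n → p n x = 0) ∧ ∀ M, N ≤ M → ∑ i ∈ Finset.range M, p i x = x := by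
  have hx : x ∈ ⨆ n, LinearMap.range (p n) := by rw [hp.iSup_range]; trivial
  induction hx using Submodule.iSup_induction' with
  | mem i x hx =>
    obtain ⟨y, rfl⟩ := hx
    refine ⟨i + 1, fun n hn => hp.proj_of_ne _ _ _ (by omega), fun M hM => ?_⟩
    rw [Finset.sum_eq_single_of_mem i (Finset.mem_range.2 (by omega))
      (fun j _ hj => hp.proj_of_ne _ _ _ hj), hp.proj_self]
  | zero => exact ⟨0, by simp, by simp⟩
  | add x y _ _ hx hy =>
    obtain ⟨N, hN, hN'⟩ := hx
    obtain ⟨M, hM, hM'⟩ := hy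
    refine ⟨max N M, fun n hn => ?_, fun K hK => ?_⟩
    · rw [map_add, hN n (by omega), hM n (by omega), add_zero]
    · simp only [map_add, Finset.sum_add_distrib]
      rw [hN' K (by omega), hM' K (by omega)]

theorem ext (hp : IsGrading p) {x y : G} (h : ∀ n, p n x = p n y) : x = y := by
  obtain ⟨N, -, hN⟩ := hp.exists_bound x
  obtain ⟨M, -, hM⟩ := hp.exists_bound y
  rw [← hN (max N M) (le_max_left _ _), ← hM (max N M) (le_max_right _ _)]
  exact Finset.sum_congr rfl fun i _ => h i

theorem mem_of_proj_mem (hp : IsGrading p) {W : Submodule F G} {x : G} (h : ∀ n, p n x ∈ W) :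
    x ∈ W := by
  obtain ⟨N, -, hN⟩ := hp.exists_bound x
  rw [← hN N le_rfl]
  exact W.sum_mem fun i _ => h i

theorem lie_homogeneous (hp : IsGrading p) {i j : ℕ} {x y : G} (hx : p i x = x)
    (hy : p j y = y) : p (i + j) ⁅x, y⁆ = ⁅x, y⁆ := by
  rw [hp.proj_lie, Finset.sum_eq_single_of_mem (i, j) (by simp)]
  · rw [hx, hy]
  · rintro ⟨a, b⟩ hab hne
    by_cases ha : a = i
    · subst ha
      have : b ≠ j := fun hb => hne (by rw [hb])
      simp only [hp.proj_eq_zero hy this, lie_zero]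
    · simp only [hp.proj_eq_zero hx ha, zero_lie]

end IsGrading

/-- A subalgebra is homogeneous if it contains the components of its elements. -/
def IsHomogeneousSubalgebra (p : ℕ → G →ₗ[F] G) (H : LieSubalgebra F G) : Prop :=
  ∀ x ∈ H, ∀ n, p n x ∈ H

/-- The dimension of the projection of `H` to the `n`-th component. -/
noncomputable def dimComp (p : ℕ → G →ₗ[F] G) (H : LieSubalgebra F G) (n : ℕ) : ℕ :=
  Module.finrank F (H.toSubmodule.map (p n))

theorem isHomogeneous_lieSpan {p : ℕ → G →ₗ[F] G} (hp : IsGrading p) {s : Set G}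
    (hs : ∀ x ∈ s, ∃ n, p n x = x) :
    IsHomogeneousSubalgebra p (LieSubalgebra.lieSpan F G s) := by
  intro x hx
  induction hx using LieSubalgebra.lieSpan_induction with
  | mem y hy =>
    intro n
    obtain ⟨m, hm⟩ := hs y hy
    by_cases h : n = m
    · rw [h, hm]; exact LieSubalgebra.subset_lieSpan hy
    · rw [hp.proj_eq_zero hm h]; exact zero_mem _
  | zero => intro n; rw [map_zero]; exact zero_mem _
  | add _ _ _ _ hu hv => intro n; rw [map_add]; exact add_mem (hu n) (hv n)
  | smul t _ _ hu => intro n; rw [map_smul]; exact SMulMemClass.smul_mem t (hu n)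
  | lie _ _ _ _ hu hv =>
    intro n
    rw [hp.proj_lie]
    exact sum_mem fun ij _ => LieSubalgebra.lie_mem _ (hu _) (hv _)

end Grading

/-! ### The grading of a free Lie algebra by weighted generators. -/

section FreeGrading

open FreeLieAlgebra (of lift)
open scoped TensorProduct Polynomial

variable {F : Type*} [Field F] {ι : Type*} {G : Type*} [LieRing G] [LieAlgebra F G]

/-- The coefficient of `X ^ n` of an element of `F[X] ⊗ G`. -/
noncomputable def tensorCoeff (n : ℕ) : F[X] ⊗[F] G →ₗ[F] G :=
  (TensorProduct.lid F G).toLinearMap ∘ₗ (Polynomial.lcoeff F n).rTensor G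

@[simp]
theorem tensorCoeff_tmul (n : ℕ) (q : F[X]) (x : G) :
    tensorCoeff n (q ⊗ₜ[F] x) = q.coeff n • x := by
  simp [tensorCoeff]

/-- The bracket multiplies the polynomial factors, so coefficients convolve. This one identity
produces both the grading (generators sent to `X ^ w i ⊗ of i`) and derivations (linear coefficient
of a deformation of the identity). -/
theorem tensorCoeff_lie (n : ℕ) (u v : F[X] ⊗[F] G) :
    tensorCoeff n (@Bracket.bracket (F[X] ⊗[F] G) (F[X] ⊗[F] G) LieRing.toBracket u v) =
      ∑ ij ∈ Finset.HasAntidiagonal.antidiagonal n, ⁅tensorCoeff ij.1 u, tensorCoeff ij.2 v⁆ := by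
  induction u using TensorProduct.induction_on with
  | zero => exact (congrArg (tensorCoeff n) (zero_lie v)).trans (by simp)
  | add a b ha hb =>
    refine (congrArg (tensorCoeff n) (add_lie a b v)).trans
      ((map_add (tensorCoeff n) _ _).trans ?_)
    simp only [map_add, add_lie, Finset.sum_add_distrib]
    exact congrArg₂ (· + ·) ha hb
  | tmul q x =>
    induction v using TensorProduct.induction_on with
    | zero => exact (congrArg (tensorCoeff n) (lie_zero (q ⊗ₜ[F] x))).trans (by simp)
    | add a b ha hb =>
      refine (congrArg (tensorCoeff n) (lie_add (q ⊗ₜ[F] x) a b)).trans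
        ((map_add (tensorCoeff n) _ _).trans ?_)
      simp only [map_add, lie_add, Finset.sum_add_distrib]
      exact congrArg₂ (· + ·) ha hb
    | tmul r y =>
      refine (congrArg (tensorCoeff n)
        (LieAlgebra.ExtendScalars.bracket_tmul F F[X] G G q r x y)).trans ?_
      simp only [tensorCoeff_tmul, Polynomial.coeff_mul,
        Finset.sum_smul, smul_lie, lie_smul, smul_smul]
      refine Finset.sum_congr rfl fun ij _ => ?_
      rw [mul_comm]

/-- The homomorphism `L → F[X] ⊗ L` that multiplies each component by a power of `X`. -/
noncomputable def weightHom (F : Type*) [Field F] {ι : Type*} (w : ι → ℕ) :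
    FreeLieAlgebra F ι →ₗ⁅F⁆ F[X] ⊗[F] FreeLieAlgebra F ι :=
  lift F fun i => (Polynomial.X ^ w i : F[X]) ⊗ₜ[F] of F i

/-- The projection to the `n`-th component of a free Lie algebra with weighted generators. -/
noncomputable def freeProj (F : Type*) [Field F] {ι : Type*} (w : ι → ℕ) (n : ℕ) :
    FreeLieAlgebra F ι →ₗ[F] FreeLieAlgebra F ι :=
  tensorCoeff n ∘ₗ (weightHom F w : FreeLieAlgebra F ι →ₗ[F] F[X] ⊗[F] FreeLieAlgebra F ι)

theorem freeProj_apply (w : ι → ℕ) (n : ℕ) (x : FreeLieAlgebra F ι) :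
    freeProj F w n x = tensorCoeff n (weightHom F w x) := rfl

theorem freeProj_of (w : ι → ℕ) (n : ℕ) (i : ι) :
    freeProj F w n (of F i) = if n = w i then of F i else 0 := by
  rw [freeProj_apply, weightHom, FreeLieAlgebra.lift_of_apply, tensorCoeff_tmul,
    Polynomial.coeff_X_pow, ite_smul, one_smul, zero_smul]

theorem freeProj_of_self (w : ι → ℕ) (i : ι) :
    freeProj F w (w i) (of F i) = of F i := by
  rw [freeProj_of, if_pos rfl]

theorem freeProj_lie (w : ι → ℕ) (n : ℕ) (x y : FreeLieAlgebra F ι) :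
    freeProj F w n ⁅x, y⁆ = ∑ ij ∈ Finset.HasAntidiagonal.antidiagonal n,
      ⁅freeProj F w ij.1 x, freeProj F w ij.2 y⁆ := by
  simp only [freeProj_apply, LieHom.map_lie, tensorCoeff_lie]

/-- Positive weights kill degree `0`. Hence a bracket of degree `n` involves only smaller degrees,
and finite dimensionality follows by strong induction. -/
theorem isGrading_freeProj [Finite ι] (w : ι → ℕ) (hw : ∀ i, w i ≠ 0) :
    IsGrading (freeProj F w) := by
  have zero : ∀ x : FreeLieAlgebra F ι, freeProj F w 0 x = 0 := by
    intro x
    induction x using free_induction with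
    | mem i => rw [freeProj_of, if_neg (hw i).symm]
    | zero => exact map_zero _
    | add x y hx hy => rw [map_add, hx, hy, add_zero]
    | smul a x hx => rw [map_smul, hx, smul_zero]
    | lie x y hx hy => rw [freeProj_lie]; simp [hx]
  have lie_hom : ∀ (k i j : ℕ) (x y : FreeLieAlgebra F ι),
      (∀ a, freeProj F w a x = if a = i then x else 0) →
      (∀ a, freeProj F w a y = if a = j then y else 0) →
      freeProj F w k ⁅x, y⁆ = if k = i + j then ⁅x, y⁆ else 0 := by
    intro k i j x y hx hy
    rw [freeProj_lie]
    split_ifs with h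
    · rw [Finset.sum_eq_single_of_mem (i, j) (by simp [h])]
      · simp [hx, hy]
      · rintro ⟨a, b⟩ hab hne
        have := Finset.HasAntidiagonal.mem_antidiagonal.1 hab
        simp only [hx, hy]
        split_ifs with h1 h2
        · exact absurd (by rw [h1, h2]) hne
        all_goals simp
    · refine Finset.sum_eq_zero ?_
      rintro ⟨a, b⟩ hab
      have := Finset.HasAntidiagonal.mem_antidiagonal.1 hab
      simp only [hx, hy]
      split_ifs with h1 h2
      · simp only at this; omega
      all_goals simp
  have pp : ∀ (x : FreeLieAlgebra F ι) (i j : ℕ),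
      freeProj F w i (freeProj F w j x) = if i = j then freeProj F w j x else 0 := by
    intro x
    induction x using free_induction with
    | mem l =>
      intro i j
      rw [freeProj_of]
      split_ifs with h1 h2 <;> simp_all [freeProj_of]
    | zero => intro i j; simp
    | add x y hx hy => intro i j; rw [map_add, map_add, hx, hy]; split_ifs <;> simp
    | smul a x hx => intro i j; rw [map_smul, map_smul, hx]; split_ifs <;> simp
    | lie x y hx hy =>
      intro i j
      rw [freeProj_lie, map_sum]
      rw [Finset.sum_congr rfl fun ab _ =>
        lie_hom i ab.1 ab.2 _ _ (fun a => hx a _) (fun a => hy a _)]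
      split_ifs with h
      · refine Finset.sum_congr rfl fun ab hab => ?_
        rw [if_pos (by rw [h, Finset.HasAntidiagonal.mem_antidiagonal.1 hab])]
      · refine Finset.sum_eq_zero fun ab hab => ?_
        rw [if_neg (by rw [Finset.HasAntidiagonal.mem_antidiagonal.1 hab]; exact h)]
  have mem_sup : ∀ x : FreeLieAlgebra F ι, x ∈ ⨆ n, LinearMap.range (freeProj F w n) := by
    intro x
    induction x using free_induction with
    | mem i => exact Submodule.mem_iSup_of_mem (w i) ⟨of F i, freeProj_of_self w i⟩
    | zero => exact zero_mem _
    | add x y hx hy => exact add_mem hx hy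
    | smul a x hx => exact Submodule.smul_mem _ a hx
    | lie x y hx hy =>
      induction hx using Submodule.iSup_induction' with
      | mem i x hx =>
        induction hy using Submodule.iSup_induction' with
        | mem j y hy =>
          obtain ⟨x, rfl⟩ := hx
          obtain ⟨y, rfl⟩ := hy
          refine Submodule.mem_iSup_of_mem (i + j) ⟨⁅freeProj F w i x, freeProj F w j y⁆, ?_⟩
          rw [lie_hom (i + j) i j _ _ (fun a => pp x a i) (fun a => pp y a j), if_pos rfl]
        | zero => rw [lie_zero]; exact zero_mem _
        | add x y _ _ hx hy => rw [lie_add]; exact add_mem hx hy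
      | zero => rw [zero_lie]; exact zero_mem _
      | add x y _ _ hx hy => rw [add_lie]; exact add_mem hx hy
  have fin : ∀ n, (LinearMap.range (freeProj F w n)).FG := by
    intro n
    induction n using Nat.strong_induction_on with
    | _ n ih =>
    let V : Submodule F (FreeLieAlgebra F ι) := Submodule.span F (Set.range (of F)) ⊔
      ⨆ ij : Fin n × Fin n, Submodule.map₂ (LieModule.toEnd F (FreeLieAlgebra F ι)
        (FreeLieAlgebra F ι) : FreeLieAlgebra F ι →ₗ[F] FreeLieAlgebra F ι →ₗ[F] FreeLieAlgebra F ι)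
        (LinearMap.range (freeProj F w ij.1)) (LinearMap.range (freeProj F w ij.2))
    have hV : V.FG := by
      refine Submodule.FG.sup (Submodule.fg_span (Set.finite_range _)) ?_
      exact Submodule.fg_iSup _ fun ij => (ih _ ij.1.2).map₂ _ (ih _ ij.2.2)
    have key : ∀ x : FreeLieAlgebra F ι, freeProj F w n x ∈ V := by
      intro x
      induction x using free_induction with
      | mem i =>
        rw [freeProj_of]
        split_ifs
        · exact Submodule.mem_sup_left (Submodule.subset_span ⟨i, rfl⟩)
        · exact zero_mem _
      | zero => rw [map_zero]; exact zero_mem _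
      | add x y hx hy => rw [map_add]; exact add_mem hx hy
      | smul a x hx => rw [map_smul]; exact Submodule.smul_mem _ a hx
      | lie x y hx hy =>
        rw [freeProj_lie]
        refine sum_mem ?_
        rintro ⟨a, b⟩ hab
        have hab := Finset.HasAntidiagonal.mem_antidiagonal.1 hab
        rcases Nat.eq_zero_or_pos a with rfl | ha
        · simp [zero]
        rcases Nat.eq_zero_or_pos b with rfl | hb
        · simp [zero]
        simp only at hab
        refine Submodule.mem_sup_right (Submodule.mem_iSup_of_mem
          (⟨⟨a, by omega⟩, ⟨b, by omega⟩⟩ : Fin n × Fin n) ?_)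
        exact Submodule.apply_mem_map₂ _ ⟨x, rfl⟩ ⟨y, rfl⟩
    have : FiniteDimensional F V := Module.Finite.iff_fg.2 hV
    refine Module.Finite.iff_fg.1 (Submodule.finiteDimensional_of_le (S₂ := V) ?_)
    rintro _ ⟨x, rfl⟩
    exact key x
  refine ⟨fun n x => ?_, fun i j x h => ?_, eq_top_iff.2 fun x _ => mem_sup x,
    freeProj_lie w, zero, fun n => Module.Finite.iff_fg.2 (fin n)⟩
  · rw [pp, if_pos rfl]
  · rw [pp, if_neg h]

end FreeGrading

/-! ### Elimination of one free generator. -/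

section Elimination

open FreeLieAlgebra (of lift)
open scoped TensorProduct Polynomial

variable {F : Type*} [Field F] {ι : Type*} {G : Type*} [LieRing G] [LieAlgebra F G]

/-- Every map from the generators of a free Lie algebra extends to a derivation. -/
theorem exists_derivation (s : ι → FreeLieAlgebra F ι) :
    ∃ D : LieDerivation F (FreeLieAlgebra F ι) (FreeLieAlgebra F ι), ∀ i, D (of F i) = s i := by
  -- A deformation `x + X • D x + ⋯` of the identity. As the constant coefficient is `x` itself
  -- (`h0`), the linear coefficient satisfies the Leibniz rule.
  let δ : FreeLieAlgebra F ι →ₗ⁅F⁆ F[X] ⊗[F] FreeLieAlgebra F ι :=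
    lift F fun i => (1 : F[X]) ⊗ₜ[F] of F i + (Polynomial.X : F[X]) ⊗ₜ[F] s i
  have hδ : ∀ i, δ (of F i) = (1 : F[X]) ⊗ₜ[F] of F i + (Polynomial.X : F[X]) ⊗ₜ[F] s i :=
    fun i => FreeLieAlgebra.lift_of_apply _ i
  have h0 : ∀ x, tensorCoeff 0 (δ x) = x := by
    intro x
    induction x using free_induction with
    | mem i => rw [hδ, map_add, tensorCoeff_tmul, tensorCoeff_tmul]; simp
    | zero => simp
    | add x y hx hy => rw [map_add, map_add, hx, hy]
    | smul a x hx => rw [map_smul, map_smul, hx]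
    | lie x y hx hy => rw [LieHom.map_lie, tensorCoeff_lie]; simp [hx, hy]
  let f : FreeLieAlgebra F ι →ₗ[F] FreeLieAlgebra F ι :=
    tensorCoeff 1 ∘ₗ (δ : FreeLieAlgebra F ι →ₗ[F] F[X] ⊗[F] FreeLieAlgebra F ι)
  have hf : ∀ x, f x = tensorCoeff 1 (δ x) := fun _ => rfl
  refine ⟨⟨f, fun x y => ?_⟩, fun i => ?_⟩
  · have : Finset.HasAntidiagonal.antidiagonal 1 = {((0 : ℕ), (1 : ℕ)), (1, 0)} := rfl
    rw [hf, hf, hf, LieHom.map_lie, tensorCoeff_lie, this, Finset.sum_pair (by simp), h0, h0,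
      ← lie_skew y]
    abel
  · change f (of F i) = s i
    rw [hf, hδ, map_add, tensorCoeff_tmul, tensorCoeff_tmul]
    simp [Polynomial.coeff_one]

/-- The iterated bracket `⁅u, ⁅u, …, ⁅u, x⁆⁆⁆` with `j` copies of `u`. -/
def adIter (u : G) (j : ℕ) (x : G) : G := (fun y => ⁅u, y⁆)^[j] x

theorem adIter_zero (u x : G) : adIter u 0 x = x := rfl

theorem adIter_succ (u x : G) (j : ℕ) : adIter u (j + 1) x = ⁅u, adIter u j x⁆ :=
  Function.iterate_succ_apply' _ _ _

theorem map_adIter {G' : Type*} [LieRing G'] [LieAlgebra F G'] (f : G →ₗ⁅F⁆ G') (u x : G) (j : ℕ) :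
    f (adIter u j x) = adIter (f u) j (f x) := by
  induction j with
  | zero => rfl
  | succ j ih => rw [adIter_succ, adIter_succ, LieHom.map_lie, ih]

/-- The generators obtained from the family `b` by eliminating `b i₀`, after the other generators
are corrected by multiples of `b i₀`. -/
def elimFamily (b : ι → G) (i₀ : ι) (c : ι → F) (k : {i // i ≠ i₀} × ℕ) : G :=
  adIter (b i₀) k.2 (b k.1 - c k.1 • b i₀)

/-- The weights of the family `elimFamily`. -/
def elimWeight (w : ι → ℕ) (i₀ : ι) (k : {i // i ≠ i₀} × ℕ) : ℕ := w k.1 + k.2 * w i₀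

theorem lift_elimFamily_of (b : ι → G) (i₀ : ι) (c : ι → F) (k : {i // i ≠ i₀} × ℕ) :
    lift F b (elimFamily (of F) i₀ c k) = elimFamily b i₀ c k := by
  simp only [elimFamily, map_adIter, FreeLieAlgebra.lift_of_apply, map_sub, map_smul]

theorem lift_lift_elimFamily (b : ι → G) (i₀ : ι) (c : ι → F)
    (x : FreeLieAlgebra F ({i // i ≠ i₀} × ℕ)) :
    lift F b (lift F (elimFamily (of F) i₀ c) x) = lift F (elimFamily b i₀ c) x := by
  have : (lift F b).comp (lift F (elimFamily (of F) i₀ c)) = lift F (elimFamily b i₀ c) := by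
    ext k
    simp [lift_elimFamily_of]
  exact LieHom.congr_fun this x

/-- The free Lie algebra `C` on the pairs `(i, j)` has a derivation `D` shifting `j`. Sending `of
i₀` to `D` and the other generators to `of (i, 0) + c i • D` in the semidirect sum of `C` and its
derivations maps the eliminated family back to the free generators of `C`, so it satisfies no
relation. -/
theorem lift_elimFamily_injective (i₀ : ι) (c : ι → F) :
    Function.Injective (lift F (elimFamily (of F) i₀ c)) := by
  classical
  set C := FreeLieAlgebra F ({i // i ≠ i₀} × ℕ)
  obtain ⟨D, hD⟩ := exists_derivation (F := F)
    (fun k : {i // i ≠ i₀} × ℕ => of F ((k.1, k.2 + 1) : {i // i ≠ i₀} × ℕ))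
  let ψ : LieDerivation F C C →ₗ⁅F⁆ LieDerivation F C C := LieHom.id
  let g : FreeLieAlgebra F ι →ₗ⁅F⁆ LieAlgebra.SemiDirectSum C (LieDerivation F C C) ψ :=
    lift F fun i => if h : i = i₀ then ⟨0, D⟩ else ⟨of F (⟨i, h⟩, 0), c i • D⟩
  have hg0 : g (of F i₀) = ⟨0, D⟩ := by
    rw [FreeLieAlgebra.lift_of_apply, dif_pos rfl]
  have hgi : ∀ i : {i // i ≠ i₀}, g (of F i.1) = ⟨of F (i, 0), c i • D⟩ := by
    intro i
    rw [FreeLieAlgebra.lift_of_apply, dif_neg i.2]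
  have key : ∀ (i : {i // i ≠ i₀}) (j : ℕ),
      g (adIter (of F i₀) j (of F i.1 - c i • of F i₀)) = ⟨of F (i, j), 0⟩ := by
    intro i j
    induction j with
    | zero =>
      rw [adIter_zero, map_sub, map_smul, hg0, hgi]
      simp
    | succ j ih =>
      rw [adIter_succ, LieHom.map_lie, ih, hg0]
      simp [ψ, hD]
  have comp : g.comp (lift F (elimFamily (of F) i₀ c)) = LieAlgebra.SemiDirectSum.inl ψ := by
    ext k
    · simp [elimFamily, key]
    · simp [elimFamily, key]
  intro x y hxy
  have hx := LieHom.congr_fun comp x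
  have hy := LieHom.congr_fun comp y
  apply LieAlgebra.SemiDirectSum.inl_injective ψ
  rw [← hx, ← hy, LieHom.comp_apply, LieHom.comp_apply, hxy]

/-- On the range of `f`, bracketing with `of i₀` is the shift derivation. Hence the line through `of
i₀` and this range together span a subalgebra, and it contains all generators. -/
theorem exists_eq_smul_add_lift_elimFamily (i₀ : ι) (c : ι → F) (x : FreeLieAlgebra F ι) :
    ∃ (s : F) (y : FreeLieAlgebra F ({i // i ≠ i₀} × ℕ)),
      x = s • of F i₀ + lift F (elimFamily (of F) i₀ c) y := by
  classical
  obtain ⟨D, hD⟩ := exists_derivation (F := F)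
    (fun k : {i // i ≠ i₀} × ℕ => of F ((k.1, k.2 + 1) : {i // i ≠ i₀} × ℕ))
  set f := lift F (elimFamily (of F : ι → FreeLieAlgebra F ι) i₀ c)
  have hf : ∀ y, ⁅of F i₀, f y⁆ = f (D y) := by
    intro y
    induction y using free_induction with
    | mem k =>
      rw [hD, FreeLieAlgebra.lift_of_apply, FreeLieAlgebra.lift_of_apply]
      exact (adIter_succ _ _ _).symm
    | zero => simp
    | add x y hx hy => simp only [map_add, lie_add, hx, hy]
    | smul a x hx => simp only [map_smul, lie_smul, hx]
    | lie x y hx hy =>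
      rw [LieHom.map_lie, leibniz_lie, hx, hy, LieDerivation.apply_lie_eq_add, map_add,
        LieHom.map_lie, LieHom.map_lie]
      abel
  induction x using free_induction with
  | mem i =>
    by_cases h : i = i₀
    · exact ⟨1, 0, by simp [h]⟩
    · refine ⟨c i, of F (⟨i, h⟩, 0), ?_⟩
      rw [FreeLieAlgebra.lift_of_apply, elimFamily, adIter_zero]
      simp
  | zero => exact ⟨0, 0, by simp⟩
  | add x y hx hy =>
    obtain ⟨s, u, rfl⟩ := hx
    obtain ⟨t, v, rfl⟩ := hy
    exact ⟨s + t, u + v, by rw [map_add, add_smul]; abel⟩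
  | smul a x hx =>
    obtain ⟨s, u, rfl⟩ := hx
    exact ⟨a * s, a • u, by rw [map_smul, smul_add, smul_smul]⟩
  | lie x y hx hy =>
    obtain ⟨s, u, rfl⟩ := hx
    obtain ⟨t, v, rfl⟩ := hy
    refine ⟨0, s • D v - t • D u + ⁅u, v⁆, ?_⟩
    have hu : ⁅f u, of F i₀⁆ = -f (D u) := by rw [← lie_skew, hf]
    simp only [add_lie, lie_add, smul_lie, lie_smul, lie_self, smul_zero, map_add, map_sub,
      map_smul, LieHom.map_lie, hf, hu, zero_smul]
    module

end Elimination

/-! ### Free families of homogeneous elements. -/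

section FreeFamily

open FreeLieAlgebra (of lift)

variable {F : Type*} [Field F] {ι : Type*} {G : Type*} [LieRing G] [LieAlgebra F G]

/-- A family of homogeneous elements that freely generates a subalgebra. -/
structure FreeFamily (p : ℕ → G →ₗ[F] G) (b : ι → G) (w : ι → ℕ) : Prop where
  injective : Function.Injective (lift F b)
  homogeneous : ∀ i, p (w i) (b i) = b i

/-- The number of elements of weight `n`. -/
noncomputable def count (w : ι → ℕ) (n : ℕ) : ℕ := {i | w i = n}.ncard

namespace FreeFamily

variable {p : ℕ → G →ₗ[F] G} {b : ι → G} {w : ι → ℕ}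

theorem linearIndependent (hb : FreeFamily p b w) : LinearIndependent F b := by
  have h : b = (lift F b : FreeLieAlgebra F ι →ₗ[F] G) ∘ of F := by
    ext i
    exact (FreeLieAlgebra.lift_of_apply b i).symm
  rw [h]
  exact of_linearIndependent.map' _ (LinearMap.ker_eq_bot.2 hb.injective)

theorem ne_zero (hb : FreeFamily p b w) (i : ι) : b i ≠ 0 := hb.linearIndependent.ne_zero i

theorem weight_ne_zero (hp : IsGrading p) (hb : FreeFamily p b w) (i : ι) : w i ≠ 0 := by
  intro h
  apply hb.ne_zero i
  rw [← hb.homogeneous i, h, hp.proj_zero]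

theorem finite_weight (hp : IsGrading p) (hb : FreeFamily p b w) (n : ℕ) :
    {i | w i = n}.Finite := by
  have := hp.finite n
  have hmem : ∀ i : {i | w i = n}, b i ∈ LinearMap.range (p n) := by
    rintro ⟨i, rfl⟩
    exact ⟨b i, hb.homogeneous i⟩
  have hli : LinearIndependent F (fun i : {i | w i = n} => b i) :=
    hb.linearIndependent.comp _ Subtype.val_injective
  have : LinearIndependent F
      (fun i : {i | w i = n} => (⟨b i, hmem i⟩ : LinearMap.range (p n))) :=
    LinearIndependent.of_comp (LinearMap.range (p n)).subtype hli
  exact Set.finite_coe_iff.1 this.finite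

theorem isHomogeneous_range (hp : IsGrading p) (hb : FreeFamily p b w) :
    IsHomogeneousSubalgebra p (lift F b).range := by
  rw [range_lift]
  refine isHomogeneous_lieSpan hp ?_
  rintro _ ⟨i, rfl⟩
  exact ⟨w i, hb.homogeneous i⟩

theorem mem_range (i : ι) : b i ∈ (lift F b).range :=
  ⟨of F i, FreeLieAlgebra.lift_of_apply b i⟩

/-- The condition on `c` keeps every corrected generator `b i - c i • b i₀` homogeneous. -/
theorem eliminate (hp : IsGrading p) (hb : FreeFamily p b w) (i₀ : ι) (c : ι → F)
    (hc : ∀ i, c i ≠ 0 → w i = w i₀) :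
    FreeFamily p (elimFamily b i₀ c) (elimWeight w i₀) := by
  refine ⟨fun x y hxy => ?_, ?_⟩
  · rw [← lift_lift_elimFamily b i₀ c x, ← lift_lift_elimFamily b i₀ c y] at hxy
    exact lift_elimFamily_injective i₀ c (hb.injective hxy)
  · rintro ⟨i, j⟩
    induction j with
    | zero =>
      simp only [elimFamily, elimWeight, adIter_zero, zero_mul, add_zero, map_sub, map_smul,
        hb.homogeneous]
      by_cases h : c i = 0
      · simp [h]
      · rw [hc i h, hb.homogeneous]
    | succ j ih =>
      simp only [elimFamily, elimWeight, adIter_succ] at ih ⊢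
      have := hp.lie_homogeneous (hb.homogeneous i₀) ih
      rwa [show w i + (j + 1) * w i₀ = w i₀ + (w i + j * w i₀) by ring]

end FreeFamily

theorem exists_eq_smul_add_of_mem_range (b : ι → G) (i₀ : ι) (c : ι → F) {x : G}
    (hx : x ∈ (lift F b).range) :
    ∃ s : F, ∃ y ∈ (lift F (elimFamily b i₀ c)).range, x = s • b i₀ + y := by
  obtain ⟨x, rfl⟩ := hx
  obtain ⟨s, y, rfl⟩ := exists_eq_smul_add_lift_elimFamily i₀ c x
  refine ⟨s, _, ⟨y, rfl⟩, ?_⟩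
  change lift F b _ = _ + lift F (elimFamily b i₀ c) y
  rw [map_add, map_smul, FreeLieAlgebra.lift_of_apply, lift_lift_elimFamily]

theorem range_elimFamily_le (b : ι → G) (i₀ : ι) (c : ι → F) :
    (lift F (elimFamily b i₀ c)).range ≤ (lift F b).range := by
  rintro _ ⟨y, rfl⟩
  exact ⟨_, lift_lift_elimFamily b i₀ c y⟩

/-- The new generators lie in the kernel of a functional that defines the elimination. -/
theorem apply_eq_zero_of_mem_range_elimFamily {b : ι → G} {i₀ : ι} {φ : G →ₗ[F] F}
    (hφ : φ (b i₀) = 1)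
    (hlie : ∀ x ∈ (lift F b).range, ∀ y ∈ (lift F b).range, φ ⁅x, y⁆ = 0) {x : G}
    (hx : x ∈ (lift F (elimFamily b i₀ (fun i => φ (b i)))).range) : φ x = 0 := by
  have hgen : ∀ (i : {i // i ≠ i₀}) (j : ℕ),
      adIter (b i₀) j (b i - φ (b i) • b i₀) ∈ (lift F b).range ∧
        φ (adIter (b i₀) j (b i - φ (b i) • b i₀)) = 0 := by
    intro i j
    induction j with
    | zero =>
      refine ⟨sub_mem (FreeFamily.mem_range _)
        (SMulMemClass.smul_mem _ (FreeFamily.mem_range _)), ?_⟩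
      rw [adIter_zero, map_sub, map_smul, hφ, smul_eq_mul, mul_one, sub_self]
    | succ j ih =>
      rw [adIter_succ]
      exact ⟨LieSubalgebra.lie_mem _ (FreeFamily.mem_range _) ih.1,
        hlie _ (FreeFamily.mem_range _) _ ih.1⟩
  have hx' := range_elimFamily_le _ _ _ hx
  rw [range_lift] at hx
  induction hx using LieSubalgebra.lieSpan_induction with
  | mem y hy => obtain ⟨k, rfl⟩ := hy; exact (hgen k.1 k.2).2
  | zero => exact map_zero _
  | add x y hx hy hu hv =>
    rw [← range_lift] at hx hy
    rw [map_add, hu (range_elimFamily_le _ _ _ hx), hv (range_elimFamily_le _ _ _ hy), add_zero]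
  | smul t x hx hu =>
    rw [← range_lift] at hx
    rw [map_smul, hu (range_elimFamily_le _ _ _ hx), smul_zero]
  | lie x y hx hy hu hv =>
    rw [← range_lift] at hx hy
    exact hlie _ (range_elimFamily_le _ _ _ hx) _ (range_elimFamily_le _ _ _ hy)

end FreeFamily

/-! ### Weight generating functions under elimination. -/

section Series

variable {ι : Type*}

/-- The generating function of the weights of a family. -/
noncomputable def weightSeries (w : ι → ℕ) : PowerSeries ℝ :=
  PowerSeries.mk fun n => (count w n : ℝ)

theorem count_eq_add {w : ι → ℕ} {i₀ : ι} (hw : ∀ n, {i | w i = n}.Finite) (n : ℕ) :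
    count w n = count (fun i : {i // i ≠ i₀} => w i) n + if n = w i₀ then 1 else 0 := by
  have h1 : count (fun i : {i // i ≠ i₀} => w i) n = ({i | w i = n} \ {i₀}).ncard := by
    rw [count, ← Set.ncard_image_of_injective _ Subtype.val_injective]
    congr 1
    ext i
    simp [and_comm]
  rw [h1, count]
  split_ifs with h
  · rw [Set.ncard_sdiff_singleton_add_one (by simp [h]) (hw n)]
  · rw [add_zero, Set.sdiff_singleton_eq_self (by simpa using fun h' => h h'.symm)]

/-- Pairs `(i, 0)` carry the old weights, and `(i, j) ↦ (i, j + 1)` raises the weight by `w i₀`.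
Finiteness matters because `ncard` of an infinite set is `0`. -/
theorem count_elimWeight {w : ι → ℕ} {i₀ : ι}
    (hw : ∀ n, {k | elimWeight w i₀ k = n}.Finite) (n : ℕ) :
    count (elimWeight w i₀) n = count (fun i : {i // i ≠ i₀} => w i) n +
      if w i₀ ≤ n then count (elimWeight w i₀) (n - w i₀) else 0 := by
  have h0 : Function.Injective (fun i : {i // i ≠ i₀} => (i, (0 : ℕ))) := fun i j h => by
    simpa using h
  have h1 : Function.Injective (fun k : {i // i ≠ i₀} × ℕ => (k.1, k.2 + 1)) := by
    rintro ⟨i, j⟩ ⟨i', j'⟩ h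
    simpa using h
  have hset : {k | elimWeight w i₀ k = n} =
      (fun i : {i // i ≠ i₀} => (i, (0 : ℕ))) '' {i | w i = n} ∪
        (fun k : {i // i ≠ i₀} × ℕ => (k.1, k.2 + 1)) ''
          {k | elimWeight w i₀ k + w i₀ = n} := by
    ext ⟨i, j⟩
    constructor
    · intro h
      simp only [elimWeight, Set.mem_ofPred_eq] at h
      cases j with
      | zero => exact Or.inl ⟨i, by simpa using h, rfl⟩
      | succ j => exact Or.inr ⟨(i, j), by simp only [elimWeight, Set.mem_ofPred_eq]; linarith, rfl⟩
    · rintro (⟨i', h, h'⟩ | ⟨⟨i', j'⟩, h, h'⟩)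
      · obtain ⟨rfl, rfl⟩ := Prod.mk.inj h'
        simpa [elimWeight] using h
      · obtain ⟨rfl, rfl⟩ := Prod.mk.inj h'
        simp only [elimWeight, Set.mem_ofPred_eq] at h ⊢
        linarith
  have hfin := hw n
  rw [hset, Set.finite_union] at hfin
  rw [count, hset, Set.ncard_union_eq _ hfin.1 hfin.2, Set.ncard_image_of_injective _ h0,
    Set.ncard_image_of_injective _ h1]
  · congr 1
    split_ifs with h
    · rw [count]
      congr 1
      ext k
      simp only [Set.mem_ofPred_eq]
      omega
    · rw [Set.ncard_eq_zero (Set.Finite.of_injOn (t := {k | elimWeight w i₀ k = n})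
        (fun k hk => ?_) h1.injOn (hw n))]
      · ext k
        simp only [Set.mem_ofPred_eq, Set.mem_empty_iff_false, iff_false]
        omega
      · simp only [Set.mem_ofPred_eq, elimWeight] at hk ⊢
        linarith
  · rw [Set.disjoint_left]
    rintro _ ⟨i, -, rfl⟩ ⟨k, -, hk⟩
    simp at hk

/-- With `W'` the new series and `a = w i₀`, the counts say `W' = (W - X ^ a) + X ^ a * W'`. -/
theorem one_sub_weightSeries {w : ι → ℕ} {i₀ : ι} (hw : ∀ n, {i | w i = n}.Finite)
    (hw' : ∀ n, {k | elimWeight w i₀ k = n}.Finite) :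
    1 - weightSeries w =
      (1 - weightSeries (elimWeight w i₀)) * (1 - PowerSeries.X ^ w i₀) := by
  have h : weightSeries w + weightSeries (elimWeight w i₀) * PowerSeries.X ^ w i₀ =
      PowerSeries.X ^ w i₀ + weightSeries (elimWeight w i₀) := by
    ext n
    rw [map_add, map_add, PowerSeries.coeff_mul_X_pow', PowerSeries.coeff_X_pow]
    simp only [weightSeries, PowerSeries.coeff_mk]
    rw [count_eq_add hw n (i₀ := i₀), count_elimWeight hw' n]
    push_cast
    split_ifs <;> ring
  linear_combination -h

end Series

/-! ### Truncated Witt products. -/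

section PowerSeriesAux

/-- The product of the factors `(1 - X ^ i) ^ ℓ i` for `1 ≤ i ≤ N`. -/
noncomputable def wittProd (ℓ : ℕ → ℕ) (N : ℕ) : PowerSeries ℝ :=
  ∏ i ∈ Finset.Icc 1 N, (1 - PowerSeries.X ^ i) ^ ℓ i

/-- Agreement up to degree `N` survives multiplication; finite truncations can therefore stand for
the infinite Witt product. -/
theorem coeff_mul_congr {f g : PowerSeries ℝ} {N : ℕ}
    (h : ∀ j ≤ N, PowerSeries.coeff j f = PowerSeries.coeff j g) (u : PowerSeries ℝ) :
    ∀ j ≤ N, PowerSeries.coeff j (f * u) = PowerSeries.coeff j (g * u) := by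
  intro j hj
  rw [PowerSeries.coeff_mul, PowerSeries.coeff_mul]
  refine Finset.sum_congr rfl fun ab hab => ?_
  have := Finset.HasAntidiagonal.mem_antidiagonal.1 hab
  rw [h _ (by omega)]

theorem wittProd_congr {ℓ ℓ' : ℕ → ℕ} {N : ℕ} (h : ∀ i ∈ Finset.Icc 1 N, ℓ i = ℓ' i) :
    wittProd ℓ N = wittProd ℓ' N :=
  Finset.prod_congr rfl fun i hi => by rw [h i hi]

theorem wittProd_zero (ℓ : ℕ → ℕ) : wittProd ℓ 0 = 1 := by simp [wittProd]

theorem wittProd_succ (ℓ : ℕ → ℕ) (N : ℕ) :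
    wittProd ℓ (N + 1) = wittProd ℓ N * (1 - PowerSeries.X ^ (N + 1)) ^ ℓ (N + 1) := by
  rw [wittProd, Finset.prod_Icc_succ_top (by omega), wittProd]

theorem wittProd_add (ℓ ℓ' : ℕ → ℕ) (N : ℕ) :
    wittProd (fun i => ℓ i + ℓ' i) N = wittProd ℓ N * wittProd ℓ' N := by
  simp only [wittProd, pow_add, Finset.prod_mul_distrib]

theorem wittProd_single {n N : ℕ} (hn : n ∈ Finset.Icc 1 N) :
    wittProd (fun i => if i = n then 1 else 0) N = 1 - PowerSeries.X ^ n := by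
  rw [wittProd, Finset.prod_eq_single_of_mem n hn]
  · simp
  · intro i _ hi
    simp [hi]

/-- `(1 - X ^ n) ^ m` agrees with `1 - m X ^ n` up to degree `n`. -/
theorem coeff_one_sub_X_pow_pow {n : ℕ} (hn : n ≠ 0) (m : ℕ) :
    ∀ j ≤ n, PowerSeries.coeff j ((1 - PowerSeries.X ^ n : PowerSeries ℝ) ^ m) =
      (if j = 0 then 1 else 0) - if j = n then (m : ℝ) else 0 := by
  induction m with
  | zero => intro j _; simp [PowerSeries.coeff_one]
  | succ m ih =>
    intro j hj
    rw [pow_succ, mul_sub, mul_one, map_sub, ih j hj, PowerSeries.coeff_mul_X_pow']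
    by_cases h : j = n
    · subst h
      rw [if_pos le_rfl, Nat.sub_self, ih 0 (Nat.zero_le _)]
      simp [hn, hn.symm]
      ring
    · rw [if_neg (show ¬ n ≤ j by omega)]
      simp [h]

theorem coeff_mul_one_sub_X_pow_pow {n : ℕ} (hn : n ≠ 0) (m : ℕ) (u : PowerSeries ℝ) {j : ℕ}
    (hj : j ≤ n) : PowerSeries.coeff j (u * (1 - PowerSeries.X ^ n) ^ m) =
      PowerSeries.coeff j u - if j = n then m * PowerSeries.coeff 0 u else 0 := by
  have h : ∀ i ≤ n, PowerSeries.coeff i ((1 - PowerSeries.X ^ n : PowerSeries ℝ) ^ m) =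
      PowerSeries.coeff i (1 - PowerSeries.C (m : ℝ) * PowerSeries.X ^ n) := by
    intro i hi
    rw [coeff_one_sub_X_pow_pow hn m i hi, map_sub, PowerSeries.coeff_one,
      PowerSeries.coeff_C_mul_X_pow]
  rw [mul_comm, coeff_mul_congr h u j hj, sub_mul, one_mul, map_sub, mul_assoc,
    PowerSeries.coeff_C_mul, PowerSeries.coeff_X_pow_mul']
  by_cases h' : j = n
  · subst h'; simp
  · rw [if_neg (by omega), if_neg h']; simp

theorem coeff_zero_wittProd (ℓ : ℕ → ℕ) (N : ℕ) : PowerSeries.coeff 0 (wittProd ℓ N) = 1 := by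
  induction N with
  | zero => simp [wittProd]
  | succ N ih =>
    rw [wittProd_succ, coeff_mul_one_sub_X_pow_pow (Nat.succ_ne_zero N) _ _ (Nat.zero_le _), ih]
    simp

theorem coeff_wittProd_of_le (ℓ : ℕ → ℕ) {n N : ℕ} (h : n ≤ N) :
    PowerSeries.coeff n (wittProd ℓ N) = PowerSeries.coeff n (wittProd ℓ n) := by
  induction N, h using Nat.le_induction with
  | base => rfl
  | succ N hN ih =>
    rw [wittProd_succ, coeff_mul_one_sub_X_pow_pow (Nat.succ_ne_zero N) _ _ (by omega), ih,
      if_neg (by omega), sub_zero]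

/-- The last exponent enters its own coefficient linearly, so the exponents can be recovered
recursively. -/
theorem coeff_succ_wittProd (ℓ : ℕ → ℕ) (n : ℕ) :
    PowerSeries.coeff (n + 1) (wittProd ℓ (n + 1)) =
      PowerSeries.coeff (n + 1) (wittProd ℓ n) - ℓ (n + 1) := by
  rw [wittProd_succ, coeff_mul_one_sub_X_pow_pow (Nat.succ_ne_zero n) _ _ le_rfl, if_pos rfl,
    coeff_zero_wittProd, mul_one]

/-- The exponents are determined by the coefficients of the product. -/
theorem eq_of_coeff_wittProd_eq {ℓ ℓ' : ℕ → ℕ} {N : ℕ}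
    (h : ∀ j ≤ N, PowerSeries.coeff j (wittProd ℓ j) = PowerSeries.coeff j (wittProd ℓ' j)) :
    ∀ i ∈ Finset.Icc 1 N, ℓ i = ℓ' i := by
  intro i
  induction i using Nat.strong_induction_on with
  | _ i ih =>
  intro hi
  obtain ⟨h1, h2⟩ := Finset.mem_Icc.1 hi
  obtain ⟨n, rfl⟩ : ∃ n, i = n + 1 := ⟨i - 1, by omega⟩
  have := h (n + 1) h2
  rw [coeff_succ_wittProd, coeff_succ_wittProd, wittProd_congr (ℓ := ℓ) (ℓ' := ℓ')] at this
  · exact_mod_cast sub_right_injective this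
  · intro j hj
    obtain ⟨hj1, hj2⟩ := Finset.mem_Icc.1 hj
    exact ih j (by omega) (Finset.mem_Icc.2 ⟨hj1, by omega⟩)

end PowerSeriesAux

/-! ### Descent from a free algebra to a homogeneous subalgebra. -/

section Chain

open FreeLieAlgebra (of lift)

variable {F : Type*} [Field F] {G : Type*} [LieRing G] [LieAlgebra F G]

theorem map_proj_eq_inf {p : ℕ → G →ₗ[F] G} {H : LieSubalgebra F G}
    (hH : IsHomogeneousSubalgebra p H) {n : ℕ} {x : G} (hx : x ∈ H.toSubmodule.map (p n)) :
    x ∈ H := by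
  obtain ⟨y, hy, rfl⟩ := hx
  exact hH y hy n

theorem finite_map_proj {p : ℕ → G →ₗ[F] G} (hp : IsGrading p) (W : Submodule F G) (n : ℕ) :
    FiniteDimensional F (W.map (p n)) :=
  have := hp.finite n
  Submodule.finiteDimensional_of_le (LinearMap.map_le_range)

/-- A proper homogeneous subalgebra is annihilated by a suitable functional in the least degree in
which it differs from the whole algebra. -/
theorem exists_homogeneous_functional {p : ℕ → G →ₗ[F] G} (hp : IsGrading p)
    {H E : LieSubalgebra F G} (hH : IsHomogeneousSubalgebra p H)
    {n : ℕ}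
    (hlt : ∀ i < n, E.toSubmodule.map (p i) ≤ H.toSubmodule.map (p i))
    (hn : ¬ E.toSubmodule.map (p n) ≤ H.toSubmodule.map (p n)) :
    ∃ φ : G →ₗ[F] F, (∀ x ∈ H, φ x = 0) ∧ (∀ x, φ (p n x) = φ x) ∧ (∃ x ∈ E, φ x ≠ 0) ∧
      ∀ x ∈ E, ∀ y ∈ E, φ ⁅x, y⁆ = 0 := by
  obtain ⟨z, hz, hz'⟩ := SetLike.not_le_iff_exists.1 hn
  obtain ⟨ψ, hψ, hψ'⟩ := Submodule.exists_dual_map_eq_bot_of_notMem hz' inferInstance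
  obtain ⟨x, hx, rfl⟩ := hz
  have hψH : ∀ y ∈ H, ψ (p n y) = 0 := by
    intro y hy
    have : ψ (p n y) ∈ (H.toSubmodule.map (p n)).map ψ := ⟨_, ⟨y, hy, rfl⟩, rfl⟩
    rwa [hψ', Submodule.mem_bot] at this
  refine ⟨ψ ∘ₗ p n, hψH, fun y => ?_, ⟨x, hx, hψ⟩, fun y hy z hz => ?_⟩
  · simp only [LinearMap.comp_apply, hp.proj_self]
  -- In each nonzero summand both factors have degree below `n`, where the components of `E` already
  -- lie in `H` by minimality of `n`. Hence the functional kills brackets of `E`.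
  · have hmem : p n ⁅y, z⁆ ∈ H := by
      rw [hp.proj_lie]
      refine sum_mem ?_
      rintro ⟨a, b⟩ hab
      have hab := Finset.HasAntidiagonal.mem_antidiagonal.1 hab
      simp only at hab ⊢
      rcases Nat.eq_zero_or_pos a with rfl | ha
      · rw [hp.proj_zero, zero_lie]; exact zero_mem _
      rcases Nat.eq_zero_or_pos b with rfl | hb
      · rw [hp.proj_zero, lie_zero]; exact zero_mem _
      exact LieSubalgebra.lie_mem _
        (map_proj_eq_inf hH (hlt a (by omega) ⟨y, hy, rfl⟩))
        (map_proj_eq_inf hH (hlt b (by omega) ⟨z, hz, rfl⟩))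
    have := hψH _ hmem
    rwa [hp.proj_self] at this

/-- One elimination step, for a functional that vanishes on brackets. -/
theorem FreeFamily.exists_step {ι : Type*} {p : ℕ → G →ₗ[F] G} (hp : IsGrading p)
    {b : ι → G} {w : ι → ℕ} (hb : FreeFamily p b w) {φ : G →ₗ[F] F} {n : ℕ}
    (hn : ∀ x, φ (p n x) = φ x) (hne : ∃ x ∈ (lift F b).range, φ x ≠ 0)
    (hlie : ∀ x ∈ (lift F b).range, ∀ y ∈ (lift F b).range, φ ⁅x, y⁆ = 0) :
    ∃ (i₀ : ι) (b' : {i // i ≠ i₀} × ℕ → G) (w' : {i // i ≠ i₀} × ℕ → ℕ), FreeFamily p b' w' ∧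
      (∀ x, x ∈ (lift F b').range ↔ x ∈ (lift F b).range ∧ φ x = 0) ∧
      1 - weightSeries w = (1 - weightSeries w') * (1 - PowerSeries.X ^ n) ∧
      n ≠ 0 ∧
      dimComp p (lift F b).range n = dimComp p (lift F b').range n + 1 ∧
      ∀ i ≠ n, (lift F b).range.toSubmodule.map (p i) = (lift F b').range.toSubmodule.map (p i) := by
  obtain ⟨i₀, hi₀⟩ : ∃ i, φ (b i) ≠ 0 := by
    by_contra! hcon
    have hzero : ∀ x ∈ (lift F b).range, φ x = 0 := by
      intro x hx
      rw [range_lift] at hx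
      induction hx using LieSubalgebra.lieSpan_induction with
      | mem y hy => obtain ⟨i, rfl⟩ := hy; exact hcon i
      | zero => exact map_zero _
      | add x y hx hy hu hv => rw [map_add, hu, hv, add_zero]
      | smul t x hx hu => rw [map_smul, hu, smul_zero]
      | lie x y hx hy hu hv =>
        rw [← range_lift] at hx hy
        exact hlie x hx y hy
    obtain ⟨x, hx, hx'⟩ := hne
    exact hx' (hzero x hx)
  -- Normalized to `1` on `b i₀`, the functional supplies the corrections `c i` as its values on the
  -- `b i`.
  obtain ⟨φ', hφ'⟩ : ∃ φ' : G →ₗ[F] F, ∀ x, φ' x = (φ (b i₀))⁻¹ * φ x :=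
    ⟨(φ (b i₀))⁻¹ • φ, fun _ => rfl⟩
  have hzero : ∀ x, φ' x = 0 ↔ φ x = 0 := fun x => by simp [hφ', hi₀]
  have h1 : φ' (b i₀) = 1 := by rw [hφ', inv_mul_cancel₀ hi₀]
  have hn' : ∀ x, φ' (p n x) = φ' x := fun x => by rw [hφ', hφ', hn]
  have hlie' : ∀ x ∈ (lift F b).range, ∀ y ∈ (lift F b).range, φ' ⁅x, y⁆ = 0 :=
    fun x hx y hy => (hzero _).2 (hlie x hx y hy)
  have hwt : ∀ i, φ' (b i) ≠ 0 → w i = n := by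
    intro i hi
    by_contra hne
    apply hi
    rw [← hn', hp.proj_eq_zero (hb.homogeneous i) (Ne.symm hne), map_zero]
  have hw₀ : w i₀ = n := hwt i₀ (by rw [h1]; exact one_ne_zero)
  have hb' := hb.eliminate hp i₀ (fun i => φ' (b i)) (fun i hi => (hwt i hi).trans hw₀.symm)
  have hrange : ∀ x, x ∈ (lift F (elimFamily b i₀ (fun i => φ' (b i)))).range ↔
      x ∈ (lift F b).range ∧ φ x = 0 := by
    intro x
    constructor
    · intro hx
      exact ⟨range_elimFamily_le _ _ _ hx,
        (hzero x).1 (apply_eq_zero_of_mem_range_elimFamily h1 hlie' hx)⟩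
    · rintro ⟨hx, hx'⟩
      obtain ⟨s, y, hy, rfl⟩ := exists_eq_smul_add_of_mem_range b i₀ (fun i => φ' (b i)) hx
      rw [← hzero, map_add, apply_eq_zero_of_mem_range_elimFamily h1 hlie' hy, map_smul, h1,
        smul_eq_mul, mul_one, add_zero] at hx'
      rw [hx', zero_smul, zero_add]
      exact hy
  have hhom := hb.isHomogeneous_range hp
  refine ⟨i₀, _, _, hb', hrange, ?_, ?_, ?_, ?_⟩
  · rw [← hw₀]
    exact one_sub_weightSeries (hb.finite_weight hp) (hb'.finite_weight hp)
  · rw [← hw₀]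
    exact hb.weight_ne_zero hp i₀
  · set E' := (lift F (elimFamily b i₀ (fun i => φ' (b i)))).range
    have hfin := finite_map_proj hp E'.toSubmodule n
    -- In degree `n` exactly the line through `b i₀` is lost; other degrees are untouched since `φ`
    -- factors through `p n`.
    have hsup : (lift F b).range.toSubmodule.map (p n) =
        E'.toSubmodule.map (p n) ⊔ Submodule.span F {b i₀} := by
      apply le_antisymm
      · rintro _ ⟨x, hx, rfl⟩
        obtain ⟨s, y, hy, rfl⟩ := exists_eq_smul_add_of_mem_range b i₀ (fun i => φ' (b i)) hx
        rw [map_add, map_smul, ← hw₀, hb.homogeneous, add_comm]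
        exact Submodule.add_mem_sup ⟨y, hy, rfl⟩
          (Submodule.smul_mem _ _ (Submodule.mem_span_singleton_self _))
      · refine sup_le (Submodule.map_mono fun x hx => ((hrange x).1 hx).1) ?_
        rw [Submodule.span_singleton_le_iff_mem]
        exact ⟨b i₀, FreeFamily.mem_range i₀, by rw [← hw₀, hb.homogeneous]⟩
    have hinf : E'.toSubmodule.map (p n) ⊓ Submodule.span F {b i₀} = ⊥ := by
      rw [eq_bot_iff]
      rintro _ ⟨⟨y, hy, rfl⟩, hz⟩
      obtain ⟨s, hs⟩ := Submodule.mem_span_singleton.1 hz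
      have h2 := congrArg φ' hs
      rw [map_smul, h1, hn', (hzero y).2 ((hrange y).1 hy).2, smul_eq_mul, mul_one] at h2
      rw [Submodule.mem_bot, ← hs, h2, zero_smul]
    have := Submodule.finrank_sup_add_finrank_inf_eq (E'.toSubmodule.map (p n))
      (Submodule.span F {b i₀})
    rw [hinf, finrank_bot, add_zero, finrank_span_singleton (hb.ne_zero i₀), ← hsup] at this
    exact this
  · intro i hi
    apply le_antisymm
    · rintro _ ⟨x, hx, rfl⟩
      refine ⟨p i x, (hrange _).2 ⟨hhom x hx i, ?_⟩, hp.proj_self i x⟩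
      rw [← hn, hp.proj_of_ne _ _ _ hi.symm, map_zero]
    · exact Submodule.map_mono fun x hx => ((hrange x).1 hx).1

/-- Every homogeneous subalgebra `H` of a free homogeneous subalgebra agrees in degrees at most `N`
with a larger free homogeneous subalgebra, whose generators are counted by the codimensions. -/
theorem FreeFamily.exists_chain.{u} {p : ℕ → G →ₗ[F] G} (hp : IsGrading p) {H : LieSubalgebra F G}
    (hH : IsHomogeneousSubalgebra p H) (N : ℕ) {ι : Type u} {b : ι → G} {w : ι → ℕ}
    (hb : FreeFamily p b w) (hle : H ≤ (lift F b).range) :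
    ∃ (ι' : Type u) (b' : ι' → G) (w' : ι' → ℕ), FreeFamily p b' w' ∧ H ≤ (lift F b').range ∧
      (∀ i ≤ N, (lift F b').range.toSubmodule.map (p i) = H.toSubmodule.map (p i)) ∧
      ∃ c : ℕ → ℕ, (∀ i ∈ Finset.Icc 1 N, c i + dimComp p H i = dimComp p (lift F b).range i) ∧
        1 - weightSeries w = (1 - weightSeries w') * wittProd c N := by
  -- Induction on the total dimension in degrees `1` to `N`, which each elimination lowers by one.
  obtain ⟨D, hD⟩ : ∃ D, ∑ i ∈ Finset.Icc 1 N, dimComp p (lift F b).range i = D := ⟨_, rfl⟩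
  induction D using Nat.strong_induction_on generalizing ι with
  | _ D ih =>
  by_cases hall : ∀ i ≤ N, (lift F b).range.toSubmodule.map (p i) ≤ H.toSubmodule.map (p i)
  · have heq : ∀ i ≤ N, (lift F b).range.toSubmodule.map (p i) = H.toSubmodule.map (p i) :=
      fun i hi => le_antisymm (hall i hi) (Submodule.map_mono hle)
    refine ⟨ι, b, w, hb, hle, heq, fun _ => 0, fun i hi => ?_, by simp [wittProd]⟩
    rw [zero_add, dimComp, dimComp, heq i (Finset.mem_Icc.1 hi).2]
  · classical
    push Not at hall
    obtain ⟨hnN, hn⟩ := Nat.find_spec hall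
    have hmin : ∀ i < Nat.find hall,
        (lift F b).range.toSubmodule.map (p i) ≤ H.toSubmodule.map (p i) := by
      intro i hi
      have := Nat.find_min hall hi
      push Not at this
      exact this (by omega)
    set n := Nat.find hall
    obtain ⟨φ, hφH, hφn, hφne, hφlie⟩ := exists_homogeneous_functional hp hH hmin hn
    obtain ⟨i₀, b', w', hb', hmem, hser, hn0, hdim, hmap⟩ := hb.exists_step hp hφn hφne hφlie
    have hnmem : n ∈ Finset.Icc 1 N := Finset.mem_Icc.2 ⟨by omega, hnN⟩
    have hdims : ∀ i, dimComp p (lift F b).range i =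
        dimComp p (lift F b').range i + if i = n then 1 else 0 := by
      intro i
      split_ifs with h
      · rw [h, hdim]
      · rw [dimComp, hmap i h, dimComp, add_zero]
    have hsum : ∑ i ∈ Finset.Icc 1 N, dimComp p (lift F b).range i =
        ∑ i ∈ Finset.Icc 1 N, dimComp p (lift F b').range i + 1 := by
      simp only [hdims, Finset.sum_add_distrib, Finset.sum_ite_eq', if_pos hnmem]
    obtain ⟨ι', b'', w'', hb'', hle'', heq'', c, hc, hser'⟩ := ih _ (by omega) hb'
      (fun x hx => (hmem x).2 ⟨hle hx, hφH x hx⟩) rfl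
    refine ⟨ι', b'', w'', hb'', hle'', heq'', fun i => c i + if i = n then 1 else 0,
      fun i hi => ?_, ?_⟩
    · rw [hdims, ← hc i hi]
      dsimp only
      omega
    · rw [wittProd_add, wittProd_single hnmem, hser, hser', mul_assoc]

/-- Witt's formula up to degree `N` for a subalgebra that agrees with a free one up to degree `N`. -/
theorem FreeFamily.coeff_one_sub_weightSeries {ι : Type*} {p : ℕ → G →ₗ[F] G} (hp : IsGrading p)
    {b : ι → G} {w : ι → ℕ} (hb : FreeFamily p b w) (N : ℕ) :
    PowerSeries.coeff N (1 - weightSeries w) =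
      PowerSeries.coeff N (wittProd (dimComp p (lift F b).range) N) := by
  have hbot : IsHomogeneousSubalgebra p (⊥ : LieSubalgebra F G) := by
    intro x hx n
    rw [LieSubalgebra.mem_bot] at hx ⊢
    rw [hx, map_zero]
  -- Descent to `0` leaves a free family without members of weight at most `N`, so only the Witt
  -- product remains in these degrees.
  obtain ⟨ι', b', w', hb', -, heq, c, hc, hser⟩ := hb.exists_chain hp hbot N bot_le
  have hw' : ∀ i ≤ N, PowerSeries.coeff i (1 - weightSeries w') =
      PowerSeries.coeff i (1 : PowerSeries ℝ) := by
    intro i hi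
    rw [map_sub, sub_eq_self, weightSeries, PowerSeries.coeff_mk, Nat.cast_eq_zero, count,
      Set.ncard_eq_zero (hb'.finite_weight hp i)]
    ext k
    simp only [Set.mem_ofPred_eq, Set.mem_empty_iff_false, iff_false]
    rintro rfl
    have hk : b' k ∈ (lift F b').range.toSubmodule.map (p (w' k)) :=
      ⟨b' k, FreeFamily.mem_range k, hb'.homogeneous k⟩
    rw [heq _ hi] at hk
    simp at hk
    exact hb'.ne_zero k hk
  rw [hser, coeff_mul_congr hw' _ N le_rfl, one_mul]
  refine congrArg _ (wittProd_congr fun i hi => ?_)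
  rw [← hc i hi]
  simp [dimComp]

end Chain

/-! ### Word counts, and their comparison with the dimensions in Witt's formula. -/

section WordCount

/-- The power series with natural coefficients `k`. -/
noncomputable def genSeries (k : ℕ → ℕ) : PowerSeries ℝ := PowerSeries.mk fun n => (k n : ℝ)

/-- The number of words of weight `n` in an alphabet with `k i` letters of weight `i`. -/
noncomputable def wordCount (k : ℕ → ℕ) (n : ℕ) : ℝ :=
  PowerSeries.coeff n (1 - genSeries k)⁻¹

variable {k ℓ : ℕ → ℕ}

theorem constantCoeff_one_sub_genSeries (h0 : k 0 = 0) :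
    PowerSeries.constantCoeff (1 - genSeries k) = 1 := by
  rw [map_sub, map_one, ← PowerSeries.coeff_zero_eq_constantCoeff_apply, genSeries,
    PowerSeries.coeff_mk, h0, Nat.cast_zero, sub_zero]

theorem mul_inv_one_sub_genSeries (h0 : k 0 = 0) : (1 - genSeries k) * (1 - genSeries k)⁻¹ = 1 := by
  apply PowerSeries.mul_inv_cancel
  rw [constantCoeff_one_sub_genSeries h0]
  exact one_ne_zero

theorem wordCount_zero (h0 : k 0 = 0) : wordCount k 0 = 1 := by
  rw [wordCount, PowerSeries.coeff_zero_eq_constantCoeff_apply, PowerSeries.constantCoeff_inv,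
    constantCoeff_one_sub_genSeries h0, inv_one]

/-- Split off the first letter of a word. -/
theorem wordCount_eq_sum (h0 : k 0 = 0) {n : ℕ} (hn : n ≠ 0) :
    wordCount k n = ∑ i ∈ Finset.range (n + 1), (k i : ℝ) * wordCount k (n - i) := by
  have h : (1 - genSeries k)⁻¹ = 1 + genSeries k * (1 - genSeries k)⁻¹ := by
    linear_combination mul_inv_one_sub_genSeries h0
  rw [wordCount, h, map_add, PowerSeries.coeff_one, if_neg hn, zero_add, PowerSeries.coeff_mul,
    Finset.Nat.sum_antidiagonal_eq_sum_range_succ_mk]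
  refine Finset.sum_congr rfl fun i _ => ?_
  simp [genSeries, wordCount]

theorem wordCount_nonneg (h0 : k 0 = 0) (n : ℕ) : 0 ≤ wordCount k n := by
  induction n using Nat.strong_induction_on with
  | _ n ih =>
  rcases eq_or_ne n 0 with rfl | hn
  · rw [wordCount_zero h0]; exact zero_le_one
  · rw [wordCount_eq_sum h0 hn]
    refine Finset.sum_nonneg fun i _ => ?_
    rcases Nat.eq_zero_or_pos i with rfl | hi
    · simp [h0]
    · exact mul_nonneg (Nat.cast_nonneg _) (ih _ (by omega))

theorem le_wordCount (h0 : k 0 = 0) (n : ℕ) : (k n : ℝ) ≤ wordCount k n := by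
  rcases eq_or_ne n 0 with rfl | hn
  · rw [h0, Nat.cast_zero]; exact wordCount_nonneg h0 0
  · rw [wordCount_eq_sum h0 hn]
    have := Finset.single_le_sum (f := fun i => (k i : ℝ) * wordCount k (n - i))
      (fun i _ => mul_nonneg (Nat.cast_nonneg _) (wordCount_nonneg h0 _))
      (Finset.self_mem_range_succ n)
    simpa [wordCount_zero h0] using this

/-- Concatenating words of fixed weights is injective; the recursion on the first letter expresses
this as an induction. -/
theorem wordCount_mul_le (h0 : k 0 = 0) (m n : ℕ) :
    wordCount k m * wordCount k n ≤ wordCount k (m + n) := by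
  induction m using Nat.strong_induction_on with
  | _ m ih =>
  rcases eq_or_ne m 0 with rfl | hm
  · rw [wordCount_zero h0, one_mul, zero_add]
  · rw [wordCount_eq_sum h0 hm, wordCount_eq_sum h0 (n := m + n) (by omega), Finset.sum_mul]
    refine le_trans (Finset.sum_le_sum
      (g := fun i => (k i : ℝ) * wordCount k (m + n - i)) fun i hi => ?_)
      (Finset.sum_le_sum_of_subset_of_nonneg
        (Finset.range_mono (by omega)) fun i _ _ =>
          mul_nonneg (Nat.cast_nonneg _) (wordCount_nonneg h0 _))
    rcases Nat.eq_zero_or_pos i with rfl | hi0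
    · simp [h0]
    · have hi' : i ≤ m := by simpa [Nat.lt_succ_iff] using hi
      rw [mul_assoc, show m + n - i = m - i + n by omega]
      exact mul_le_mul_of_nonneg_left (ih _ (by omega)) (Nat.cast_nonneg _)

theorem wordCount_pow_le (h0 : k 0 = 0) (n q : ℕ) :
    wordCount k n ^ q ≤ wordCount k (n * q) := by
  induction q with
  | zero => rw [pow_zero, mul_zero, wordCount_zero h0]
  | succ q ih =>
    rw [pow_succ, Nat.mul_succ]
    exact (mul_le_mul_of_nonneg_right ih (wordCount_nonneg h0 n)).trans (wordCount_mul_le h0 _ _)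

/-- After division by `r ^ n`, the first-letter recursion bounds each count by a combination of
earlier ones with nonnegative weights of sum at most `1`. -/
theorem wordCount_le_pow (h0 : k 0 = 0) {r : ℝ} (hr : 0 < r)
    (h : ∀ n, ∑ i ∈ Finset.range (n + 1), (k i : ℝ) * (r ^ i)⁻¹ ≤ 1) (n : ℕ) :
    wordCount k n ≤ r ^ n := by
  induction n using Nat.strong_induction_on with
  | _ n ih =>
  rcases eq_or_ne n 0 with rfl | hn
  · rw [wordCount_zero h0, pow_zero]
  · rw [wordCount_eq_sum h0 hn]
    calc _ ≤ ∑ i ∈ Finset.range (n + 1), r ^ n * ((k i : ℝ) * (r ^ i)⁻¹) := by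
          refine Finset.sum_le_sum fun i hi => ?_
          rcases Nat.eq_zero_or_pos i with rfl | hi0
          · simp [h0]
          · have hi' : i ≤ n := by simpa [Nat.lt_succ_iff] using hi
            have : r ^ n = r ^ (n - i) * r ^ i := by rw [← pow_add]; congr 1; omega
            rw [this]
            have hri : r ^ i ≠ 0 := (pow_pos hr i).ne'
            calc (k i : ℝ) * wordCount k (n - i) ≤ k i * r ^ (n - i) :=
                  mul_le_mul_of_nonneg_left (ih _ (by omega)) (Nat.cast_nonneg _)
              _ = _ := by field_simp
      _ = r ^ n * ∑ i ∈ Finset.range (n + 1), (k i : ℝ) * (r ^ i)⁻¹ := by rw [Finset.mul_sum]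
      _ ≤ r ^ n * 1 := mul_le_mul_of_nonneg_left (h n) (pow_pos hr n).le
      _ = r ^ n := mul_one _

/-- If `∑ k n / r ^ n = 1`, then the word counts are not dominated by smaller powers. -/
theorem exists_pow_lt_wordCount (h0 : k 0 = 0) {r : ℝ}
    (h : HasSum (fun n => (k n : ℝ) * (r ^ n)⁻¹) 1) {s : ℝ} (hs : 0 < s) (hsr : s < r) :
    ∃ n ≠ 0, s ^ n < wordCount k n := by
  by_contra! hcon
  have hr : 0 < r := hs.trans hsr
  have hle : ∀ n, wordCount k n ≤ s ^ n := by
    intro n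
    rcases eq_or_ne n 0 with rfl | hn
    · rw [wordCount_zero h0, pow_zero]
    · exact hcon n hn
  set f : ℕ → ℝ := fun n => (k n : ℝ) * (r ^ n)⁻¹
  set g : ℕ → ℝ := fun n => wordCount k n * (r ^ n)⁻¹
  have hg0 : ∀ n, 0 ≤ g n := fun n =>
    mul_nonneg (wordCount_nonneg h0 n) (inv_nonneg.2 (pow_pos hr n).le)
  have hf0 : ∀ n, 0 ≤ f n := fun n =>
    mul_nonneg (Nat.cast_nonneg _) (inv_nonneg.2 (pow_pos hr n).le)
  have hg : Summable g := by
    refine Summable.of_nonneg_of_le hg0 (fun n => ?_)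
      (summable_geometric_of_lt_one (div_pos hs hr).le ((div_lt_one hr).2 hsr))
    rw [div_pow, div_eq_mul_inv]
    exact mul_le_mul_of_nonneg_right (hle n) (inv_nonneg.2 (pow_pos hr n).le)
  -- If all counts were at most `s ^ n`, the word series would converge at `1 / r` to some `A`, and
  -- the recursion would read `A = 1 + 1 * A`.
  have hmul := tsum_mul_tsum_eq_tsum_sum_antidiagonal_of_summable_norm
    (f := f) (g := g) (by simpa [abs_of_nonneg, hf0] using h.summable)
    (by simpa [abs_of_nonneg, hg0] using hg)
  have hconv : ∀ n, ∑ ij ∈ Finset.HasAntidiagonal.antidiagonal n, f ij.1 * g ij.2 =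
      g n - if n = 0 then 1 else 0 := by
    intro n
    rw [Finset.Nat.sum_antidiagonal_eq_sum_range_succ_mk]
    split_ifs with hn
    · subst hn
      simp [f, g, h0, wordCount_zero h0]
    · rw [sub_zero]
      simp only [g, wordCount_eq_sum h0 hn, Finset.sum_mul]
      refine Finset.sum_congr rfl fun i hi => ?_
      have hi' : i ≤ n := by simpa [Nat.lt_succ_iff] using hi
      have : r ^ n = r ^ (n - i) * r ^ i := by rw [← pow_add]; congr 1; omega
      rw [this]
      simp only [f, mul_inv]
      ring
  rw [h.tsum_eq, one_mul, tsum_congr hconv,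
    hg.tsum_sub (hasSum_ite_eq 0 (1 : ℝ)).summable, tsum_ite_eq] at hmul
  linarith

/-- The relation between the numbers `k` of generators and the dimensions `ℓ` of the components of
a graded free Lie algebra. -/
def IsWitt (k ℓ : ℕ → ℕ) : Prop :=
  ∀ n, PowerSeries.coeff n (1 - genSeries k) = PowerSeries.coeff n (wittProd ℓ n)

theorem IsWitt.zero (h : IsWitt k ℓ) : k 0 = 0 := by
  simpa [genSeries, wittProd_zero] using h 0

theorem IsWitt.coeff_eq (h : IsWitt k ℓ) {n N : ℕ} (hn : n ≤ N) :
    PowerSeries.coeff n (1 - genSeries k) = PowerSeries.coeff n (wittProd ℓ N) := by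
  rw [h n, coeff_wittProd_of_le ℓ hn]

/-- The inverse counts words in a single letter of weight `n`. -/
theorem coeff_inv_one_sub_X_pow {n : ℕ} (hn : n ≠ 0) (j : ℕ) :
    0 ≤ PowerSeries.coeff j (1 - PowerSeries.X ^ n : PowerSeries ℝ)⁻¹ ∧
      PowerSeries.coeff j (1 - PowerSeries.X ^ n : PowerSeries ℝ)⁻¹ ≤ 1 := by
  have h : genSeries (fun i => if i = n then 1 else 0) = PowerSeries.X ^ n := by
    ext i
    simp [genSeries, PowerSeries.coeff_X_pow]
  rw [← h]
  refine ⟨wordCount_nonneg (by simp [hn.symm]) j, ?_⟩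
  refine (wordCount_le_pow (by simp [hn.symm]) one_pos (fun m => ?_) j).trans_eq (one_pow j)
  simp only [one_pow, inv_one, mul_one, Nat.cast_ite, Nat.cast_one, Nat.cast_zero,
    Finset.sum_ite_eq']
  split_ifs <;> norm_num

theorem mul_inv_one_sub_X_pow {n : ℕ} (hn : n ≠ 0) :
    (1 - PowerSeries.X ^ n : PowerSeries ℝ) * (1 - PowerSeries.X ^ n)⁻¹ = 1 := by
  apply PowerSeries.mul_inv_cancel
  simp [hn]

theorem coeff_mul_nonneg {f g : PowerSeries ℝ} (hf : ∀ n, 0 ≤ PowerSeries.coeff n f)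
    (hg : ∀ n, 0 ≤ PowerSeries.coeff n g) (n : ℕ) : 0 ≤ PowerSeries.coeff n (f * g) := by
  rw [PowerSeries.coeff_mul]
  exact Finset.sum_nonneg fun _ _ => mul_nonneg (hf _) (hg _)

theorem coeff_pow_nonneg {f : PowerSeries ℝ} (hf : ∀ n, 0 ≤ PowerSeries.coeff n f) (m n : ℕ) :
    0 ≤ PowerSeries.coeff n (f ^ m) := by
  induction m generalizing n with
  | zero => rw [pow_zero, PowerSeries.coeff_one]; split_ifs <;> norm_num
  | succ m ih => rw [pow_succ]; exact coeff_mul_nonneg ih hf n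

/-- The inverse of `wittProd`. -/
theorem exists_inv_wittProd (ℓ : ℕ → ℕ) (N : ℕ) :
    ∃ T : PowerSeries ℝ, wittProd ℓ N * T = 1 ∧ (∀ n, 0 ≤ PowerSeries.coeff n T) ∧
      PowerSeries.coeff 0 T = 1 := by
  have key : ∃ T : PowerSeries ℝ, wittProd ℓ N * T = 1 ∧ ∀ n, 0 ≤ PowerSeries.coeff n T := by
    induction N with
    | zero =>
      refine ⟨1, by simp [wittProd], fun n => ?_⟩
      rw [PowerSeries.coeff_one]; split_ifs <;> norm_num
    | succ N ih =>
      obtain ⟨T, hT, hT0⟩ := ih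
      refine ⟨T * ((1 - PowerSeries.X ^ (N + 1))⁻¹) ^ ℓ (N + 1), ?_,
        coeff_mul_nonneg hT0 (coeff_pow_nonneg
          (fun n => (coeff_inv_one_sub_X_pow (Nat.succ_ne_zero N) n).1) _)⟩
      rw [wittProd_succ, mul_mul_mul_comm, hT, ← mul_pow,
        mul_inv_one_sub_X_pow (Nat.succ_ne_zero N), one_pow, one_mul]
  obtain ⟨T, hT, hT0⟩ := key
  refine ⟨T, hT, hT0, ?_⟩
  have := congrArg (PowerSeries.coeff 0) hT
  simpa [PowerSeries.coeff_mul, coeff_zero_wittProd] using this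

/-- The word series inverts the Witt product, as in the Poincaré–Birkhoff–Witt theorem. In degree
`n` the factors of index below `n` contribute a nonnegative amount and the `n`-th factor exactly `ℓ
n`. -/
theorem IsWitt.le_wordCount (h : IsWitt k ℓ) {n : ℕ} (hn : n ≠ 0) :
    (ℓ n : ℝ) ≤ wordCount k n := by
  obtain ⟨N, rfl⟩ := Nat.exists_eq_succ_of_ne_zero hn
  set A := (1 - genSeries k)⁻¹
  obtain ⟨T, hT, hT0, hT1⟩ := exists_inv_wittProd ℓ N
  have hAS : ∀ j ≤ N + 1, PowerSeries.coeff j (A * wittProd ℓ N) =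
      PowerSeries.coeff j (1 + PowerSeries.C (ℓ (N + 1) : ℝ) * PowerSeries.X ^ (N + 1)) := by
    intro j hj
    have h1 := coeff_mul_congr (fun j hj => h.coeff_eq hj) A j hj
    rw [mul_inv_one_sub_genSeries h.zero, wittProd_succ, mul_right_comm,
      coeff_mul_one_sub_X_pow_pow (Nat.succ_ne_zero N) _ _ hj] at h1
    have h2 : PowerSeries.coeff 0 (wittProd ℓ N * A) = 1 := by
      have : PowerSeries.coeff 0 A = 1 := wordCount_zero h.zero
      simp [PowerSeries.coeff_mul, coeff_zero_wittProd, this]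
    rw [h2, mul_one] at h1
    rw [mul_comm A, map_add, PowerSeries.coeff_C_mul_X_pow, h1]
    ring
  have := coeff_mul_congr hAS T (N + 1) le_rfl
  rw [mul_assoc, hT, mul_one, add_mul, one_mul, map_add, mul_assoc, PowerSeries.coeff_C_mul,
    PowerSeries.coeff_X_pow_mul', if_pos le_rfl, Nat.sub_self, hT1, mul_one] at this
  change _ ≤ PowerSeries.coeff (N + 1) A
  rw [this]
  linarith [hT0 (N + 1)]

theorem coeff_X_mul_derivative (f : PowerSeries ℝ) (n : ℕ) :
    PowerSeries.coeff n (PowerSeries.X * PowerSeries.derivative ℝ f) =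
      n * PowerSeries.coeff n f := by
  cases n with
  | zero => simp
  | succ n =>
    rw [PowerSeries.coeff_succ_X_mul, PowerSeries.coeff_derivative, mul_comm]
    push_cast
    rfl

theorem X_mul_derivative_one_sub_X_pow_pow {n : ℕ} (hn : n ≠ 0) (m : ℕ) :
    PowerSeries.X * PowerSeries.derivative ℝ ((1 - PowerSeries.X ^ n : PowerSeries ℝ) ^ m) =
      -((1 - PowerSeries.X ^ n) ^ m * (PowerSeries.C ((m * n : ℕ) : ℝ) *
        (PowerSeries.X ^ n * (1 - PowerSeries.X ^ n)⁻¹))) := by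
  set u : PowerSeries ℝ := 1 - PowerSeries.X ^ n
  have hu : u * u⁻¹ = 1 := mul_inv_one_sub_X_pow hn
  have hdu : PowerSeries.X * PowerSeries.derivative ℝ u =
      -(PowerSeries.C (n : ℝ) * PowerSeries.X ^ n) := by
    ext j
    rw [coeff_X_mul_derivative, map_neg, PowerSeries.coeff_C_mul_X_pow, map_sub,
      PowerSeries.coeff_X_pow, PowerSeries.coeff_one]
    by_cases h : j = n
    · subst h; simp [hn]
    · by_cases h0 : j = 0
      · simp [h0, hn.symm]
      · simp [h, h0]
  induction m with
  | zero => simp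
  | succ m ih =>
    rw [pow_succ, Derivation.leibniz, smul_eq_mul, smul_eq_mul, mul_add]
    have h1 : PowerSeries.X * (u ^ m * PowerSeries.derivative ℝ u) =
        u ^ m * (PowerSeries.X * PowerSeries.derivative ℝ u) := by ring
    have h2 : PowerSeries.X * (u * PowerSeries.derivative ℝ (u ^ m)) =
        u * (PowerSeries.X * PowerSeries.derivative ℝ (u ^ m)) := by ring
    rw [h1, h2, hdu, ih]
    push_cast
    rw [map_mul, map_mul, map_add, map_one]
    linear_combination (u ^ m * PowerSeries.C (n : ℝ) * PowerSeries.X ^ n) * hu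

theorem X_mul_derivative_wittProd (ℓ : ℕ → ℕ) (N : ℕ) :
    PowerSeries.X * PowerSeries.derivative ℝ (wittProd ℓ N) =
      -(wittProd ℓ N * ∑ i ∈ Finset.Icc 1 N, PowerSeries.C ((ℓ i * i : ℕ) : ℝ) *
        (PowerSeries.X ^ i * (1 - PowerSeries.X ^ i)⁻¹)) := by
  induction N with
  | zero => simp [wittProd]
  | succ N ih =>
    rw [wittProd_succ, Derivation.leibniz, smul_eq_mul, smul_eq_mul,
      Finset.sum_Icc_succ_top (by omega)]
    linear_combination wittProd ℓ N *
      X_mul_derivative_one_sub_X_pow_pow (n := N + 1) (by omega) (ℓ (N + 1)) +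
      (1 - PowerSeries.X ^ (N + 1)) ^ ℓ (N + 1) * ih

/-- Logarithmic differentiation of Witt's formula gives X K′/(1 − K) = Σ i ℓ_i Xⁱ/(1 − Xⁱ) up to
degree n, with K the series of `k`. On the left the coefficient is Σ j k_j a_{n−j} ≥ Σ k_j a_{n−j} =
a_n; on the right each summand contributes at most i ℓ_i ≤ n ℓ_i. -/
theorem IsWitt.wordCount_le (h : IsWitt k ℓ) {n : ℕ} (hn : n ≠ 0) :
    wordCount k n ≤ n * ((∑ i ∈ Finset.Icc 1 n, ℓ i : ℕ) : ℝ) := by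
  set A := (1 - genSeries k)⁻¹
  set T : PowerSeries ℝ := ∑ i ∈ Finset.Icc 1 n, PowerSeries.C ((ℓ i * i : ℕ) : ℝ) *
        (PowerSeries.X ^ i * (1 - PowerSeries.X ^ i)⁻¹)
  have hA0 : ∀ j, 0 ≤ PowerSeries.coeff j A := wordCount_nonneg h.zero
  have h1 : ∀ j ≤ n, PowerSeries.coeff j (PowerSeries.X * PowerSeries.derivative ℝ (1 - genSeries k))
      = PowerSeries.coeff j (PowerSeries.X * PowerSeries.derivative ℝ (wittProd ℓ n)) := by
    intro j hj
    rw [coeff_X_mul_derivative, coeff_X_mul_derivative, h.coeff_eq hj]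
  have h2 := coeff_mul_congr h1 A n le_rfl
  have h3 : PowerSeries.coeff n (wittProd ℓ n * A * T) = PowerSeries.coeff n (1 * T) := by
    refine coeff_mul_congr (fun j hj => ?_) T n le_rfl
    rw [← coeff_mul_congr (fun j hj => h.coeff_eq hj) A j hj, mul_inv_one_sub_genSeries h.zero]
  rw [X_mul_derivative_wittProd, neg_mul, mul_right_comm (wittProd ℓ n), map_neg, h3, one_mul] at h2
  have h4 : wordCount k n ≤ -PowerSeries.coeff n
      (PowerSeries.X * PowerSeries.derivative ℝ (1 - genSeries k) * A) := by
    rw [PowerSeries.coeff_mul, Finset.Nat.sum_antidiagonal_eq_sum_range_succ_mk,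
      wordCount_eq_sum h.zero hn, ← Finset.sum_neg_distrib]
    refine Finset.sum_le_sum fun i _ => ?_
    rcases Nat.eq_zero_or_pos i with rfl | hi
    · simp [h.zero]
    · rw [coeff_X_mul_derivative, map_sub, PowerSeries.coeff_one, if_neg hi.ne', zero_sub,
        genSeries, PowerSeries.coeff_mk, ← neg_mul, mul_neg, neg_neg]
      refine mul_le_mul_of_nonneg_right ?_ (wordCount_nonneg h.zero _)
      have : (1 : ℝ) ≤ i := by exact_mod_cast hi
      nlinarith [(Nat.cast_nonneg (k i) : (0 : ℝ) ≤ k i)]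
  rw [h2, neg_neg] at h4
  refine h4.trans ?_
  rw [map_sum]
  push_cast
  rw [Finset.mul_sum]
  refine Finset.sum_le_sum fun i hi => ?_
  obtain ⟨hi1, hi2⟩ := Finset.mem_Icc.1 hi
  rw [PowerSeries.coeff_C_mul, PowerSeries.coeff_X_pow_mul', if_pos hi2, mul_comm (n : ℝ)]
  have hc := coeff_inv_one_sub_X_pow (n := i) (by omega) (n - i)
  have hin : (i : ℝ) ≤ n := by exact_mod_cast hi2
  have hl : (0 : ℝ) ≤ (ℓ i : ℝ) := Nat.cast_nonneg _
  have hi0 : (0 : ℝ) ≤ (i : ℝ) := Nat.cast_nonneg _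
  calc _ ≤ (ℓ i * i : ℝ) * 1 := mul_le_mul_of_nonneg_left hc.2 (mul_nonneg hl hi0)
    _ ≤ _ := by rw [mul_one]; exact mul_le_mul_of_nonneg_left hin hl

end WordCount

/-! ### Exponential rates of word counts and dimensions. -/

section Base

variable {k ℓ : ℕ → ℕ}

theorem tendsto_natCast_rpow_inv :
    Tendsto (fun n : ℕ => (n : ℝ) ^ (1 / (n : ℝ))) atTop (𝓝 1) :=
  tendsto_rpow_div.comp tendsto_natCast_atTop_atTop

theorem tendsto_const_rpow_inv {M : ℝ} (hM : 0 < M) :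
    Tendsto (fun n : ℕ => M ^ (1 / (n : ℝ))) atTop (𝓝 1) := by
  have h : Tendsto (fun n : ℕ => (1 / (n : ℝ))) atTop (𝓝 0) :=
    tendsto_one_div_atTop_nhds_zero_nat
  have := (Real.continuous_const_rpow hM.ne').tendsto 0 |>.comp h
  rwa [Real.rpow_zero] at this

/-- The base of the cumulative dimensions is the exponential growth rate of the word counts. -/
theorem IsWitt.hasBase (h : IsWitt k ℓ) {r : ℝ} (hr : 1 ≤ r)
    (hle : ∀ n, wordCount k n ≤ r ^ n)
    (hlt : ∀ s, 0 < s → s < r → ∃ n ≠ 0, s ^ n < wordCount k n) :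
    HasBase (fun n => ∑ i ∈ Finset.Icc 1 n, ℓ i) r := by
  set g : ℕ → ℕ := fun n => ∑ i ∈ Finset.Icc 1 n, ℓ i
  have hr0 : 0 < r := by linarith
  have hmono : Monotone g := fun a b hab =>
    Finset.sum_le_sum_of_subset (Finset.Icc_subset_Icc_right hab)
  have hupper : ∀ n, (g n : ℝ) ≤ n * r ^ n := by
    intro n
    simp only [g]
    push_cast
    calc (∑ i ∈ Finset.Icc 1 n, (ℓ i : ℝ)) ≤ ∑ i ∈ Finset.Icc 1 n, r ^ n := by
          refine Finset.sum_le_sum fun i hi => ?_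
          obtain ⟨h1, h2⟩ := Finset.mem_Icc.1 hi
          exact ((h.le_wordCount (by omega)).trans (hle i)).trans (pow_le_pow_right₀ hr h2)
      _ = n * r ^ n := by simp
  rw [HasBase, tendsto_order]
  constructor
  · intro s hs
    -- The maximum with `0` covers negative `s`; the gap between `s` and `s'` absorbs the
    -- subexponential factors below.
    obtain ⟨s', hs1, hs2⟩ := exists_between (max_lt hs hr0)
    have hs'0 : 0 < s' := lt_of_le_of_lt (le_max_right _ _) hs1
    have hss' : s < s' := lt_of_le_of_lt (le_max_left _ _) hs1
    obtain ⟨d, hd, hd'⟩ := hlt s' hs'0 hs2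
    -- For `n = d * q + n % d`, supermultiplicativity controls the part `d * q`, and `M` bounds the
    -- leftover `s' ^ (n % d)`.
    set M := (max 1 s') ^ d
    have hM1 : 1 ≤ max 1 s' := le_max_left _ _
    have hM : 0 < M := pow_pos (by linarith) d
    have hlim : Tendsto (fun n : ℕ => s' / ((n : ℝ) ^ (1 / (n : ℝ)) * M ^ (1 / (n : ℝ)))) atTop
        (𝓝 (s' / (1 * 1))) :=
      Tendsto.div tendsto_const_nhds (tendsto_natCast_rpow_inv.mul (tendsto_const_rpow_inv hM))
        (by norm_num)
    rw [mul_one, div_one] at hlim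
    filter_upwards [hlim.eventually_const_lt hss', eventually_ge_atTop d] with n hn hnd
    refine hn.trans_le ?_
    have hn0 : 0 < n := by omega
    have hnR : (0 : ℝ) < n := by exact_mod_cast hn0
    have hkey : s' ^ n ≤ n * M * g n := by
      set q := n / d
      have hq : 0 < q := Nat.div_pos hnd (by omega)
      have hdq : d * q ≤ n := Nat.mul_div_le n d
      have hdq0 : d * q ≠ 0 := (Nat.mul_pos (by omega) hq).ne'
      have hmod : n = d * q + n % d := (Nat.div_add_mod n d).symm
      have hrem : s' ^ (n % d) ≤ M := by
        calc s' ^ (n % d) ≤ (max 1 s') ^ (n % d) :=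
              pow_le_pow_left₀ hs'0.le (le_max_right _ _) _
          _ ≤ M := pow_le_pow_right₀ hM1 (Nat.mod_lt n (by omega)).le
      have h1 : s' ^ (d * q) ≤ wordCount k (d * q) := by
        rw [pow_mul]
        exact (pow_le_pow_left₀ (pow_pos hs'0 d).le hd'.le q).trans
          (wordCount_pow_le h.zero d q)
      have h2 : wordCount k (d * q) ≤ n * (g n : ℝ) := by
        refine (h.wordCount_le hdq0).trans ?_
        have : ((∑ i ∈ Finset.Icc 1 (d * q), ℓ i : ℕ) : ℝ) ≤ g n := by
          exact_mod_cast hmono hdq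
        exact mul_le_mul (by exact_mod_cast hdq) this (Nat.cast_nonneg _) hnR.le
      calc s' ^ n = s' ^ (d * q) * s' ^ (n % d) := by rw [← pow_add, ← hmod]
        _ ≤ (n * (g n : ℝ)) * M := mul_le_mul (h1.trans h2) hrem (pow_pos hs'0 _).le (by positivity)
        _ = n * M * g n := by ring
    have hroot := Real.rpow_le_rpow (pow_pos hs'0 n).le hkey (z := 1 / (n : ℝ)) (by positivity)
    rw [one_div, Real.pow_rpow_inv_natCast hs'0.le hn0.ne', ← one_div,
      Real.mul_rpow (by positivity) (by positivity), Real.mul_rpow hnR.le hM.le] at hroot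
    rw [div_le_iff₀ (by positivity)]
    linarith
  · intro s hs
    have hlim : Tendsto (fun n : ℕ => (n : ℝ) ^ (1 / (n : ℝ)) * r) atTop (𝓝 (1 * r)) :=
      tendsto_natCast_rpow_inv.mul_const r
    rw [one_mul] at hlim
    filter_upwards [hlim.eventually_lt_const hs, eventually_gt_atTop 0] with n hn hn0
    refine lt_of_le_of_lt ?_ hn
    refine (Real.rpow_le_rpow (Nat.cast_nonneg _) (hupper n) (by positivity)).trans_eq ?_
    rw [Real.mul_rpow (by positivity) (by positivity), one_div,
      Real.pow_rpow_inv_natCast hr0.le (by omega)]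

theorem IsWitt.hasBase_of_hasSum (h : IsWitt k ℓ) {r : ℝ} (hr : 1 ≤ r)
    (hsum : HasSum (fun n => (k n : ℝ) * (r ^ n)⁻¹) 1) :
    HasBase (fun n => ∑ i ∈ Finset.Icc 1 n, ℓ i) r := by
  have hr0 : 0 < r := by linarith
  refine h.hasBase hr (wordCount_le_pow h.zero hr0 fun n => ?_)
    fun s hs hsr => exists_pow_lt_wordCount h.zero hsum hs hsr
  exact sum_le_hasSum _
    (fun i _ => mul_nonneg (Nat.cast_nonneg _) (inv_nonneg.2 (pow_pos hr0 i).le)) hsum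

/-- With at least two generators and exponentially bounded word counts, growth is exponential. -/
theorem IsWitt.isExponential (h : IsWitt k ℓ) {C : ℝ} (hC : 0 < C)
    (hle : ∀ n, wordCount k n ≤ C ^ n) {d : ℕ} (hd : 1 < wordCount k d) :
    IsExponential (fun n => ∑ i ∈ Finset.Icc 1 n, ℓ i) := by
  have hd0 : d ≠ 0 := by
    rintro rfl
    rw [wordCount_zero h.zero] at hd
    exact lt_irrefl _ hd
  -- As in Fekete's lemma, the rate of a supermultiplicative sequence is the supremum of its roots.
  set R : Set ℝ := {x | ∃ n : ℕ, n ≠ 0 ∧ x = wordCount k n ^ (1 / (n : ℝ))}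
  have hpow : ∀ n : ℕ, n ≠ 0 → (wordCount k n ^ (1 / (n : ℝ))) ^ n = wordCount k n := by
    intro n hn
    rw [one_div, Real.rpow_inv_natCast_pow (wordCount_nonneg h.zero n) hn]
  have hbdd : BddAbove R := by
    refine ⟨C, ?_⟩
    rintro _ ⟨n, hn, rfl⟩
    rw [one_div]
    refine (Real.rpow_le_rpow (wordCount_nonneg h.zero n) (hle n) (by positivity)).trans_eq ?_
    rw [Real.pow_rpow_inv_natCast hC.le hn]
  have hmem : wordCount k d ^ (1 / (d : ℝ)) ∈ R := ⟨d, hd0, rfl⟩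
  have hgt : 1 < wordCount k d ^ (1 / (d : ℝ)) :=
    Real.one_lt_rpow hd (by positivity)
  have hr : 1 < sSup R := hgt.trans_le (le_csSup hbdd hmem)
  refine ⟨sSup R, hr, h.hasBase hr.le (fun n => ?_) fun s hs hsr => ?_⟩
  · rcases eq_or_ne n 0 with rfl | hn
    · rw [wordCount_zero h.zero, pow_zero]
    · rw [← hpow n hn]
      exact pow_le_pow_left₀ (Real.rpow_nonneg (wordCount_nonneg h.zero n) _)
        (le_csSup hbdd ⟨n, hn, rfl⟩) n
  · obtain ⟨_, ⟨n, hn, rfl⟩, hlt⟩ := exists_lt_of_lt_csSup ⟨_, hmem⟩ hsr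
    refine ⟨n, hn, ?_⟩
    rw [← hpow n hn]
    exact pow_lt_pow_left₀ hlt hs.le hn

/-- With at most one generator, `1 - genSeries k` is `1` or `1 - X ^ p`, already a Witt product: the
free Lie algebra has dimension at most one. -/
theorem isWitt_self (h0 : k 0 = 0) (h : ∀ M, ∑ i ∈ Finset.Icc 1 M, k i ≤ 1) : IsWitt k k := by
  intro n
  by_cases hz : ∀ i, k i = 0
  · have : genSeries k = 0 := by ext i; simp [genSeries, hz]
    simp [this, wittProd, hz]
  · push Not at hz
    obtain ⟨p, hp⟩ := hz
    have hp0 : p ≠ 0 := by rintro rfl; exact hp h0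
    have hk : k = fun i => if i = p then 1 else 0 := by
      funext i
      have hsum := h (max i p)
      have hpm : p ∈ Finset.Icc 1 (max i p) := Finset.mem_Icc.2 ⟨by omega, le_max_right _ _⟩
      split_ifs with hip
      · subst hip
        have := Finset.single_le_sum (f := k) (fun _ _ => Nat.zero_le _) hpm
        omega
      · rcases Nat.eq_zero_or_pos i with rfl | hi
        · exact h0
        have him : i ∈ Finset.Icc 1 (max i p) := Finset.mem_Icc.2 ⟨hi, le_max_left _ _⟩
        have := Finset.add_le_sum (f := k) (fun _ _ => Nat.zero_le _) him hpm hip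
        omega
    have hgen : genSeries k = PowerSeries.X ^ p := by
      ext i; simp [genSeries, hk, PowerSeries.coeff_X_pow]
    by_cases hpn : p ≤ n
    · rw [hgen, hk, wittProd_single (Finset.mem_Icc.2 ⟨by omega, hpn⟩)]
    · have hw : wittProd k n = 1 := by
        refine Finset.prod_eq_one fun i hi => ?_
        have := (Finset.mem_Icc.1 hi).2
        rw [hk]
        dsimp only
        rw [if_neg (by omega), pow_zero]
      rw [hw, hgen, map_sub, PowerSeries.coeff_X_pow, if_neg (by omega), sub_zero]

/-- Total dimension at least two requires at least two generators. -/
theorem IsWitt.exists_two_le_sum (h : IsWitt k ℓ) {N : ℕ}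
    (hN : 2 ≤ ∑ i ∈ Finset.Icc 1 N, ℓ i) : ∃ M, 2 ≤ ∑ i ∈ Finset.Icc 1 M, k i := by
  by_contra! hcon
  have hle : ∀ M, ∑ i ∈ Finset.Icc 1 M, k i ≤ 1 := fun M => by have := hcon M; omega
  have hself := isWitt_self h.zero hle
  have := eq_of_coeff_wittProd_eq (ℓ := ℓ) (ℓ' := k) (N := N) fun j _ => by rw [← h j, hself j]
  have hs : ∑ i ∈ Finset.Icc 1 N, ℓ i = ∑ i ∈ Finset.Icc 1 N, k i := Finset.sum_congr rfl this
  have := hle N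
  omega

/-- Two letters of equal weight are two words of that weight; letters of different weights give two
words by writing them in either order. -/
theorem exists_one_lt_wordCount (h0 : k 0 = 0) {M : ℕ} (hM : 2 ≤ ∑ i ∈ Finset.Icc 1 M, k i) :
    ∃ d, 1 < wordCount k d := by
  by_cases h2 : ∃ p, 2 ≤ k p
  · obtain ⟨p, hp⟩ := h2
    refine ⟨p, lt_of_lt_of_le ?_ (le_wordCount h0 p)⟩
    exact_mod_cast hp
  · push Not at h2
    obtain ⟨p, hp, hkp⟩ : ∃ p ∈ Finset.Icc 1 M, k p ≠ 0 := by
      by_contra! hcon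
      rw [Finset.sum_eq_zero hcon] at hM
      omega
    obtain ⟨q, hq, hkq⟩ : ∃ q ∈ (Finset.Icc 1 M).erase p, k q ≠ 0 := by
      by_contra! hcon
      rw [← Finset.add_sum_erase _ _ hp, Finset.sum_eq_zero hcon] at hM
      have := h2 p
      omega
    have hqp := Finset.ne_of_mem_erase hq
    have hp1 := (Finset.mem_Icc.1 hp).1
    refine ⟨p + q, ?_⟩
    rw [wordCount_eq_sum h0 (by omega)]
    have hterm : ∀ i, 0 ≤ (k i : ℝ) * wordCount k (p + q - i) := fun i =>
      mul_nonneg (Nat.cast_nonneg _) (wordCount_nonneg h0 _)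
    have hsum := Finset.add_le_sum (s := Finset.range (p + q + 1))
      (f := fun i => (k i : ℝ) * wordCount k (p + q - i)) (fun i _ => hterm i)
      (i := p) (j := q) (by simp) (by simp) hqp.symm
    refine lt_of_lt_of_le ?_ hsum
    have hp' : (1 : ℝ) ≤ k p := by exact_mod_cast Nat.one_le_iff_ne_zero.2 hkp
    have hq' : (1 : ℝ) ≤ k q := by exact_mod_cast Nat.one_le_iff_ne_zero.2 hkq
    have h3 := hp'.trans (le_wordCount h0 p)
    have h4 := hq'.trans (le_wordCount h0 q)
    simp only [Nat.add_sub_cancel_left, Nat.add_sub_cancel]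
    nlinarith

end Base

/-! ### Leading parts and the associated graded subalgebra. -/

section Leading

variable {F : Type*} [Field F] {G : Type*} [LieRing G] [LieAlgebra F G]

/-- The elements without components of degree greater than `n`. -/
def filt (p : ℕ → G →ₗ[F] G) (n : ℕ) : Submodule F G := ⨅ j ∈ Set.Ioi n, LinearMap.ker (p j)

theorem mem_filt {p : ℕ → G →ₗ[F] G} {n : ℕ} {x : G} :
    x ∈ filt p n ↔ ∀ j, n < j → p j x = 0 := by
  simp [filt, Submodule.mem_iInf]

theorem filt_mono {p : ℕ → G →ₗ[F] G} {a b : ℕ} (h : a ≤ b) : filt p a ≤ filt p b := by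
  intro x hx
  rw [mem_filt] at hx ⊢
  exact fun j hj => hx j (by omega)

theorem IsGrading.proj_mem_filt {p : ℕ → G →ₗ[F] G} (hp : IsGrading p) {i n : ℕ} (hi : i ≤ n)
    (x : G) : p i x ∈ filt p n := by
  rw [mem_filt]
  exact fun j hj => hp.proj_of_ne _ _ _ (by omega)

theorem IsGrading.filt_zero {p : ℕ → G →ₗ[F] G} (hp : IsGrading p) : filt p 0 = ⊥ := by
  rw [eq_bot_iff]
  intro x hx
  rw [mem_filt] at hx
  rw [Submodule.mem_bot]
  refine hp.ext fun n => ?_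
  rw [map_zero]
  rcases Nat.eq_zero_or_pos n with rfl | hn
  · exact hp.proj_zero x
  · exact hx n hn

theorem IsGrading.exists_mem_filt {p : ℕ → G →ₗ[F] G} (hp : IsGrading p) (x : G) :
    ∃ n, x ∈ filt p n := by
  obtain ⟨N, hN, -⟩ := hp.exists_bound x
  exact ⟨N, mem_filt.2 fun j hj => hN j hj.le⟩

theorem IsGrading.lie_mem_filt {p : ℕ → G →ₗ[F] G} (hp : IsGrading p) {a b : ℕ} {x y : G}
    (hx : x ∈ filt p a) (hy : y ∈ filt p b) :
    ⁅x, y⁆ ∈ filt p (a + b) ∧ p (a + b) ⁅x, y⁆ = ⁅p a x, p b y⁆ := by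
  rw [mem_filt] at hx hy
  constructor
  · rw [mem_filt]
    intro j hj
    rw [hp.proj_lie]
    refine Finset.sum_eq_zero fun ij hij => ?_
    have := Finset.HasAntidiagonal.mem_antidiagonal.1 hij
    by_cases h : a < ij.1
    · rw [hx _ h, zero_lie]
    · rw [hy ij.2 (by omega), lie_zero]
  · rw [hp.proj_lie, Finset.sum_eq_single_of_mem (a, b) (by simp)]
    rintro ⟨i, j⟩ hij hne
    have := Finset.HasAntidiagonal.mem_antidiagonal.1 hij
    simp only at this ⊢
    by_cases h : a < i
    · rw [hx _ h, zero_lie]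
    · by_cases h' : b < j
      · rw [hy j h', lie_zero]
      · exact absurd (by ext <;> simp only <;> omega) hne

/-- The components of degree `n` of the elements of `W` of degree at most `n`. -/
def lead (p : ℕ → G →ₗ[F] G) (W : Submodule F G) (n : ℕ) : Submodule F G :=
  (W ⊓ filt p n).map (p n)

theorem IsGrading.inf_filt_succ_inf_ker {p : ℕ → G →ₗ[F] G} (W : Submodule F G) (n : ℕ) :
    W ⊓ filt p (n + 1) ⊓ LinearMap.ker (p (n + 1)) = W ⊓ filt p n := by
  ext x
  simp only [Submodule.mem_inf, mem_filt, LinearMap.mem_ker, and_assoc, and_congr_right_iff]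
  intro _
  constructor
  · rintro ⟨h1, h2⟩ j hj
    rcases (show n + 1 ≤ j from hj).eq_or_lt with rfl | h
    · exact h2
    · exact h1 j h
  · intro h
    exact ⟨fun j hj => h j (by omega), h _ (by omega)⟩

theorem IsGrading.finite_filt {p : ℕ → G →ₗ[F] G} (hp : IsGrading p) (n : ℕ) :
    FiniteDimensional F (filt p n) := by
  induction n with
  | zero => rw [hp.filt_zero]; infer_instance
  | succ n ih =>
    refine Module.Finite.iff_fg.2 (Submodule.fg_of_fg_map_of_fg_inf_ker (p (n + 1)) ?_ ?_)
    · exact Module.Finite.iff_fg.1 (finite_map_proj hp _ _)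
    · have := IsGrading.inf_filt_succ_inf_ker (p := p) ⊤ n
      rw [top_inf_eq, top_inf_eq] at this
      rw [this]
      exact Module.Finite.iff_fg.1 ih

/-- Rank–nullity for the top projection, whose kernel is the next smaller piece. This is why passing
to leading parts preserves growth. -/
theorem IsGrading.finrank_inf_filt {p : ℕ → G →ₗ[F] G} (hp : IsGrading p) (W : Submodule F G)
    (n : ℕ) : Module.finrank F ↥(W ⊓ filt p n) =
      ∑ i ∈ Finset.Icc 1 n, Module.finrank F (lead p W i) := by
  induction n with
  | zero => rw [hp.filt_zero, inf_bot_eq]; simp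
  | succ n ih =>
    have := hp.finite_filt (n + 1)
    set V := W ⊓ filt p (n + 1)
    have hV : FiniteDimensional F V := Submodule.finiteDimensional_of_le inf_le_right
    have h := LinearMap.finrank_range_add_finrank_ker ((p (n + 1)).domRestrict V)
    have hr : LinearMap.range ((p (n + 1)).domRestrict V) = lead p W (n + 1) := by
      rw [LinearMap.range_domRestrict]
      rfl
    have hk : Module.finrank F (LinearMap.ker ((p (n + 1)).domRestrict V)) =
        Module.finrank F ↥(W ⊓ filt p n) := by
      have hmap : (LinearMap.ker ((p (n + 1)).domRestrict V)).map V.subtype = W ⊓ filt p n := by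
        rw [← IsGrading.inf_filt_succ_inf_ker W n, LinearMap.ker_domRestrict,
          Submodule.map_comap_subtype]
      rw [← hmap, Submodule.finrank_map_subtype_eq]
    rw [hr, hk, ih] at h
    rw [Finset.sum_Icc_succ_top (by omega), ← h, add_comm]

/-- The subalgebra spanned by the leading parts of the elements of `H`. -/
def gr {p : ℕ → G →ₗ[F] G} (hp : IsGrading p) (H : LieSubalgebra F G) : LieSubalgebra F G where
  carrier := {x | ∀ n, p n x ∈ lead p H.toSubmodule n}
  add_mem' hx hy n := by rw [map_add]; exact add_mem (hx n) (hy n)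
  zero_mem' n := by rw [map_zero]; exact zero_mem _
  smul_mem' c x hx n := by rw [map_smul]; exact Submodule.smul_mem _ c (hx n)
  lie_mem' {x y} hx hy n := by
    rw [hp.proj_lie]
    refine sum_mem ?_
    rintro ⟨a, b⟩ hab
    obtain rfl := Finset.HasAntidiagonal.mem_antidiagonal.1 hab
    obtain ⟨u, ⟨hu, hu'⟩, hux⟩ := hx a
    obtain ⟨v, ⟨hv, hv'⟩, hvy⟩ := hy b
    obtain ⟨h1, h2⟩ := hp.lie_mem_filt hu' hv'
    exact ⟨⁅u, v⁆, ⟨H.lie_mem hu hv, h1⟩, by rw [h2, hux, hvy]⟩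

theorem mem_gr_of_mem_lead {p : ℕ → G →ₗ[F] G} (hp : IsGrading p) {H : LieSubalgebra F G} {x : G}
    {n : ℕ} (hx : x ∈ lead p H.toSubmodule n) : x ∈ gr hp H := by
  have hxn : p n x = x := by
    obtain ⟨u, -, rfl⟩ := hx
    exact hp.proj_self n u
  intro j
  by_cases h : j = n
  · rw [h, hxn]; exact hx
  · rw [hp.proj_eq_zero hxn h]; exact zero_mem _

theorem isHomogeneous_gr {p : ℕ → G →ₗ[F] G} (hp : IsGrading p) (H : LieSubalgebra F G) :
    IsHomogeneousSubalgebra p (gr hp H) := fun _ hx n => mem_gr_of_mem_lead hp (hx n)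

theorem dimComp_gr {p : ℕ → G →ₗ[F] G} (hp : IsGrading p) (H : LieSubalgebra F G) (n : ℕ) :
    dimComp p (gr hp H) n = Module.finrank F (lead p H.toSubmodule n) := by
  have : (gr hp H).toSubmodule.map (p n) = lead p H.toSubmodule n := by
    apply le_antisymm
    · rintro _ ⟨x, hx, rfl⟩
      exact hx n
    · intro x hx
      refine ⟨x, mem_gr_of_mem_lead hp hx, ?_⟩
      obtain ⟨u, -, rfl⟩ := hx
      exact hp.proj_self n u
  rw [dimComp, this]

theorem gr_eq_self {p : ℕ → G →ₗ[F] G} (hp : IsGrading p) {H : LieSubalgebra F G}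
    (hH : IsHomogeneousSubalgebra p H) : gr hp H = H := by
  apply le_antisymm
  · intro x hx
    refine hp.mem_of_proj_mem (W := H.toSubmodule) fun n => ?_
    obtain ⟨u, ⟨hu, -⟩, hux⟩ := hx n
    rw [← hux]
    exact hH u hu n
  · intro x hx n
    exact ⟨p n x, ⟨hH x hx n, hp.proj_mem_filt le_rfl x⟩, hp.proj_self n x⟩

theorem IsGrading.finrank_inf_filt_eq {p : ℕ → G →ₗ[F] G} (hp : IsGrading p)
    (H : LieSubalgebra F G) (n : ℕ) : Module.finrank F ↥(H.toSubmodule ⊓ filt p n) =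
      ∑ i ∈ Finset.Icc 1 n, dimComp p (gr hp H) i := by
  rw [hp.finrank_inf_filt]
  exact Finset.sum_congr rfl fun i _ => (dimComp_gr hp H i).symm

end Leading

/-! ### Witt's formula and Kraft's inequality for homogeneous subalgebras. -/

section Bounds

open FreeLieAlgebra (of lift)

variable {F : Type*} [Field F] {G : Type*} [LieRing G] [LieAlgebra F G]

/-- Witt's formula for a homogeneous subalgebra of a free Lie algebra. -/
theorem FreeFamily.exists_isWitt {ι : Type*} {p : ℕ → G →ₗ[F] G} (hp : IsGrading p)
    {H : LieSubalgebra F G} (hH : IsHomogeneousSubalgebra p H) {b : ι → G} {w : ι → ℕ}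
    (hb : FreeFamily p b w) (hle : H ≤ (lift F b).range) : ∃ k, IsWitt k (dimComp p H) := by
  -- Each `N` has its own chain, and `k n` is read off the chain run to degree `n`. Witt's formula
  -- in degree `n` involves that chain alone, so no compatibility is needed.
  choose ι' b' w' hb' _ heq _ using fun N => hb.exists_chain hp hH N hle
  refine ⟨fun n => count (w' n) n, fun n => ?_⟩
  have h := (hb' n).coeff_one_sub_weightSeries hp n
  rw [wittProd_congr (ℓ' := dimComp p H) fun i hi => by
    rw [dimComp, heq n i (Finset.mem_Icc.1 hi).2, dimComp]] at h
  rw [← h]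
  simp [genSeries, weightSeries]

theorem FreeFamily.isWitt {ι : Type*} {p : ℕ → G →ₗ[F] G} (hp : IsGrading p)
    {b : ι → G} {w : ι → ℕ} (hb : FreeFamily p b w) :
    IsWitt (count w) (dimComp p (lift F b).range) := fun n =>
  hb.coeff_one_sub_weightSeries hp n

/-- One factor `1 - X` is enough: all coefficients of its inverse are `1`, and a nonnegative series
with constant term `1` keeps them positive. This is the source of strictness in Kraft's inequality.
-/
theorem exists_inv_wittProd_pos {c : ℕ → ℕ} {N : ℕ} (hN : 1 ≤ N) (hc : 1 ≤ c 1) :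
    ∃ T : PowerSeries ℝ, wittProd c N * T = 1 ∧ (∀ n, 0 < PowerSeries.coeff n T) ∧
      PowerSeries.coeff 0 T = 1 := by
  obtain ⟨T, hT, hT0, hT1⟩ := exists_inv_wittProd (fun i => c i - if i = 1 then 1 else 0) N
  have hw : wittProd c N = wittProd (fun i => c i - if i = 1 then 1 else 0) N *
      (1 - PowerSeries.X) := by
    rw [← pow_one (PowerSeries.X : PowerSeries ℝ),
      ← wittProd_single (Finset.mem_Icc.2 ⟨le_rfl, hN⟩), ← wittProd_add]
    refine wittProd_congr fun i _ => ?_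
    by_cases h : i = 1
    · subst h; simp; omega
    · simp [h]
  have hone : (1 - PowerSeries.X) * PowerSeries.mk (1 : ℕ → ℝ) = 1 := by
    rw [mul_comm, PowerSeries.mk_one_mul_one_sub_eq_one]
  refine ⟨T * PowerSeries.mk (1 : ℕ → ℝ), ?_, fun n => ?_, ?_⟩
  · rw [hw, mul_mul_mul_comm, hT, hone, one_mul]
  · rw [PowerSeries.coeff_mul]
    refine Finset.sum_pos' (fun ij _ => ?_) ⟨(0, n), by simp, ?_⟩
    · simpa using hT0 ij.1
    · simp only [hT1, PowerSeries.coeff_mk, Pi.one_apply]; norm_num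
  · simp only [PowerSeries.coeff_mul, Finset.Nat.antidiagonal_zero, Finset.sum_singleton, hT1,
      PowerSeries.coeff_mk, Pi.one_apply, mul_one]

/-- With T_n the coefficients of `T`, the hypothesis reads k_{n+1} = m T_n − T_{n+1}; division by
m^{n+1} makes the sum telescope. -/
theorem sum_eq_one_sub {k : ℕ → ℕ} {m : ℝ} (hm : 0 < m) {T : PowerSeries ℝ} {N : ℕ} (h0 : k 0 = 0)
    (hT : PowerSeries.coeff 0 T = 1) (h : ∀ j ≤ N, PowerSeries.coeff j
      ((1 - PowerSeries.C m * PowerSeries.X) * T) = PowerSeries.coeff j (1 - genSeries k)) :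
    ∀ n ≤ N, ∑ i ∈ Finset.range (n + 1), (k i : ℝ) * (m ^ i)⁻¹ =
      1 - PowerSeries.coeff n T * (m ^ n)⁻¹ := by
  intro n
  induction n with
  | zero => intro _; simp [h0, hT]
  | succ n ih =>
    intro hn
    rw [Finset.sum_range_succ, ih (by omega)]
    have := h (n + 1) hn
    rw [sub_mul, one_mul, map_sub, mul_assoc, PowerSeries.coeff_C_mul,
      PowerSeries.coeff_succ_X_mul, map_sub, PowerSeries.coeff_one, if_neg (by omega), genSeries,
      PowerSeries.coeff_mk] at this
    have hk : (k (n + 1) : ℝ) = m * PowerSeries.coeff n T - PowerSeries.coeff (n + 1) T := by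
      linarith
    rw [hk, pow_succ]
    field_simp
    ring

/-- The Kraft-type inequality for the generators of a homogeneous subalgebra of a free Lie algebra
on `m` generators of degree one; it is strict for proper subalgebras. -/
theorem FreeFamily.sum_le_one {ι : Type*} {p : ℕ → G →ₗ[F] G} (hp : IsGrading p)
    {H : LieSubalgebra F G} (hH : IsHomogeneousSubalgebra p H) {b : ι → G} {w : ι → ℕ}
    (hb : FreeFamily p b w) (hle : H ≤ (lift F b).range) {m : ℕ} (hm : 0 < m)
    (hw : weightSeries w = PowerSeries.C (m : ℝ) * PowerSeries.X) {k : ℕ → ℕ}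
    (hk : IsWitt k (dimComp p H)) (N : ℕ) :
    ∑ i ∈ Finset.range (N + 1), (k i : ℝ) * ((m : ℝ) ^ i)⁻¹ ≤ 1 ∧
    (1 ≤ N → dimComp p H 1 ≠ dimComp p (lift F b).range 1 →
      ∑ i ∈ Finset.range (N + 1), (k i : ℝ) * ((m : ℝ) ^ i)⁻¹ < 1) := by
  obtain ⟨ι', b', w', hb', -, heq, c, hc, hser⟩ := hb.exists_chain hp hH N hle
  have hm' : (0 : ℝ) < m := by exact_mod_cast hm
  -- `T` undoes the factors split off during the descent, which leaves the series of the generators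
  -- reached; by Witt's formula it agrees with that of `k` up to degree `N`.
  have hcoeff : ∀ T : PowerSeries ℝ, wittProd c N * T = 1 → ∀ j ≤ N, PowerSeries.coeff j
      ((1 - PowerSeries.C (m : ℝ) * PowerSeries.X) * T) =
      PowerSeries.coeff j (1 - genSeries k) := by
    intro T hT j hj
    rw [← hw, hser, mul_assoc, hT, mul_one, hb'.coeff_one_sub_weightSeries hp, hk j]
    refine congrArg _ (wittProd_congr fun i hi => ?_)
    rw [dimComp, heq i ((Finset.mem_Icc.1 hi).2.trans hj), dimComp]
  constructor
  · obtain ⟨T, hT, hT0, hT1⟩ := exists_inv_wittProd c N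
    rw [sum_eq_one_sub hm' hk.zero hT1 (hcoeff T hT) N le_rfl]
    have := mul_nonneg (hT0 N) (inv_nonneg.2 (pow_pos hm' N).le)
    linarith
  · intro hN hne
    have hc1 : 1 ≤ c 1 := by
      have := hc 1 (Finset.mem_Icc.2 ⟨le_rfl, hN⟩)
      omega
    obtain ⟨T, hT, hT0, hT1⟩ := exists_inv_wittProd_pos hN hc1
    rw [sum_eq_one_sub hm' hk.zero hT1 (hcoeff T hT) N le_rfl]
    have := mul_pos (hT0 N) (inv_pos.2 (pow_pos hm' N))
    linarith

end Bounds

/-! ### The grading by length, and exponential growth of nonabelian subalgebras. -/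

section Standard

open FreeLieAlgebra (of lift)

variable {F : Type*} [Field F] {X : Type*}

theorem lift_of_eq_id : lift F (of F : X → FreeLieAlgebra F X) = LieHom.id := by
  ext i
  simp

theorem range_lift_of : (lift F (of F : X → FreeLieAlgebra F X)).range = ⊤ := by
  rw [range_lift, lieSpan_range_of]

theorem freeFamily_of (w : X → ℕ) : FreeFamily (freeProj F w) (of F) w :=
  ⟨by rw [lift_of_eq_id]; exact fun _ _ h => h, freeProj_of_self w⟩

variable (F X) in
/-- The projections for the grading of the free Lie algebra by length. -/
noncomputable def stdProj : ℕ → FreeLieAlgebra F X →ₗ[F] FreeLieAlgebra F X :=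
  freeProj F (fun _ : X => 1)

variable (F X) in
theorem isGrading_stdProj [Finite X] : IsGrading (stdProj F X) :=
  isGrading_freeProj _ fun _ => one_ne_zero

theorem freeFamily_std : FreeFamily (stdProj F X) (of F) (fun _ => 1) := freeFamily_of _

theorem stdProj_commutator [Finite X] {n : ℕ} {c : FreeLieAlgebra F X} (hc : IsCommutator n c) :
    stdProj F X n c = c := by
  induction hc with
  | of x => exact freeProj_of_self _ x
  | lie _ _ hk hl => exact (isGrading_stdProj F X).lie_homogeneous hk hl

theorem homogeneous_le_range [Finite X] (n : ℕ) :
    homogeneous F X n ≤ LinearMap.range (stdProj F X n) :=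
  Submodule.span_le.2 fun c hc => ⟨c, stdProj_commutator hc⟩

theorem lie_mem_homogeneous {i j : ℕ} {x y : FreeLieAlgebra F X} (hx : x ∈ homogeneous F X i)
    (hy : y ∈ homogeneous F X j) : ⁅x, y⁆ ∈ homogeneous F X (i + j) := by
  induction hx using Submodule.span_induction with
  | mem x hx =>
    induction hy using Submodule.span_induction with
    | mem y hy => exact Submodule.subset_span (IsCommutator.lie hx hy)
    | zero => rw [lie_zero]; exact zero_mem _
    | add u v _ _ hu hv => rw [lie_add]; exact add_mem hu hv
    | smul a u _ hu => rw [lie_smul]; exact Submodule.smul_mem _ a hu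
  | zero => rw [zero_lie]; exact zero_mem _
  | add u v _ _ hu hv => rw [add_lie]; exact add_mem hu hv
  | smul a u _ hu => rw [smul_lie]; exact Submodule.smul_mem _ a hu

theorem mem_iSup_homogeneous (x : FreeLieAlgebra F X) : x ∈ ⨆ n, homogeneous F X n := by
  induction x using free_induction with
  | mem i => exact Submodule.mem_iSup_of_mem 1 (Submodule.subset_span (IsCommutator.of i))
  | zero => exact zero_mem _
  | add x y hx hy => exact add_mem hx hy
  | smul a x hx => exact Submodule.smul_mem _ a hx
  | lie x y hx hy =>
    induction hx using Submodule.iSup_induction' with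
    | mem i x hx =>
      induction hy using Submodule.iSup_induction' with
      | mem j y hy => exact Submodule.mem_iSup_of_mem (i + j) (lie_mem_homogeneous hx hy)
      | zero => rw [lie_zero]; exact zero_mem _
      | add x y _ _ hx hy => rw [lie_add]; exact add_mem hx hy
    | zero => rw [zero_lie]; exact zero_mem _
    | add x y _ _ hx hy => rw [add_lie]; exact add_mem hx hy

theorem homogeneous_eq_range [Finite X] (n : ℕ) :
    homogeneous F X n = LinearMap.range (stdProj F X n) := by
  refine le_antisymm (homogeneous_le_range n) ?_
  rintro _ ⟨x, rfl⟩
  have hp := isGrading_stdProj F X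
  induction mem_iSup_homogeneous x using Submodule.iSup_induction' with
  | mem i x hx =>
    obtain ⟨y, rfl⟩ := homogeneous_le_range i hx
    rw [hp.proj_proj]
    split_ifs with h
    · rw [h]; exact hx
    · exact zero_mem _
  | zero => rw [map_zero]; exact zero_mem _
  | add x y _ _ hx hy => rw [map_add]; exact add_mem hx hy

theorem filtration_eq_filt [Finite X] (n : ℕ) : filtration F X n = filt (stdProj F X) n := by
  have hp := isGrading_stdProj F X
  apply le_antisymm
  · refine iSup₂_le fun i hi => ?_
    rw [homogeneous_eq_range]
    rintro _ ⟨x, rfl⟩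
    exact hp.proj_mem_filt hi x
  · intro x hx
    refine hp.mem_of_proj_mem fun i => ?_
    by_cases hi : i ≤ n
    · refine Submodule.mem_iSup_of_mem i (Submodule.mem_iSup_of_mem hi ?_)
      rw [homogeneous_eq_range]
      exact ⟨x, rfl⟩
    · rw [mem_filt.1 hx i (by omega)]
      exact zero_mem _

theorem growth_eq_sum [Finite X] (H : LieSubalgebra F (FreeLieAlgebra F X)) (n : ℕ) :
    growth H.toSubmodule n =
      ∑ i ∈ Finset.Icc 1 n, dimComp (stdProj F X) (gr (isGrading_stdProj F X) H) i := by
  rw [growth, filtration_eq_filt, (isGrading_stdProj F X).finrank_inf_filt_eq]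

theorem degree_le_iff [Finite X] {u : FreeLieAlgebra F X} {n : ℕ} :
    degree u ≤ n ↔ u ∈ filt (stdProj F X) n := by
  have hmem : u ∈ filtration F X (degree u) := by
    refine Nat.sInf_mem (s := {n | u ∈ filtration F X n}) ?_
    obtain ⟨N, hN⟩ := (isGrading_stdProj F X).exists_mem_filt u
    exact ⟨N, by rw [Set.mem_ofPred_eq, filtration_eq_filt]; exact hN⟩
  constructor
  · intro h
    rw [filtration_eq_filt] at hmem
    exact filt_mono h hmem
  · intro h
    exact Nat.sInf_le (by rw [Set.mem_ofPred_eq, filtration_eq_filt]; exact h)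

theorem degree_ne_zero [Finite X] {u : FreeLieAlgebra F X} (hu : u ≠ 0) : degree u ≠ 0 := by
  intro h
  have := degree_le_iff.1 h.le
  rw [(isGrading_stdProj F X).filt_zero] at this
  exact hu this

theorem stdProj_degree_ne_zero [Finite X] {u : FreeLieAlgebra F X} (hu : u ≠ 0) :
    stdProj F X (degree u) u ≠ 0 := by
  intro h
  have hd := degree_ne_zero hu
  have h1 : u ∈ filt (stdProj F X) (degree u) := degree_le_iff.1 le_rfl
  have h2 : u ∈ filt (stdProj F X) (degree u - 1) := by
    rw [mem_filt] at h1 ⊢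
    intro j hj
    rcases (show degree u ≤ j by omega).eq_or_lt with rfl | h'
    · exact h
    · exact h1 j h'
  have := degree_le_iff.2 h2
  omega

theorem degree_eq [Finite X] {u : FreeLieAlgebra F X} {n : ℕ} (h : u ∈ filt (stdProj F X) n)
    (h' : stdProj F X n u ≠ 0) : degree u = n := by
  refine le_antisymm (degree_le_iff.2 h) ?_
  by_contra! hlt
  exact h' (mem_filt.1 (degree_le_iff.1 le_rfl) n hlt)

theorem isLeadingPart_iff [Finite X] {u v : FreeLieAlgebra F X} :
    IsLeadingPart u v ↔ u ≠ 0 ∧ v = stdProj F X (degree u) u := by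
  have hp := isGrading_stdProj F X
  constructor
  · rintro ⟨n, hv, hv0, huv⟩
    rw [homogeneous_eq_range] at hv
    rw [filtration_eq_filt] at huv
    obtain ⟨x, rfl⟩ := hv
    have h1 : stdProj F X (n + 1) u = stdProj F X (n + 1) x := by
      have := mem_filt.1 huv (n + 1) (by omega)
      rwa [map_sub, hp.proj_self, sub_eq_zero] at this
    have h2 : u ∈ filt (stdProj F X) (n + 1) := by
      have := add_mem (filt_mono (Nat.le_succ n) huv) (hp.proj_mem_filt (le_refl (n + 1)) x)
      rwa [sub_add_cancel] at this
    have hd : degree u = n + 1 := degree_eq h2 (by rw [h1]; exact hv0)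
    refine ⟨?_, by rw [hd, h1]⟩
    rintro rfl
    apply hv0
    rw [← h1, map_zero]
  · rintro ⟨hu, rfl⟩
    have hd := degree_ne_zero hu
    obtain ⟨n, hn⟩ := Nat.exists_eq_succ_of_ne_zero hd
    refine ⟨n, ?_, stdProj_degree_ne_zero hu, ?_⟩
    · rw [homogeneous_eq_range, hn]
      exact ⟨u, rfl⟩
    · rw [filtration_eq_filt, mem_filt]
      intro j hj
      rw [map_sub, hp.proj_proj]
      split_ifs with h
      · rw [h, sub_self]
      · rw [sub_zero]
        exact mem_filt.1 (degree_le_iff.1 le_rfl) j (by omega)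

theorem weightSeries_one [Fintype X] :
    weightSeries (fun _ : X => 1) = PowerSeries.C (Fintype.card X : ℝ) * PowerSeries.X := by
  ext n
  rw [weightSeries, PowerSeries.coeff_mk, PowerSeries.coeff_C_mul, PowerSeries.coeff_X, count]
  split_ifs with h
  · subst h
    simp [Set.ncard_univ]
  · have : {i : X | 1 = n} = ∅ := by
      ext i
      simp [Ne.symm h]
    simp [this]

/-- If every piece had dimension at most one, any two elements would be multiples of one vector and
commute. -/
theorem exists_two_le_growth [Finite X] {H : LieSubalgebra F (FreeLieAlgebra F X)}
    (hH : ¬ IsLieAbelian H) : ∃ N, 2 ≤ growth H.toSubmodule N := by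
  by_contra! hcon
  apply hH
  have hp := isGrading_stdProj F X
  have key : ∀ x ∈ H, ∀ y ∈ H, ⁅x, y⁆ = 0 := by
    intro x hx y hy
    obtain ⟨a, ha⟩ := hp.exists_mem_filt x
    obtain ⟨b, hb⟩ := hp.exists_mem_filt y
    have hle : Module.finrank F ↥(H.toSubmodule ⊓ filt (stdProj F X) (max a b)) ≤ 1 := by
      have := hcon (max a b)
      rw [growth, filtration_eq_filt] at this
      omega
    have := hp.finite_filt (max a b)
    have : FiniteDimensional F ↥(H.toSubmodule ⊓ filt (stdProj F X) (max a b)) :=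
      Submodule.finiteDimensional_of_le inf_le_right
    obtain ⟨v, hv⟩ := finrank_le_one_iff.1 hle
    obtain ⟨s, hs⟩ := hv ⟨x, hx, filt_mono (le_max_left _ _) ha⟩
    obtain ⟨t, ht⟩ := hv ⟨y, hy, filt_mono (le_max_right _ _) hb⟩
    have hs' : s • (v : FreeLieAlgebra F X) = x := congrArg Subtype.val hs
    have ht' : t • (v : FreeLieAlgebra F X) = y := congrArg Subtype.val ht
    rw [← hs', ← ht', smul_lie, lie_smul, lie_self, smul_zero, smul_zero]
  exact ⟨fun x y => Subtype.ext (key x x.2 y y.2)⟩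

theorem card_pos_of_not_abelian [Fintype X] {H : LieSubalgebra F (FreeLieAlgebra F X)}
    (hH : ¬ IsLieAbelian H) : 0 < Fintype.card X := by
  rw [Fintype.card_pos_iff]
  by_contra hX
  rw [not_nonempty_iff] at hX
  apply hH
  have hzero : ∀ x : FreeLieAlgebra F X, x = 0 := by
    intro x
    induction x using free_induction with
    | mem i => exact hX.elim i
    | zero => rfl
    | add x y hx hy => rw [hx, hy, add_zero]
    | smul a x hx => rw [hx, smul_zero]
    | lie x y hx hy => rw [hx, zero_lie]
  exact ⟨fun x y => Subtype.ext (hzero _)⟩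

theorem exists_isWitt_gr [Fintype X] (H : LieSubalgebra F (FreeLieAlgebra F X)) :
    ∃ k, IsWitt k (dimComp (stdProj F X) (gr (isGrading_stdProj F X) H)) :=
  freeFamily_std.exists_isWitt (isGrading_stdProj F X) (isHomogeneous_gr _ H)
    (by rw [range_lift_of]; exact le_top)

theorem exists_two_le_sum_of_not_abelian [Finite X] {H : LieSubalgebra F (FreeLieAlgebra F X)}
    (hH : ¬ IsLieAbelian H) {k : ℕ → ℕ}
    (hk : IsWitt k (dimComp (stdProj F X) (gr (isGrading_stdProj F X) H))) :
    ∃ M, 2 ≤ ∑ i ∈ Finset.Icc 1 M, k i := by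
  obtain ⟨N, hN⟩ := exists_two_le_growth hH
  rw [growth_eq_sum] at hN
  exact hk.exists_two_le_sum hN

/-- Nothing lives in degree `0`, so an element of degree one equals its leading part. If `gr H`
filled degree one, `H` would contain all free generators. -/
theorem dimComp_gr_one_ne [Finite X] {H : LieSubalgebra F (FreeLieAlgebra F X)} (hH : H ≠ ⊤) :
    dimComp (stdProj F X) (gr (isGrading_stdProj F X) H) 1 ≠
      dimComp (stdProj F X) (lift F (of F : X → FreeLieAlgebra F X)).range 1 := by
  have hp := isGrading_stdProj F X
  intro h
  apply hH
  have hfin := finite_map_proj hp (lift F (of F : X → FreeLieAlgebra F X)).range.toSubmodule 1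
  have heq := Submodule.eq_of_le_of_finrank_eq (Submodule.map_mono (f := stdProj F X 1)
    (show (gr hp H).toSubmodule ≤ (lift F (of F : X → FreeLieAlgebra F X)).range.toSubmodule by
      rw [range_lift_of]; exact le_top)) h
  rw [eq_top_iff, ← lieSpan_range_of, LieSubalgebra.lieSpan_le]
  rintro _ ⟨i, rfl⟩
  have hi : stdProj F X 1 (of F i) = of F i := freeProj_of_self (fun _ : X => 1) i
  have hmem : of F i ∈ (gr hp H).toSubmodule.map (stdProj F X 1) := by
    rw [heq]
    exact ⟨of F i, FreeFamily.mem_range i, hi⟩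
  have hmem' : of F i ∈ gr hp H := map_proj_eq_inf (isHomogeneous_gr hp H) hmem
  obtain ⟨u, ⟨hu, hu'⟩, hux⟩ := hmem' 1
  have : u = of F i := by
    refine hp.ext fun n => ?_
    rcases lt_trichotomy n 1 with hn | rfl | hn
    · rw [show n = 0 by omega, hp.proj_zero, hp.proj_zero]
    · exact hux
    · rw [mem_filt.1 hu' n hn, hp.proj_eq_zero hi (by omega)]
  rw [SetLike.mem_coe, ← this]
  exact hu

/-- The generators of the leading subalgebra satisfy Kraft's inequality. -/
theorem sum_gr_le_one [Fintype X] {H : LieSubalgebra F (FreeLieAlgebra F X)}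
    (hX : 0 < Fintype.card X) {k : ℕ → ℕ}
    (hk : IsWitt k (dimComp (stdProj F X) (gr (isGrading_stdProj F X) H))) (N : ℕ) :
    ∑ i ∈ Finset.range (N + 1), (k i : ℝ) * ((Fintype.card X : ℝ) ^ i)⁻¹ ≤ 1 ∧ (1 ≤ N → H ≠ ⊤ →
      ∑ i ∈ Finset.range (N + 1), (k i : ℝ) * ((Fintype.card X : ℝ) ^ i)⁻¹ < 1) := by
  have h := freeFamily_std.sum_le_one (isGrading_stdProj F X)
    (isHomogeneous_gr (isGrading_stdProj F X) H) (by rw [range_lift_of]; exact le_top) hX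
    weightSeries_one hk N
  exact ⟨h.1, fun hN hH => h.2 hN (dimComp_gr_one_ne hH)⟩

/-- Nonabelian subalgebras of a free Lie algebra have exponential growth. -/
theorem isExponential_growth [Fintype X] {H : LieSubalgebra F (FreeLieAlgebra F X)}
    (hH : ¬ IsLieAbelian H) : IsExponential (growth H.toSubmodule) := by
  obtain ⟨k, hk⟩ := exists_isWitt_gr H
  obtain ⟨M, hM⟩ := exists_two_le_sum_of_not_abelian hH hk
  obtain ⟨d, hd⟩ := exists_one_lt_wordCount hk.zero hM
  have hX := card_pos_of_not_abelian hH
  have hX' : (0 : ℝ) < Fintype.card X := by exact_mod_cast hX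
  have := hk.isExponential hX'
    (wordCount_le_pow hk.zero hX' fun n => (sum_gr_le_one hX hk n).1) hd
  rwa [← funext (growth_eq_sum H)] at this

end Standard

/-! ### Irreducible homogeneous families are free. -/

section Irreducible

open FreeLieAlgebra (of lift)

variable {F : Type*} [Field F] {G : Type*} [LieRing G] [LieAlgebra F G]
  {p : ℕ → G →ₗ[F] G}

/-- The span of the brackets of homogeneous elements of `E` of total degree `n`. -/
def decomposables (p : ℕ → G →ₗ[F] G) (E : LieSubalgebra F G) (n : ℕ) : Submodule F G :=
  Submodule.span F {z | ∃ a b : ℕ, a < n ∧ b < n ∧ a + b = n ∧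
    ∃ x ∈ E.toSubmodule.map (p a), ∃ y ∈ E.toSubmodule.map (p b), z = ⁅x, y⁆}

theorem decomposables_congr {E E' : LieSubalgebra F G} {n : ℕ}
    (h : ∀ a < n, E.toSubmodule.map (p a) = E'.toSubmodule.map (p a)) :
    decomposables p E n = decomposables p E' n := by
  unfold decomposables
  congr 1
  ext z
  constructor
  · rintro ⟨a, b, ha, hb, hab, hz⟩
    rw [h a ha, h b hb] at hz
    exact ⟨a, b, ha, hb, hab, hz⟩
  · rintro ⟨a, b, ha, hb, hab, hz⟩
    rw [← h a ha, ← h b hb] at hz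
    exact ⟨a, b, ha, hb, hab, hz⟩

theorem proj_lie_mem_decomposables (hp : IsGrading p) {E : LieSubalgebra F G} {x y : G}
    (hx : x ∈ E) (hy : y ∈ E) (n : ℕ) : p n ⁅x, y⁆ ∈ decomposables p E n := by
  rw [hp.proj_lie]
  refine sum_mem ?_
  rintro ⟨a, b⟩ hab
  have hab := Finset.HasAntidiagonal.mem_antidiagonal.1 hab
  simp only at hab ⊢
  rcases Nat.eq_zero_or_pos a with rfl | ha
  · rw [hp.proj_zero, zero_lie]; exact zero_mem _
  rcases Nat.eq_zero_or_pos b with rfl | hb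
  · rw [hp.proj_zero, lie_zero]; exact zero_mem _
  exact Submodule.subset_span
    ⟨a, b, by omega, by omega, hab, _, ⟨x, hx, rfl⟩, _, ⟨y, hy, rfl⟩, rfl⟩

/-- If the generators of degree `n` are independent modulo decomposables, their number is the
dimension of the space of indecomposables. -/
theorem count_eq_finrank (hp : IsGrading p) {J : Type*} {y : J → G} {v : J → ℕ}
    (hy : ∀ j, p (v j) (y j) = y j) {n : ℕ} (hfin : {j | v j = n}.Finite)
    (hli : LinearIndependent F (fun j : {j | v j = n} =>
      (decomposables p (lift F y).range n).mkQ (y j))) :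
    count v n = Module.finrank F
      (((lift F y).range.toSubmodule.map (p n)).map (decomposables p (lift F y).range n).mkQ) := by
  set E := (lift F y).range with hE
  set D := decomposables p E n
  have hspan : (E.toSubmodule.map (p n)).map D.mkQ =
      Submodule.span F (Set.range (fun j : {j | v j = n} => D.mkQ (y j))) := by
    apply le_antisymm
    · rintro _ ⟨_, ⟨x, hx, rfl⟩, rfl⟩
      have hx' : x ∈ LieSubalgebra.lieSpan F G (Set.range y) := by rwa [← range_lift]
      clear hx
      induction hx' using LieSubalgebra.lieSpan_induction with
      | mem z hz =>
        obtain ⟨j, rfl⟩ := hz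
        by_cases h : v j = n
        · rw [← h, hy, h]
          exact Submodule.subset_span ⟨⟨j, h⟩, rfl⟩
        · rw [hp.proj_eq_zero (hy j) (Ne.symm h), map_zero]
          exact zero_mem _
      | zero => rw [map_zero, map_zero]; exact zero_mem _
      | add a b _ _ ha hb => rw [map_add, map_add]; exact add_mem ha hb
      | smul t a _ ha => rw [map_smul, map_smul]; exact Submodule.smul_mem _ t ha
      | lie a b ha hb _ _ =>
        rw [← range_lift] at ha hb
        have : D.mkQ (p n ⁅a, b⁆) = 0 := by
          rw [Submodule.mkQ_apply, Submodule.Quotient.mk_eq_zero]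
          exact proj_lie_mem_decomposables hp ha hb n
        rw [this]
        exact zero_mem _
    · rw [Submodule.span_le]
      rintro _ ⟨⟨j, rfl⟩, rfl⟩
      exact ⟨y j, ⟨y j, FreeFamily.mem_range j, hy j⟩, rfl⟩
  have := hfin.fintype
  rw [hspan, finrank_span_eq_card hli, count, Set.ncard_eq_toFinset_card', Set.toFinset_card]

/-- The functional dual to one free generator vanishes on brackets, so it separates that generator
from the others and the decomposables. -/
theorem FreeFamily.linearIndependent_mkQ (hp : IsGrading p) {ι : Type*} {b : ι → G} {w : ι → ℕ}
    (hb : FreeFamily p b w) (n : ℕ) :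
    LinearIndependent F (fun j : {j | w j = n} =>
      (decomposables p (lift F b).range n).mkQ (b j)) := by
  classical
  rw [linearIndependent_iff']
  intro s g hg j hj
  obtain ⟨φ, hφ, hφ'⟩ := exists_functional (F := F) (fun i => if i = (j : ι) then (1 : F) else 0)
  simp only [← map_smul, ← map_sum] at hg
  rw [Submodule.mkQ_apply, Submodule.Quotient.mk_eq_zero] at hg
  have hle : decomposables p (lift F b).range n ≤
      (LinearMap.ker φ).map (lift F b : FreeLieAlgebra F ι →ₗ[F] G) := by
    rw [decomposables, Submodule.span_le]
    rintro _ ⟨a, c, -, -, -, x, hx, y, hy, rfl⟩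
    obtain ⟨u, rfl⟩ := map_proj_eq_inf (hb.isHomogeneous_range hp) hx
    obtain ⟨u', rfl⟩ := map_proj_eq_inf (hb.isHomogeneous_range hp) hy
    exact ⟨⁅u, u'⁆, hφ' u u', LieHom.map_lie _ _ _⟩
  obtain ⟨z, hz, hz'⟩ := hle hg
  have : z = ∑ i ∈ s, g i • of F (i : ι) := by
    apply hb.injective
    refine hz'.trans ?_
    simp only [map_sum, map_smul, FreeLieAlgebra.lift_of_apply]
  have hz0 : φ z = 0 := hz
  rw [this, map_sum] at hz0
  simp only [map_smul, hφ, smul_eq_mul, mul_ite, mul_one, mul_zero] at hz0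
  rw [Finset.sum_eq_single_of_mem j hj] at hz0
  · simpa using hz0
  · intro i _ hij
    rw [if_neg]
    exact fun h => hij (Subtype.ext h)

/-- A relation with nonzero coefficient at `j` expresses `y j` through other generators and
decomposables. The latter are built from degrees below `n = v j`, where `y j` plays no part. -/
theorem linearIndependent_mkQ_of_irreducible (hp : IsGrading p) {J : Type*} {y : J → G} {v : J → ℕ}
    (hy : ∀ j, p (v j) (y j) = y j)
    (hirr : ∀ j, y j ∉ LieSubalgebra.lieSpan F G {x | ∃ i ≠ j, y i = x}) (n : ℕ) :
    LinearIndependent F (fun j : {j | v j = n} =>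
      (decomposables p (lift F y).range n).mkQ (y j)) := by
  classical
  rw [linearIndependent_iff']
  intro s g hg j hj
  by_contra hgj
  apply hirr j
  set U := LieSubalgebra.lieSpan F G {x | ∃ i ≠ (j : J), y i = x}
  have hmem : ∀ i ≠ (j : J), y i ∈ U := fun i hi => LieSubalgebra.subset_lieSpan ⟨i, hi, rfl⟩
  simp only [← map_smul, ← map_sum] at hg
  rw [Submodule.mkQ_apply, Submodule.Quotient.mk_eq_zero] at hg
  have hlow : ∀ x ∈ (lift F y).range, ∀ a < n, p a x ∈ U := by
    intro x hx
    rw [range_lift] at hx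
    induction hx using LieSubalgebra.lieSpan_induction with
    | mem z hz =>
      obtain ⟨i, rfl⟩ := hz
      intro a ha
      by_cases h : a = v i
      · rw [h, hy]
        refine hmem i ?_
        rintro rfl
        have : v j = n := j.2
        omega
      · rw [hp.proj_eq_zero (hy i) h]
        exact zero_mem _
    | zero => intro a _; rw [map_zero]; exact zero_mem _
    | add u w _ _ hu hw => intro a ha; rw [map_add]; exact add_mem (hu a ha) (hw a ha)
    | smul t u _ hu => intro a ha; rw [map_smul]; exact SMulMemClass.smul_mem t (hu a ha)
    | lie u w _ _ hu hw =>
      intro a ha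
      rw [hp.proj_lie]
      refine sum_mem fun ij hij => ?_
      have := Finset.HasAntidiagonal.mem_antidiagonal.1 hij
      exact U.lie_mem (hu _ (by omega)) (hw _ (by omega))
  have hD : decomposables p (lift F y).range n ≤ U.toSubmodule := by
    rw [decomposables, Submodule.span_le]
    rintro _ ⟨a, b, ha, hb, -, _, ⟨x, hx, rfl⟩, _, ⟨z, hz, rfl⟩, rfl⟩
    exact U.lie_mem (hlow x hx a ha) (hlow z hz b hb)
  have hsum : g j • y j = (∑ i ∈ s, g i • y i) - ∑ i ∈ s.erase j, g i • y i := by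
    rw [← Finset.add_sum_erase _ _ hj, add_sub_cancel_right]
  have hgy : g j • y j ∈ U := by
    rw [hsum]
    refine sub_mem (hD hg) (sum_mem fun i hi => SMulMemClass.smul_mem _ (hmem i ?_))
    exact fun h => Finset.ne_of_mem_erase hi (Subtype.ext h)
  have := SMulMemClass.smul_mem (g j)⁻¹ hgy
  rwa [smul_smul, inv_mul_cancel₀ hgj, one_smul] at this

/-- A homogeneous family none of whose members lies in the subalgebra generated by the others is
free, inside a free Lie algebra. -/
theorem freeFamily_of_irreducible (hp : IsGrading p) {ι : Type*} {b : ι → G} {w : ι → ℕ}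
    (hb : FreeFamily p b w) {J : Type*} [Finite J] {y : J → G} {v : J → ℕ}
    (hle : (lift F y).range ≤ (lift F b).range) (hy : ∀ j, p (v j) (y j) = y j)
    (hirr : ∀ j, y j ∉ LieSubalgebra.lieSpan F G {x | ∃ i ≠ j, y i = x}) :
    FreeFamily p y v := by
  refine ⟨?_, hy⟩
  have hv : ∀ j, v j ≠ 0 := by
    intro j hj
    apply hirr j
    rw [← hy j, hj, hp.proj_zero]
    exact zero_mem _
  have hq := isGrading_freeProj (F := F) v hv
  have hhom : IsHomogeneousSubalgebra p (lift F y).range := by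
    rw [range_lift]
    refine isHomogeneous_lieSpan hp ?_
    rintro _ ⟨j, rfl⟩
    exact ⟨v j, hy j⟩
  have hcomm : ∀ n x, lift F y (freeProj F v n x) = p n (lift F y x) := by
    intro n x
    induction x using free_induction generalizing n with
    | mem i =>
      rw [freeProj_of, FreeLieAlgebra.lift_of_apply]
      split_ifs with h
      · rw [h, hy, FreeLieAlgebra.lift_of_apply]
      · rw [map_zero, hp.proj_eq_zero (hy i) h]
    | zero => simp
    | add x z hx hz => simp only [map_add, hx, hz]
    | smul t x hx => simp only [map_smul, hx]
    | lie x z hx hz =>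
      rw [hq.proj_lie, LieHom.map_lie, hp.proj_lie, map_sum]
      exact Finset.sum_congr rfl fun ij _ => by rw [LieHom.map_lie, hx, hz]
  -- A chain gives a free family whose range agrees with that of `y` up to degree `n`. In both
  -- families the generators of a given weight number the dimension of the indecomposables, so
  -- Witt's formula matches the abstract free algebra on `J` with the subalgebra.
  have hdim : ∀ n, dimComp (freeProj F v) (lift F (of F)).range n =
      dimComp p (lift F y).range n := by
    intro n
    rcases Nat.eq_zero_or_pos n with rfl | hn
    · have h1 : freeProj F v 0 = 0 := LinearMap.ext hq.proj_zero
      have h2 : p 0 = 0 := LinearMap.ext hp.proj_zero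
      rw [dimComp, dimComp, h1, h2, Submodule.map_zero, Submodule.map_zero, finrank_bot, finrank_bot]
    obtain ⟨ι', b', w', hb', -, heq, -⟩ := hb.exists_chain hp hhom n hle
    have hcount : ∀ j ≤ n, count v j = count w' j := by
      intro j hj
      have hD := decomposables_congr (p := p) (n := j) fun a ha => heq a (by omega)
      rw [count_eq_finrank hp hb'.homogeneous (hb'.finite_weight hp j)
        (hb'.linearIndependent_mkQ hp j), count_eq_finrank hp hy (Set.toFinite _)
        (linearIndependent_mkQ_of_irreducible hp hy hirr j), heq j hj, hD]
    have := eq_of_coeff_wittProd_eq (N := n)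
      (ℓ := dimComp (freeProj F v) (lift F (of F)).range)
      (ℓ' := dimComp p (lift F b').range) fun j hj => by
        rw [← (freeFamily_of v).coeff_one_sub_weightSeries hq,
          ← hb'.coeff_one_sub_weightSeries hp]
        simp only [weightSeries, map_sub, PowerSeries.coeff_mk, hcount j hj]
    rw [this n (Finset.mem_Icc.2 ⟨hn, le_rfl⟩), dimComp, heq n le_rfl, dimComp]
  -- In each degree the lift is a surjection between spaces of equal finite dimension.
  rw [injective_iff_map_eq_zero]
  intro x hx
  refine hq.ext fun n => ?_
  rw [map_zero]
  set A := (lift F (of F : J → FreeLieAlgebra F J)).range.toSubmodule.map (freeProj F v n)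
  have hA : FiniteDimensional F A := finite_map_proj hq _ n
  have hmap : A.map (lift F y : FreeLieAlgebra F J →ₗ[F] G) =
      (lift F y).range.toSubmodule.map (p n) := by
    apply le_antisymm
    · rintro _ ⟨_, ⟨z, -, rfl⟩, rfl⟩
      exact ⟨lift F y z, ⟨z, rfl⟩, (hcomm n z).symm⟩
    · rintro _ ⟨_, ⟨z, rfl⟩, rfl⟩
      refine ⟨freeProj F v n z, ⟨z, ?_, rfl⟩, hcomm n z⟩
      rw [range_lift_of]
      trivial
  have hrank := LinearMap.finrank_range_add_finrank_ker
    ((lift F y : FreeLieAlgebra F J →ₗ[F] G).domRestrict A)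
  rw [LinearMap.range_domRestrict, hmap] at hrank
  have hdim' : Module.finrank F A = Module.finrank F ((lift F y).range.toSubmodule.map (p n)) :=
    hdim n
  have hker : LinearMap.ker ((lift F y : FreeLieAlgebra F J →ₗ[F] G).domRestrict A) = ⊥ := by
    rw [← Submodule.finrank_eq_zero (R := F)]
    omega
  have hxA : freeProj F v n x ∈ A := ⟨x, by rw [range_lift_of]; trivial, rfl⟩
  have hmem : (⟨freeProj F v n x, hxA⟩ : A) ∈
      LinearMap.ker ((lift F y : FreeLieAlgebra F J →ₗ[F] G).domRestrict A) := by
    rw [LinearMap.mem_ker, LinearMap.domRestrict_apply]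
    change lift F y (freeProj F v n x) = 0
    rw [hcomm, hx, map_zero]
  rw [hker, Submodule.mem_bot] at hmem
  exact congrArg Subtype.val hmem

theorem IsGrading.sum_of_mem_filt (hp : IsGrading p) {n : ℕ} {x : G} (hx : x ∈ filt p n) :
    ∑ i ∈ Finset.range (n + 1), p i x = x := by
  refine hp.ext fun j => ?_
  simp only [map_sum, hp.proj_proj, Finset.sum_ite_eq, Finset.mem_range]
  split_ifs with h
  · rfl
  · rw [mem_filt.1 hx j (by omega)]

theorem mem_filt_pred {n : ℕ} {x : G} (hx : x ∈ filt p n) (h : p n x = 0) :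
    x ∈ filt p (n - 1) := by
  rw [mem_filt] at hx ⊢
  intro j hj
  rcases (show n ≤ j by omega).eq_or_lt with rfl | h'
  · exact h
  · exact hx j h'

/-- If the leading parts of the generators of `H` are free, they generate the leading subalgebra. -/
theorem gr_eq_of_free_lead (hp : IsGrading p) {J : Type*} [Finite J] {y : J → G} {v : J → ℕ}
    (hy : ∀ j, y j ∈ filt p (v j)) (hfree : FreeFamily p (fun j => p (v j) (y j)) v) :
    gr hp (lift F y).range = (lift F (fun j => p (v j) (y j))).range := by
  set y' : J → G := fun j => p (v j) (y j)
  have hq := isGrading_freeProj (F := F) v (hfree.weight_ne_zero hp)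
  -- Lower terms of the `y j` never reach the top degree, where `y` may thus be replaced by its
  -- leading parts.
  have key : ∀ x d, lift F y (freeProj F v d x) ∈ filt p d ∧
      p d (lift F y (freeProj F v d x)) = lift F y' (freeProj F v d x) := by
    intro x
    induction x using free_induction with
    | mem i =>
      intro d
      rw [freeProj_of]
      split_ifs with h
      · rw [FreeLieAlgebra.lift_of_apply, FreeLieAlgebra.lift_of_apply, h]
        exact ⟨hy i, rfl⟩
      · simp
    | zero => intro d; simp
    | add x z hx hz =>
      intro d
      simp only [map_add]
      exact ⟨add_mem (hx d).1 (hz d).1, by rw [(hx d).2, (hz d).2]⟩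
    | smul t x hx =>
      intro d
      simp only [map_smul]
      exact ⟨Submodule.smul_mem _ t (hx d).1, by rw [(hx d).2]⟩
    | lie x z hx hz =>
      intro d
      rw [hq.proj_lie]
      simp only [map_sum, LieHom.map_lie]
      constructor
      · refine sum_mem fun ij hij => ?_
        rw [← Finset.HasAntidiagonal.mem_antidiagonal.1 hij]
        exact (hp.lie_mem_filt (hx _).1 (hz _).1).1
      · refine Finset.sum_congr rfl fun ij hij => ?_
        rw [← (hx _).2, ← (hz _).2, ← Finset.HasAntidiagonal.mem_antidiagonal.1 hij]
        exact (hp.lie_mem_filt (hx _).1 (hz _).1).2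
  have key2 : ∀ d, ∀ f ∈ filt (freeProj F v) d,
      p d (lift F y f) = lift F y' (freeProj F v d f) := by
    intro d f hf
    conv_lhs => rw [← hq.sum_of_mem_filt hf]
    rw [map_sum, map_sum, Finset.sum_range_succ, (key f d).2, add_eq_right]
    refine Finset.sum_eq_zero fun i hi => ?_
    exact mem_filt.1 (key f i).1 d (Finset.mem_range.1 hi)
  apply le_antisymm
  · intro x hx
    refine hp.mem_of_proj_mem (W := (lift F y').range.toSubmodule) fun n => ?_
    obtain ⟨u, ⟨⟨f, rfl⟩, hu⟩, hux⟩ := hx n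
    rw [← hux]
    have hex := hq.exists_mem_filt f
    classical
    have hd := Nat.find_spec hex
    have hmin := fun j => Nat.find_min hex (m := j)
    set d := Nat.find hex
    -- Freeness of the leading parts rules out cancellation: the top weight of `f` survives in its
    -- image.
    have hdn : d ≤ n := by
      by_contra! hlt
      refine hmin (d - 1) (by omega) (mem_filt_pred hd ?_)
      apply hfree.injective
      rw [← key2 d f hd, map_zero]
      exact mem_filt.1 hu d hlt
    exact ⟨freeProj F v n f, (key2 n f (filt_mono hdn hd)).symm⟩
  · rw [range_lift, LieSubalgebra.lieSpan_le]
    rintro _ ⟨j, rfl⟩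
    exact mem_gr_of_mem_lead hp (n := v j) ⟨y j, ⟨FreeFamily.mem_range j, hy j⟩, rfl⟩

end Irreducible

/-! ### The characteristic equation. -/

section Root

/-- The characteristic equation of a weight distribution with at least two generators has exactly
one positive root. -/
theorem exists_unique_root {k : ℕ → ℕ} {d : ℕ} {m : ℝ} (hm : 1 ≤ m)
    (h2 : 2 ≤ ∑ i ∈ Finset.Icc 1 d, k i)
    (hle : ∑ i ∈ Finset.Icc 1 d, (k i : ℝ) * (m ^ i)⁻¹ ≤ 1) :
    ∃ r : ℝ, 1 < r ∧ ∑ i ∈ Finset.Icc 1 d, (k i : ℝ) * (r ^ i)⁻¹ = 1 ∧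
      (∑ i ∈ Finset.Icc 1 d, (k i : ℝ) * (m ^ i)⁻¹ < 1 → r < m) ∧ IsIntegral ℤ r ∧
      ∀ z : ℝ, 0 < z → (z ^ d = ∑ i ∈ Finset.Icc 1 d, (k i : ℝ) * z ^ (d - i) ↔ z = r) := by
  -- Divided by `z ^ d`, the equation is `f z = 1`, where `f` decreases strictly on the positive
  -- reals from `f 1 ≥ 2` to `f m ≤ 1`.
  set f : ℝ → ℝ := fun z => ∑ i ∈ Finset.Icc 1 d, (k i : ℝ) * (z ^ i)⁻¹ with hf
  have h2' : (2 : ℝ) ≤ f 1 := by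
    simp only [hf, one_pow, inv_one, mul_one]
    exact_mod_cast h2
  have hcont : ContinuousOn f (Set.Icc 1 m) := by
    refine continuousOn_finsetSum _ fun i _ => ContinuousOn.mul continuousOn_const
      (ContinuousOn.inv₀ (continuousOn_id.pow i) fun z hz => pow_ne_zero _ ?_)
    have h1 : (1 : ℝ) ≤ z := hz.1
    exact (show (0 : ℝ) < z by linarith).ne'
  obtain ⟨r, ⟨hr1, hrm⟩, hr⟩ := intermediate_value_Icc' hm hcont
    (show (1 : ℝ) ∈ Set.Icc (f m) (f 1) from ⟨hle, by linarith⟩)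
  have hr1' : 1 < r := by
    rcases hr1.eq_or_lt with rfl | h
    · linarith
    · exact h
  have hr0 : 0 < r := by linarith
  have hanti : ∀ x y : ℝ, 0 < x → x < y → f y < f x := by
    intro x y hx hxy
    have hy : 0 < y := hx.trans hxy
    obtain ⟨p, hp, hkp⟩ : ∃ p ∈ Finset.Icc 1 d, k p ≠ 0 := by
      by_contra! hcon
      rw [Finset.sum_eq_zero hcon] at h2
      omega
    refine Finset.sum_lt_sum (fun i _ => ?_) ⟨p, hp, ?_⟩
    · exact mul_le_mul_of_nonneg_left
        (inv_anti₀ (pow_pos hx i) (pow_le_pow_left₀ hx.le hxy.le i)) (Nat.cast_nonneg _)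
    · have hp1 := (Finset.mem_Icc.1 hp).1
      exact mul_lt_mul_of_pos_left
        (inv_strictAnti₀ (pow_pos hx p) (pow_lt_pow_left₀ hxy hx.le (by omega)))
        (by exact_mod_cast Nat.pos_of_ne_zero hkp)
  have hinj : ∀ z : ℝ, 0 < z → f z = 1 → z = r := by
    intro z hz hz1
    rcases lt_trichotomy z r with h | h | h
    · have := hanti z r hz h; linarith
    · exact h
    · have := hanti r z hr0 h; linarith
  have hiff : ∀ z : ℝ, 0 < z →
      (z ^ d = ∑ i ∈ Finset.Icc 1 d, (k i : ℝ) * z ^ (d - i) ↔ f z = 1) := by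
    intro z hz
    have hsum : ∑ i ∈ Finset.Icc 1 d, (k i : ℝ) * z ^ (d - i) = z ^ d * f z := by
      rw [hf, Finset.mul_sum]
      refine Finset.sum_congr rfl fun i hi => ?_
      have hid := (Finset.mem_Icc.1 hi).2
      have : z ^ d = z ^ (d - i) * z ^ i := by rw [← pow_add]; congr 1; omega
      have hzi := (pow_pos hz i).ne'
      rw [this]
      field_simp
    rw [hsum]
    have hzd := (pow_pos hz d).ne'
    constructor
    · intro h
      exact (mul_left_cancel₀ hzd (by rw [← h, mul_one])).symm
    · intro h
      rw [h, mul_one]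
  refine ⟨r, hr1', hr, fun hlt => ?_, ?_, fun z hz => ?_⟩
  · refine lt_of_le_of_ne hrm ?_
    rintro rfl
    exact hlt.ne hr
  · have hd : d ≠ 0 := by
      rintro rfl
      simp at h2
    set q : Polynomial ℤ := ∑ i ∈ Finset.Icc 1 d, Polynomial.C (k i : ℤ) * Polynomial.X ^ (d - i)
    have hq : q.degree < d := by
      refine (Polynomial.degree_sum_le _ _).trans_lt ?_
      rw [Finset.sup_lt_iff (by exact WithBot.bot_lt_coe d)]
      intro i hi
      have := Finset.mem_Icc.1 hi
      refine (Polynomial.degree_C_mul_X_pow_le _ _).trans_lt ?_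
      exact_mod_cast (by omega : d - i < d)
    refine ⟨Polynomial.X ^ d - q, Polynomial.monic_X_pow_sub hq, ?_⟩
    rw [Polynomial.eval₂_sub, Polynomial.eval₂_X_pow, Polynomial.eval₂_finsetSum, sub_eq_zero,
      (hiff r hr0).2 hr]
    refine Finset.sum_congr rfl fun i _ => ?_
    simp
  · rw [hiff z hz]
    exact ⟨hinj z hz, fun h => by rw [h]; exact hr⟩

end Root

/-! ### Finite irreducible generating sets. -/

section FinitelyGenerated

open FreeLieAlgebra (of lift)

variable {F : Type*} [Field F] {X : Type*}

theorem HasBase.unique {f : ℕ → ℕ} {a b : ℝ} (ha : HasBase f a) (hb : HasBase f b) : a = b :=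
  tendsto_nhds_unique ha hb

theorem range_lift_coe (Y : Finset (FreeLieAlgebra F X)) :
    (lift F (fun y : Y => (y : FreeLieAlgebra F X))).range =
      LieSubalgebra.lieSpan F (FreeLieAlgebra F X) (Y : Set (FreeLieAlgebra F X)) := by
  rw [range_lift]
  congr 1
  ext x
  simp

/-- The leading parts of a finite irreducible set are free and generate the leading subalgebra. -/
theorem isWitt_of_irreducible [Fintype X] {Y : Finset (FreeLieAlgebra F X)}
    (hY : IsIrreducible (Y : Set (FreeLieAlgebra F X))) :
    IsWitt (count (fun y : Y => degree (y : FreeLieAlgebra F X)))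
      (dimComp (stdProj F X) (gr (isGrading_stdProj F X) (LieSubalgebra.lieSpan F
        (FreeLieAlgebra F X) (Y : Set (FreeLieAlgebra F X))))) := by
  have hp := isGrading_stdProj F X
  have hfree : FreeFamily (stdProj F X)
      (fun y : Y => stdProj F X (degree (y : FreeLieAlgebra F X)) y)
      (fun y : Y => degree (y : FreeLieAlgebra F X)) := by
    refine freeFamily_of_irreducible hp freeFamily_std (by rw [range_lift_of]; exact le_top)
      (fun y => hp.proj_self _ _) fun y hy => ?_
    refine (hY y y.2).2 _ (isLeadingPart_iff.2 ⟨(hY y y.2).1, rfl⟩) (LieSubalgebra.lieSpan_mono ?_ hy)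
    rintro _ ⟨z, hz, rfl⟩
    exact ⟨z, ⟨z.2, fun h => hz (Subtype.ext h)⟩, isLeadingPart_iff.2 ⟨(hY z z.2).1, rfl⟩⟩
  have hgr := gr_eq_of_free_lead hp (fun y => degree_le_iff.1 le_rfl) hfree
  rw [← range_lift_coe, hgr]
  exact hfree.isWitt hp


theorem count_degree (Y : Finset (FreeLieAlgebra F X)) (n : ℕ) :
    count (fun y : Y => degree (y : FreeLieAlgebra F X)) n =
      (Y.filter (fun y => degree y = n)).card := by
  rw [count, ← Set.ncard_image_of_injective _ Subtype.val_injective, ← Set.ncard_coe_finset]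
  congr 1
  ext y
  simp [and_comm]

/-- Every finite set generates the same subalgebra as some finite irreducible set. -/
theorem exists_irreducible [Finite X] (s : Finset (FreeLieAlgebra F X)) :
    ∃ Y : Finset (FreeLieAlgebra F X), IsIrreducible (Y : Set (FreeLieAlgebra F X)) ∧
      LieSubalgebra.lieSpan F (FreeLieAlgebra F X) (Y : Set (FreeLieAlgebra F X)) =
        LieSubalgebra.lieSpan F (FreeLieAlgebra F X) (s : Set (FreeLieAlgebra F X)) := by
  classical
  have hp := isGrading_stdProj F X
  -- The summand `1` makes the measure drop even when the element `0`, of degree `0`, is discarded.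
  obtain ⟨D, hD⟩ : ∃ D, ∑ y ∈ s, (degree y + 1) = D := ⟨_, rfl⟩
  induction D using Nat.strong_induction_on generalizing s with
  | _ D ih =>
  by_cases hs : IsIrreducible (s : Set (FreeLieAlgebra F X))
  · exact ⟨s, hs, rfl⟩
  rw [IsIrreducible] at hs
  push Not at hs
  obtain ⟨u, hu, hu'⟩ := hs
  have hus : u ∈ s := hu
  have hsum := Finset.add_sum_erase s (fun y => degree y + 1) hus
  have hcoe : ((s.erase u : Finset (FreeLieAlgebra F X)) : Set (FreeLieAlgebra F X)) =
      (s : Set (FreeLieAlgebra F X)) \ {u} := Finset.coe_erase u s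
  by_cases hu0 : u = 0
  · obtain ⟨Y, hY, hY'⟩ := ih _ (by omega) (s.erase u) rfl
    refine ⟨Y, hY, hY'.trans (le_antisymm (LieSubalgebra.lieSpan_mono (by simp)) ?_)⟩
    rw [LieSubalgebra.lieSpan_le]
    intro y hy
    by_cases hyu : y = u
    · rw [hyu, hu0]; exact zero_mem _
    · exact LieSubalgebra.subset_lieSpan (by rw [hcoe]; exact ⟨hy, hyu⟩)
  · obtain ⟨v, hv, hvmem⟩ := hu' hu0
    set Q := LieSubalgebra.lieSpan F (FreeLieAlgebra F X)
      ((s.erase u : Finset (FreeLieAlgebra F X)) : Set (FreeLieAlgebra F X)) with hQ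
    have hle : LieSubalgebra.lieSpan F (FreeLieAlgebra F X)
        {w | ∃ y ∈ (s : Set (FreeLieAlgebra F X)) \ {u}, IsLeadingPart y w} ≤ gr hp Q := by
      rw [LieSubalgebra.lieSpan_le]
      rintro w ⟨y, hy, hw⟩
      rw [isLeadingPart_iff] at hw
      refine mem_gr_of_mem_lead hp (n := degree y)
        ⟨y, ⟨LieSubalgebra.subset_lieSpan (by rw [hcoe]; exact hy), degree_le_iff.1 le_rfl⟩,
          hw.2.symm⟩
    -- Some `q` generated by the other elements has the leading part of `u`, so `u` can be replaced
    -- by `u - q` of smaller degree.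
    obtain ⟨q, ⟨hq, hq'⟩, hqv⟩ := hle hvmem (degree u)
    rw [(isLeadingPart_iff.1 hv).2, hp.proj_self] at hqv
    have hd := degree_ne_zero hu0
    have hdeg : degree (u - q) < degree u := by
      have h1 : u - q ∈ filt (stdProj F X) (degree u - 1) := by
        refine mem_filt_pred (sub_mem (degree_le_iff.1 le_rfl) hq') ?_
        rw [map_sub, hqv, sub_self]
      have := degree_le_iff.2 h1
      omega
    have hins : ∑ y ∈ insert (u - q) (s.erase u), (degree y + 1) ≤
        (degree (u - q) + 1) + ∑ y ∈ s.erase u, (degree y + 1) := by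
      by_cases h : u - q ∈ s.erase u
      · rw [Finset.insert_eq_of_mem h]; omega
      · rw [Finset.sum_insert h]
    obtain ⟨Y, hY, hY'⟩ := ih _ (by omega) (insert (u - q) (s.erase u)) rfl
    have hQs : Q ≤ LieSubalgebra.lieSpan F (FreeLieAlgebra F X) (s : Set (FreeLieAlgebra F X)) :=
      LieSubalgebra.lieSpan_mono (by simp)
    refine ⟨Y, hY, hY'.trans (le_antisymm ?_ ?_)⟩
    · rw [LieSubalgebra.lieSpan_le, Finset.coe_insert, Set.insert_subset_iff]
      exact ⟨sub_mem (LieSubalgebra.subset_lieSpan hu) (hQs hq),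
        fun y hy => hQs (LieSubalgebra.subset_lieSpan hy)⟩
    · have hQi : Q ≤ LieSubalgebra.lieSpan F (FreeLieAlgebra F X)
          ((insert (u - q) (s.erase u) : Finset (FreeLieAlgebra F X)) :
            Set (FreeLieAlgebra F X)) :=
        LieSubalgebra.lieSpan_mono (by rw [Finset.coe_insert]; exact Set.subset_insert _ _)
      rw [LieSubalgebra.lieSpan_le]
      intro y hy
      by_cases hyu : y = u
      · have h := add_mem (LieSubalgebra.subset_lieSpan (R := F) (by simp) :
          u - q ∈ LieSubalgebra.lieSpan F (FreeLieAlgebra F X)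
            ((insert (u - q) (s.erase u) : Finset (FreeLieAlgebra F X)) :
              Set (FreeLieAlgebra F X))) (hQi hq)
        rw [sub_add_cancel] at h
        rwa [hyu]
      · exact hQi (LieSubalgebra.subset_lieSpan (by rw [hcoe]; exact ⟨hy, hyu⟩))

/-- The base of the growth of a finitely generated subalgebra in terms of a given finite
irreducible generating set. -/
theorem exists_base_of_irreducible [Fintype X] {H : LieSubalgebra F (FreeLieAlgebra F X)}
    (hH : ¬ IsLieAbelian H) {Y : Finset (FreeLieAlgebra F X)}
    (hY : IsIrreducible (Y : Set (FreeLieAlgebra F X)))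
    (hYH : LieSubalgebra.lieSpan F (FreeLieAlgebra F X) (Y : Set (FreeLieAlgebra F X)) = H)
    {d : ℕ} {k : ℕ → ℕ} (hd : d = Y.sup degree)
    (hk : ∀ i, k i = (Y.filter (fun y => degree y = i)).card) :
    ∃ r : ℝ, 1 < r ∧ HasBase (growth H.toSubmodule) r ∧ (H ≠ ⊤ → r < Fintype.card X) ∧
      IsIntegral ℤ r ∧
      ∀ z : ℝ, 0 < z → (z ^ d = ∑ i ∈ Finset.Icc 1 d, (k i : ℝ) * z ^ (d - i) ↔ z = r) := by
  have hW := isWitt_of_irreducible hY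
  rw [hYH, show count (fun y : Y => degree (y : FreeLieAlgebra F X)) = k from
    funext fun n => (count_degree Y n).trans (hk n).symm] at hW
  have hX := card_pos_of_not_abelian hH
  have hk0 := hW.zero
  have hkd : ∀ i, d < i → k i = 0 := by
    intro i hi
    rw [hk, Finset.card_eq_zero, Finset.filter_eq_empty_iff]
    intro y hy h
    have := Finset.le_sup (f := degree) hy
    omega
  obtain ⟨M, hM⟩ := exists_two_le_sum_of_not_abelian hH hW
  have h2 : 2 ≤ ∑ i ∈ Finset.Icc 1 d, k i := by
    refine hM.trans ?_
    rw [← Finset.sum_filter_ne_zero]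
    refine Finset.sum_le_sum_of_subset fun i hi => ?_
    obtain ⟨hi1, hi2⟩ := Finset.mem_filter.1 hi
    refine Finset.mem_Icc.2 ⟨(Finset.mem_Icc.1 hi1).1, ?_⟩
    by_contra! h
    exact hi2 (hkd i h)
  have hd1 : 1 ≤ d := by
    by_contra! h
    rw [show d = 0 by omega] at h2
    simp at h2
  have hrange : ∀ r : ℝ, ∑ i ∈ Finset.range (d + 1), (k i : ℝ) * (r ^ i)⁻¹ =
      ∑ i ∈ Finset.Icc 1 d, (k i : ℝ) * (r ^ i)⁻¹ := by
    intro r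
    symm
    refine Finset.sum_subset (fun i hi => ?_) fun i hi hi' => ?_
    · have := Finset.mem_Icc.1 hi
      exact Finset.mem_range.2 (by omega)
    · have h1 := Finset.mem_range.1 hi
      have : i = 0 := by
        by_contra h0
        exact hi' (Finset.mem_Icc.2 ⟨by omega, by omega⟩)
      rw [this, hk0]
      simp
  have hkraft := sum_gr_le_one hX hW d
  rw [hrange] at hkraft
  obtain ⟨r, hr1, hr, hrm, hint, hz⟩ := exists_unique_root
    (m := (Fintype.card X : ℝ)) (by exact_mod_cast hX) h2 hkraft.1
  refine ⟨r, hr1, ?_, fun hne => hrm (hkraft.2 hd1 hne), hint, hz⟩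
  rw [funext (growth_eq_sum H)]
  refine hW.hasBase_of_hasSum hr1.le ?_
  rw [← hr]
  refine hasSum_sum_of_ne_finset_zero fun i hi => ?_
  rcases Nat.eq_zero_or_pos i with rfl | hi0
  · simp [hk0]
  · rw [hkd i (by by_contra! h; exact hi (Finset.mem_Icc.2 ⟨hi0, h⟩))]
    simp

end FinitelyGenerated

/-! ### Digit expansions of one in a real base. -/

section Digits

/-- Quasi-greedy expansions: every `r ∈ (1, m]` has digits at most `m - 1` that represent `1`. -/
theorem exists_digits {m : ℕ} {r : ℝ} (hr : 1 < r) (hrm : r ≤ m) :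
    ∃ e : ℕ → ℕ, e 0 = 0 ∧ (∀ n, e n ≤ m - 1) ∧ HasSum (fun n => (e n : ℝ) * (r ^ n)⁻¹) 1 := by
  have hr0 : 0 < r := by linarith
  -- Subtracting this digit keeps the remainder in `(0, 1]`. The floor would give the forbidden
  -- digit `m` at `x = 1` when `r = m`.
  let d : ℝ → ℕ := fun x => ⌈r * x⌉₊ - 1
  let R : ℕ → ℝ := fun n => n.rec 1 fun _ x => r * x - d x
  have hd : ∀ x : ℝ, 0 < x → ((d x : ℕ) : ℝ) = ⌈r * x⌉₊ - 1 := by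
    intro x hx
    have : 1 ≤ ⌈r * x⌉₊ := Nat.one_le_iff_ne_zero.2 (Nat.ceil_pos.2 (by positivity)).ne'
    simp only [d]
    push_cast [Nat.cast_sub this]
    ring
  have hR : ∀ n, 0 < R n ∧ R n ≤ 1 := by
    intro n
    induction n with
    | zero => exact ⟨one_pos, le_rfl⟩
    | succ n ih =>
      have h1 : R (n + 1) = r * R n - d (R n) := rfl
      have h2 := Nat.ceil_lt_add_one (mul_pos hr0 ih.1).le
      have h3 := Nat.le_ceil (r * R n)
      rw [h1, hd _ ih.1]
      constructor <;> linarith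
  let e : ℕ → ℕ := fun n => if n = 0 then 0 else d (R (n - 1))
  have he : ∀ n, e (n + 1) = d (R n) := fun n => rfl
  have hpart : ∀ n, ∑ i ∈ Finset.range (n + 1), ((e i : ℕ) : ℝ) * (r ^ i)⁻¹ = 1 - R n * (r ^ n)⁻¹ := by
    intro n
    induction n with
    | zero => simp [e, R]
    | succ n ih =>
      have h1 : R (n + 1) = r * R n - d (R n) := rfl
      rw [Finset.sum_range_succ, ih, he, h1]
      field_simp
      ring
  refine ⟨e, rfl, ?_, ?_⟩
  · rintro (_ | n)
    · exact Nat.zero_le _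
    · rw [he]
      refine Nat.sub_le_sub_right (Nat.ceil_le.2 ?_) 1
      nlinarith [(hR n).1, (hR n).2]
  · rw [hasSum_iff_tendsto_nat_of_nonneg (fun i => by positivity), ← tendsto_add_atTop_iff_nat 1]
    simp_rw [hpart]
    have hz : Tendsto (fun n => (r ^ n)⁻¹) atTop (𝓝 0) :=
      tendsto_inv_atTop_zero.comp (tendsto_pow_atTop_atTop_of_one_lt hr)
    have hz' : Tendsto (fun n => R n * (r ^ n)⁻¹) atTop (𝓝 0) := by
      refine squeeze_zero (fun n => ?_) (fun n => ?_) hz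
      · exact mul_nonneg (hR n).1.le (by positivity)
      · exact mul_le_of_le_one_left (by positivity) (hR n).2
    simpa using hz'.const_sub 1

theorem HasBase.congr {f g : ℕ → ℕ} {b : ℝ} (hf : HasBase f b) (h : ∀ n, 1 ≤ n → f n = g n) :
    HasBase g b := by
  refine Tendsto.congr' ?_ hf
  filter_upwards [eventually_ge_atTop 1] with n hn
  rw [h n hn]

theorem hasBase_one : HasBase (fun _ => 1) 1 := by
  simp [HasBase]

/-- A positive base makes `f n ≥ 1` eventually, so `1 + f n` lies between `f n` and `2 * f n`. -/
theorem HasBase.one_add {f : ℕ → ℕ} {b : ℝ} (hf : HasBase f b) (hb : 1 ≤ b) :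
    HasBase (fun n => 1 + f n) b := by
  have h2 : Tendsto (fun n : ℕ => (2 : ℝ) ^ (1 / (n : ℝ)) * (f n : ℝ) ^ (1 / (n : ℝ))) atTop
      (𝓝 b) := by
    have : Tendsto (fun n : ℕ => (2 : ℝ) ^ (1 / (n : ℝ))) atTop (𝓝 1) := by
      have := (tendsto_const_nhds (x := (2 : ℝ))).rpow
        (tendsto_one_div_atTop_nhds_zero_nat (𝕜 := ℝ)) (Or.inl two_ne_zero)
      simpa using this
    simpa using this.mul hf
  refine tendsto_of_tendsto_of_tendsto_of_le_of_le' hf h2 ?_ ?_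
  · filter_upwards with n
    exact Real.rpow_le_rpow (by positivity) (by push_cast; linarith) (by positivity)
  · have hpos : ∀ᶠ n : ℕ in atTop, 0 < (f n : ℝ) ^ (1 / (n : ℝ)) :=
      hf.eventually_const_lt (by linarith)
    filter_upwards [hpos, eventually_ge_atTop 1] with n hn hn1
    have hf1 : 1 ≤ f n := by
      by_contra! h
      have h0 : f n = 0 := by omega
      rw [h0, Nat.cast_zero, Real.zero_rpow (by positivity)] at hn
      exact lt_irrefl _ hn
    rw [← Real.mul_rpow zero_le_two (by positivity)]
    have hf1' : (1 : ℝ) ≤ f n := by exact_mod_cast hf1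
    exact Real.rpow_le_rpow (by positivity) (by push_cast; linarith) (by positivity)

end Digits

/-! ### Retractions onto part of a free generating set. -/

section Retract

open FreeLieAlgebra

variable {F : Type*} [Field F] {ι : Type*} {G : Type*} [LieRing G] [LieAlgebra F G]

/-- A Lie algebra isomorphic to a free one is free. -/
theorem isFree_of_equiv (e : FreeLieAlgebra F ι ≃ₗ⁅F⁆ G) : IsFree F G := by
  have hinj : Function.Injective (fun i => e (of F i)) := fun i j h =>
    of_injective (e.injective h)
  let σ : ι ≃ Set.range (fun i => e (of F i)) := Equiv.ofInjective _ hinj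
  let g : FreeLieAlgebra F (Set.range (fun i => e (of F i))) →ₗ⁅F⁆ FreeLieAlgebra F ι :=
    lift F fun x => of F (σ.symm x)
  let g' : FreeLieAlgebra F ι →ₗ⁅F⁆ FreeLieAlgebra F (Set.range (fun i => e (of F i))) :=
    lift F fun i => of F (σ i)
  have h1 : g.comp g' = LieHom.id := by ext i; simp [g, g']
  have h2 : g'.comp g = LieHom.id := by ext i; simp [g, g']
  have hg : Function.Bijective g :=
    ⟨Function.LeftInverse.injective (g := g') fun x => LieHom.congr_fun h2 x,
      Function.RightInverse.surjective (g := g') fun x => LieHom.congr_fun h1 x⟩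
  have h3 : (e : FreeLieAlgebra F ι →ₗ⁅F⁆ G).comp g =
      lift F (fun b : Set.range (fun i => e (of F i)) => (b : G)) := by
    ext x
    obtain ⟨i, rfl⟩ := σ.surjective x
    simp [g, σ]
  refine ⟨Set.range (fun i => e (of F i)), ?_⟩
  rw [IsFreeBasis, ← h3]
  exact e.bijective.comp hg

/-- The retraction of a free Lie algebra onto the subalgebra generated by the free generators in
`Z`, with values in the free Lie algebra on `Z`. -/
noncomputable def restrictGens (F : Type*) [Field F] (Z : Set ι) :
    FreeLieAlgebra F ι →ₗ⁅F⁆ FreeLieAlgebra F Z :=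
  open Classical in lift F fun i => if h : i ∈ Z then of F ⟨i, h⟩ else 0

theorem restrictGens_of_mem {Z : Set ι} {i : ι} (h : i ∈ Z) :
    restrictGens F Z (of F i) = of F ⟨i, h⟩ := by
  rw [restrictGens, lift_of_apply, dif_pos h]

theorem restrictGens_of_notMem {Z : Set ι} {i : ι} (h : i ∉ Z) :
    restrictGens F Z (of F i) = 0 := by
  rw [restrictGens, lift_of_apply, dif_neg h]

theorem restrictGens_lift (Z : Set ι) (x : FreeLieAlgebra F Z) :
    restrictGens F Z (lift F (fun i : Z => of F (i : ι)) x) = x := by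
  have : (restrictGens F Z).comp (lift F (fun i : Z => of F (i : ι))) = LieHom.id := by
    ext i
    simp [restrictGens_of_mem i.2]
  exact LieHom.congr_fun this x

theorem lift_restrict (b : ι → G) (Z : Set ι) (x : FreeLieAlgebra F Z) :
    lift F b (lift F (fun i : Z => of F (i : ι)) x) = lift F (fun i : Z => b i) x := by
  have : (lift F b).comp (lift F (fun i : Z => of F (i : ι))) = lift F (fun i : Z => b i) := by
    ext i
    simp
  exact LieHom.congr_fun this x

namespace FreeFamily

variable {p : ℕ → G →ₗ[F] G} {b : ι → G} {w : ι → ℕ}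

theorem restrict (hb : FreeFamily p b w) (Z : Set ι) :
    FreeFamily p (fun i : Z => b i) (fun i : Z => w i) := by
  refine ⟨fun x y h => ?_, fun i => hb.homogeneous i⟩
  rw [← lift_restrict b Z x, ← lift_restrict b Z y] at h
  have := hb.injective h
  rw [← restrictGens_lift Z x, this, restrictGens_lift]

/-- The retraction onto the subalgebra generated by a part of the family is homogeneous. -/
theorem exists_proj_eq (hp : IsGrading p) (hb : FreeFamily p b w) (Z : Set ι)
    (y : FreeLieAlgebra F ι) (n : ℕ) :
    ∃ y', p n (lift F b y) = lift F b y' ∧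
      p n (lift F (fun i : Z => b i) (restrictGens F Z y)) =
        lift F (fun i : Z => b i) (restrictGens F Z y') := by
  induction y using free_induction generalizing n with
  | mem i =>
    refine ⟨if n = w i then of F i else 0, ?_⟩
    have h1 : p n (b i) = if n = w i then b i else 0 := by
      split_ifs with h
      · rw [h, hb.homogeneous]
      · rw [← hb.homogeneous i, hp.proj_of_ne _ _ _ h]
    by_cases hi : i ∈ Z
    · rw [restrictGens_of_mem hi, lift_of_apply, lift_of_apply]
      split_ifs at h1 ⊢ with h
      · simp [h1, restrictGens_of_mem hi]
      · simp [h1]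
    · rw [restrictGens_of_notMem hi, lift_of_apply]
      split_ifs at h1 ⊢ with h
      · simp [h1, restrictGens_of_notMem hi]
      · simp [h1]
  | zero => exact ⟨0, by simp⟩
  | add x y hx hy =>
    obtain ⟨x', h1, h2⟩ := hx n
    obtain ⟨y', h3, h4⟩ := hy n
    exact ⟨x' + y', by simp [h1, h3], by simp [h2, h4]⟩
  | smul a x hx =>
    obtain ⟨x', h1, h2⟩ := hx n
    exact ⟨a • x', by simp [h1], by simp [h2]⟩
  | lie x y hx hy =>
    choose x' h1 h2 using hx
    choose y' h3 h4 using hy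
    refine ⟨∑ ij ∈ Finset.HasAntidiagonal.antidiagonal n, ⁅x' ij.1, y' ij.2⁆, ?_, ?_⟩
    · rw [LieHom.map_lie, hp.proj_lie, map_sum]
      exact Finset.sum_congr rfl fun ij _ => by rw [LieHom.map_lie, h1, h3]
    · rw [LieHom.map_lie, LieHom.map_lie, hp.proj_lie, map_sum, map_sum]
      exact Finset.sum_congr rfl fun ij _ => by
        rw [LieHom.map_lie, LieHom.map_lie, h2, h4]

/-- The retraction is homogeneous, and injectivity of the lift carries vanishing components through
it. This lets cogrowth be computed inside each filtration piece. -/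
theorem lift_restrictGens_mem_filt (hp : IsGrading p) (hb : FreeFamily p b w) (Z : Set ι)
    {y : FreeLieAlgebra F ι} {n : ℕ} (hy : lift F b y ∈ filt p n) :
    lift F (fun i : Z => b i) (restrictGens F Z y) ∈ filt p n := by
  rw [mem_filt] at hy ⊢
  intro j hj
  obtain ⟨y', h1, h2⟩ := hb.exists_proj_eq hp Z y j
  rw [hy j hj] at h1
  have : y' = 0 := hb.injective (by rw [← h1, map_zero])
  rw [h2, this, map_zero, map_zero]

end FreeFamily

end Retract

/-! ### Retracts of an ideal of codimension one. -/

section Construction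

open FreeLieAlgebra

variable {F X : Type*} [Field F]

/-- The ideal on which a functional that vanishes on brackets vanishes. -/
noncomputable def kerIdeal (φ : FreeLieAlgebra F X →ₗ[F] F) (hφ : ∀ x y : FreeLieAlgebra F X, φ ⁅x, y⁆ = 0) :
    LieIdeal F (FreeLieAlgebra F X) :=
  { LinearMap.ker φ with lie_mem := fun {x y} _ => hφ x y }

theorem hasCodimOne_kerIdeal {φ : FreeLieAlgebra F X →ₗ[F] F}
    (hφ : ∀ x y : FreeLieAlgebra F X, φ ⁅x, y⁆ = 0)
    (h : Function.Surjective φ) : HasCodimOne (kerIdeal φ hφ) :=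
  ((φ.quotKerEquivOfSurjective h).finrank_eq).trans (Module.finrank_self F)

/-- A set `Z` of the generators obtained by elimination of `x₀` generates a retract of an ideal of
codimension one, with cogrowth of the kernel of the retraction given by the growth of the
retract. -/
theorem exists_retract [Finite X] (x₀ : X) {c : X → F} (hc : c x₀ = 1)
    (Z : Set ({i // i ≠ x₀} × ℕ)) :
    ∃ (M : LieIdeal F (FreeLieAlgebra F X)) (S : LieIdeal F M),
      HasCodimOne M ∧ IsFree F (M ⧸ S) ∧
      IsRetractOf (lift F (fun i : Z => elimFamily (of F) x₀ c i)).range M ∧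
      ∀ n, 1 ≤ n → 1 + growth (lift F (fun i : Z => elimFamily (of F) x₀ c i)).range.toSubmodule n =
        cogrowth (subidealSubspace M S) n := by
  have hp := isGrading_stdProj F X
  obtain ⟨φ, hφ, hlie⟩ := exists_functional c
  have hφ0 : φ (of F x₀) = 1 := by rw [hφ, hc]
  have hb : FreeFamily (stdProj F X) (elimFamily (of F) x₀ c) (elimWeight (fun _ => 1) x₀) :=
    freeFamily_std.eliminate hp x₀ c fun _ _ => rfl
  have hbZ := hb.restrict Z
  set f := lift F (elimFamily (of F : X → FreeLieAlgebra F X) x₀ c) with hf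
  set g := lift F (fun i : Z => elimFamily (of F : X → FreeLieAlgebra F X) x₀ c i) with hg
  have hfφ : ∀ y, φ (f y) = 0 := by
    intro y
    refine apply_eq_zero_of_mem_range_elimFamily hφ0 (fun x _ y _ => hlie x y) ?_
    rw [show (fun i => φ (of F i)) = c from funext hφ]
    exact ⟨y, rfl⟩
  have hrange : ∀ x, φ x = 0 → x ∈ f.range := by
    intro x hx
    obtain ⟨s, y, ⟨y, rfl⟩, rfl⟩ := exists_eq_smul_add_of_mem_range (of F) x₀ c (x := x)
      (by rw [range_lift_of]; trivial)
    have h : φ (s • of F x₀ + f y) = 0 := hx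
    rw [map_add, map_smul, hφ0, hfφ, add_zero, smul_eq_mul, mul_one] at h
    exact ⟨y, by rw [h, zero_smul, zero_add]⟩
  -- `M` is the range of `f`, hence free on the eliminated family. Below, `σ` takes coordinates in
  -- that family and `ρ₀` forgets the generators outside `Z`; the kernel of `ρ₀` serves as `S`.
  let M := kerIdeal φ hlie
  let inc : M →ₗ⁅F⁆ f.range :=
    { toFun := fun x => ⟨x, hrange x x.2⟩
      map_add' := fun _ _ => rfl
      map_smul' := fun _ _ => rfl
      map_lie' := rfl }
  let σ : M →ₗ⁅F⁆ FreeLieAlgebra F ({i // i ≠ x₀} × ℕ) :=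
    ((LieEquiv.ofInjective f hb.injective).symm : f.range →ₗ⁅F⁆ _).comp inc
  have hσ : ∀ x : M, f (σ x) = x := fun x =>
    congrArg Subtype.val ((LieEquiv.ofInjective f hb.injective).apply_symm_apply (inc x))
  let ρ₀ : M →ₗ⁅F⁆ FreeLieAlgebra F Z := (restrictGens F Z).comp σ
  have hgM : ∀ y, g y ∈ M := by
    intro y
    rw [hg, ← lift_restrict]
    exact hfφ _
  have hρ₀ : ∀ y (h : g y ∈ M), ρ₀ ⟨g y, h⟩ = y := by
    intro y h
    have : σ ⟨g y, h⟩ = lift F (fun i : Z => of F (i : {i // i ≠ x₀} × ℕ)) y := by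
      apply hb.injective
      rw [lift_restrict]
      exact hσ _
    change restrictGens F Z (σ ⟨g y, h⟩) = y
    rw [this, restrictGens_lift]
  have hsurj : Function.Surjective ρ₀ := fun y => ⟨⟨g y, hgM y⟩, hρ₀ y _⟩
  refine ⟨M, ρ₀.ker, hasCodimOne_kerIdeal hlie fun s => ⟨s • of F x₀, by simp [hφ0]⟩, ?_, ?_, ?_⟩
  · have e : (M ⧸ ρ₀.ker) ≃ₗ⁅F⁆ ρ₀.range := ρ₀.quotKerEquivRange
    have e' : FreeLieAlgebra F Z ≃ₗ⁅F⁆ (M ⧸ ρ₀.ker) :=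
      (LieEquiv.ofBijective (e.symm : ρ₀.range →ₗ⁅F⁆ _) e.symm.bijective |>.symm.trans
        (LieEquiv.ofBijective ρ₀.range.incl
          ⟨Subtype.val_injective, fun y => ⟨⟨y, hsurj y⟩, rfl⟩⟩)).symm
    exact isFree_of_equiv e'
  · refine ⟨fun x hx => ?_, g.rangeRestrict.comp ρ₀, ?_⟩
    · obtain ⟨y, rfl⟩ := hx
      exact hgM y
    · rintro ⟨_, y, rfl⟩
      apply Subtype.ext
      exact congrArg g (hρ₀ y _)
  · intro n hn
    have hfin := hp.finite_filt n
    rw [growth, cogrowth, filtration_eq_filt]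
    set A := filt (stdProj F X) n with hA
    have hx₀ : of F x₀ ∈ A := by
      rw [mem_filt]
      intro j hj
      rw [← freeFamily_std.homogeneous x₀]
      exact hp.proj_of_ne _ _ _ (by omega)
    -- Projection onto `M` along `of x₀`. It does not raise the degree above `n`, since `of x₀` has
    -- degree one and `1 ≤ n`.
    let π : FreeLieAlgebra F X →ₗ[F] M :=
      LinearMap.codRestrict M.toSubmodule (LinearMap.id - φ.smulRight (of F x₀)) fun x => by
        change φ (x - φ x • of F x₀) = 0
        simp [hφ0]
    have hπ : ∀ x, (π x : FreeLieAlgebra F X) = x - φ x • of F x₀ := fun _ => rfl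
    have hπM : ∀ x : M, π x = x := fun x => Subtype.ext (by
      rw [hπ, show φ (x : FreeLieAlgebra F X) = 0 from x.2, zero_smul, sub_zero])
    let θ : FreeLieAlgebra F X →ₗ[F] FreeLieAlgebra F X :=
      (g : FreeLieAlgebra F Z →ₗ[F] FreeLieAlgebra F X) ∘ₗ (ρ₀ : M →ₗ[F] FreeLieAlgebra F Z) ∘ₗ π
    have hθ : ∀ x, θ x = g (ρ₀ (π x)) := fun _ => rfl
    have hθA : ∀ x ∈ A, θ x ∈ g.range.toSubmodule ⊓ A := by
      intro x hx
      refine ⟨⟨_, rfl⟩, hb.lift_restrictGens_mem_filt hp Z (y := σ (π x)) ?_⟩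
      change f (σ (π x)) ∈ A
      rw [hσ, hπ]
      exact sub_mem hx (Submodule.smul_mem _ _ hx₀)
    -- `Ψ` records the value of `φ` and the retracted part; it is onto with kernel the part of `S`
    -- in `A`, which gives one plus the growth of the retract.
    let Ψ : A →ₗ[F] F × ↥(g.range.toSubmodule ⊓ A) :=
      (φ ∘ₗ A.subtype).prod (LinearMap.codRestrict _ (θ ∘ₗ A.subtype) fun x => hθA x x.2)
    have hΨ : Function.Surjective Ψ := by
      rintro ⟨s, ⟨_, ⟨y, rfl⟩, hyA⟩⟩
      change g y ∈ A at hyA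
      have hφy : φ (g y) = 0 := hgM y
      have h1 : φ (s • of F x₀ + g y) = s := by
        rw [map_add, map_smul, hφ0, hφy, smul_eq_mul, mul_one, add_zero]
      refine ⟨⟨s • of F x₀ + g y, add_mem (Submodule.smul_mem _ _ hx₀) hyA⟩, Prod.ext h1 ?_⟩
      apply Subtype.ext
      change θ (s • of F x₀ + g y) = g y
      have h2 : π (s • of F x₀ + g y) = ⟨g y, hgM y⟩ := Subtype.ext (by
        rw [hπ, h1, add_sub_cancel_left])
      rw [hθ, h2, hρ₀]
    have hker : (subidealSubspace M ρ₀.ker).submoduleOf A = LinearMap.ker Ψ := by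
      ext x
      have h1 : x ∈ LinearMap.ker Ψ ↔ φ x = 0 ∧ θ x = 0 := by
        rw [LinearMap.mem_ker, Prod.ext_iff, Subtype.ext_iff]
        exact Iff.rfl
      rw [h1]
      constructor
      · rintro ⟨z, hz, hzx⟩
        have hz' : (z : FreeLieAlgebra F X) = x := hzx
        rw [← hz', hθ, hπM]
        have hz0 : ρ₀ z = 0 := (LieHom.mem_ker (f := ρ₀)).1 hz
        exact ⟨z.2, by rw [hz0, map_zero]⟩
      · rintro ⟨h2, h3⟩
        rw [hθ, hπM ⟨x, h2⟩] at h3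
        exact ⟨⟨x, h2⟩, (LieHom.mem_ker (f := ρ₀)).2 (hbZ.injective (h3.trans (map_zero g).symm)), rfl⟩
    rw [hker, (Ψ.quotKerEquivOfSurjective hΨ).finrank_eq, Module.finrank_prod,
      Module.finrank_self]

/-- The growth of the subalgebra generated by a free family has base `r` if the weights of the
family satisfy the characteristic equation of `r`. -/
theorem FreeFamily.hasBase_growth [Finite X] {ι : Type*} {b : ι → FreeLieAlgebra F X} {w : ι → ℕ}
    (hb : FreeFamily (stdProj F X) b w) {r : ℝ} (hr : 1 ≤ r)
    (hsum : HasSum (fun n => (count w n : ℝ) * (r ^ n)⁻¹) 1) :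
    HasBase (growth (lift F b).range.toSubmodule) r := by
  have hp := isGrading_stdProj F X
  have h := (hb.isWitt hp).hasBase_of_hasSum hr hsum
  rwa [show growth (lift F b).range.toSubmodule = _ from funext (growth_eq_sum _),
    gr_eq_self hp (hb.isHomogeneous_range hp)]

theorem hasSum_single_one :
    HasSum (fun n : ℕ => ((if n = 1 then 1 else 0 : ℕ) : ℝ) * ((1 : ℝ) ^ n)⁻¹) 1 := by
  simpa using hasSum_ite_eq (1 : ℕ) (1 : ℝ)

/-- For `r = 1` a single digit `1` in degree one is used, admissible because `m - 1 ≥ 1`. -/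
theorem exists_digits_of_mem_Icc {m : ℕ} (hm : 2 ≤ m) {r : ℝ} (hr : r ∈ Set.Icc (1 : ℝ) m) :
    ∃ e : ℕ → ℕ, e 0 = 0 ∧ (∀ n, e n ≤ m - 1) ∧ HasSum (fun n => (e n : ℝ) * (r ^ n)⁻¹) 1 := by
  rcases hr.1.eq_or_lt with rfl | h
  · refine ⟨fun n => if n = 1 then 1 else 0, rfl, fun n => ?_, ?_⟩
    · dsimp only
      split_ifs <;> omega
    · exact hasSum_single_one
  · exact exists_digits h hr.2

/-- Part of the generators obtained by elimination of `x₀` has any prescribed weight distribution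
bounded by the number of the other generators. -/
theorem exists_count_eq [Fintype X] (x₀ : X) {e : ℕ → ℕ} (h0 : e 0 = 0)
    (he : ∀ n, e n ≤ Fintype.card X - 1) :
    ∃ Z : Set ({i // i ≠ x₀} × ℕ),
      ∀ n, count (fun i : Z => elimWeight (fun _ => 1) x₀ (i : {i // i ≠ x₀} × ℕ)) n = e n := by
  classical
  have hcard : Fintype.card {i // i ≠ x₀} = Fintype.card X - 1 := by
    rw [Fintype.card_subtype_compl, Fintype.card_subtype_eq]
  choose s hs using fun n => Finset.exists_subset_card_eq
    (s := (Finset.univ : Finset {i // i ≠ x₀})) (n := e n)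
    (by rw [Finset.card_univ, hcard]; exact he n)
  -- The pair `(i, j)` has weight `j + 1`, so every positive weight offers `Fintype.card X - 1`
  -- pairs.
  refine ⟨{k | k.1 ∈ s (k.2 + 1)}, fun n => ?_⟩
  rw [count, ← Set.ncard_image_of_injective _ Subtype.val_injective]
  cases n with
  | zero =>
    rw [h0, show {i : {k : {i // i ≠ x₀} × ℕ | k.1 ∈ s (k.2 + 1)} |
      elimWeight (fun _ => 1) x₀ (i : {i // i ≠ x₀} × ℕ) = 0} = ∅ from
        Set.eq_empty_of_forall_notMem fun i hi => by simp [elimWeight] at hi,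
      Set.image_empty, Set.ncard_empty]
  | succ n =>
    rw [← (hs (n + 1)).2, ← Set.ncard_coe_finset,
      ← Set.ncard_image_of_injective (s (n + 1) : Set {i // i ≠ x₀})
        (f := fun i => (i, n)) (fun i j h => (Prod.ext_iff.1 h).1)]
    congr 1
    ext ⟨i, j⟩
    constructor
    · rintro ⟨⟨⟨i', j'⟩, hi⟩, hw, h⟩
      obtain ⟨rfl, rfl⟩ := Prod.mk.inj h
      have hj : 1 + j' * 1 = n + 1 := hw
      obtain rfl : j' = n := by omega
      exact ⟨i', hi, rfl⟩
    · rintro ⟨i', hi, h⟩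
      obtain ⟨rfl, rfl⟩ := Prod.mk.inj h
      exact ⟨⟨(i', n), hi⟩, show 1 + n * 1 = n + 1 by omega, rfl⟩

end Construction

/-! ### The finitely generated case and the realization of bases. -/

section Bases

open FreeLieAlgebra

variable {F X : Type*} [Field F]

theorem exists_base_of_finitelyGenerated [Fintype X] {H : LieSubalgebra F (FreeLieAlgebra F X)}
    (hfg : IsFinitelyGenerated H) (hH : ¬ IsLieAbelian H) :
    ∃ β : ℝ, 1 < β ∧ HasBase (growth H.toSubmodule) β ∧ IsIntegral ℤ β ∧
      (H ≠ ⊤ → β < (Fintype.card X : ℝ)) ∧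
      (∃ Y : Finset (FreeLieAlgebra F X), IsIrreducible (Y : Set (FreeLieAlgebra F X)) ∧
        LieSubalgebra.lieSpan F (FreeLieAlgebra F X) (Y : Set (FreeLieAlgebra F X)) = H) ∧
      (∀ Y : Finset (FreeLieAlgebra F X), IsIrreducible (Y : Set (FreeLieAlgebra F X)) →
        LieSubalgebra.lieSpan F (FreeLieAlgebra F X) (Y : Set (FreeLieAlgebra F X)) = H →
        ∀ (d : ℕ) (k : ℕ → ℕ), d = Y.sup degree →
          (∀ i, k i = (Y.filter (fun y => degree y = i)).card) →
          ∀ z : ℝ, 0 < z →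
            (z ^ d = ∑ i ∈ Finset.Icc 1 d, (k i : ℝ) * z ^ (d - i) ↔ z = β)) := by
  obtain ⟨s, hs⟩ := hfg
  obtain ⟨Y₀, hY₀, hY₀s⟩ := exists_irreducible s
  obtain ⟨β, hβ1, hβ, hβm, hint, -⟩ :=
    exists_base_of_irreducible hH hY₀ (hY₀s.trans hs) rfl fun _ => rfl
  refine ⟨β, hβ1, hβ, hint, hβm, ⟨Y₀, hY₀, hY₀s.trans hs⟩, ?_⟩
  intro Y hY hYH d k hd hk
  -- Each irreducible generating set yields its own root; uniqueness of the limit identifies it with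
  -- `β`.
  obtain ⟨r, -, hr, -, -, hroot⟩ := exists_base_of_irreducible hH hY hYH hd hk
  rwa [hr.unique hβ] at hroot

theorem exists_retract_hasBase [Fintype X] (hX : 2 ≤ Fintype.card X) {r : ℝ}
    (hr : r ∈ Set.Icc (1 : ℝ) (Fintype.card X)) :
    ∃ (H : LieSubalgebra F (FreeLieAlgebra F X)) (M : LieIdeal F (FreeLieAlgebra F X))
      (S : LieIdeal F M), HasBase (growth H.toSubmodule) r ∧ HasCodimOne M ∧ IsRetractOf H M ∧
        IsFree F (M ⧸ S) ∧ HasBase (cogrowth (subidealSubspace M S)) r := by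
  classical
  obtain ⟨x₀⟩ : Nonempty X := Fintype.card_pos_iff.1 (by omega)
  obtain ⟨e, h0, he, hsum⟩ := exists_digits_of_mem_Icc hX hr
  obtain ⟨Z, hZ⟩ := exists_count_eq x₀ h0 he
  -- Any `c` with `c x₀ = 1` would do; here `M` is the kernel of the functional with value `1` on
  -- all free generators.
  obtain ⟨M, S, hM, hfree, hret, hco⟩ := exists_retract (F := F) x₀ (c := fun _ => 1) rfl Z
  have hb := (freeFamily_std.eliminate (isGrading_stdProj F X) x₀ (fun _ => 1)
    fun _ _ => rfl).restrict Z
  have hbase := hb.hasBase_growth hr.1 (by simpa only [hZ] using hsum)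
  exact ⟨_, M, S, hbase, hM, hret, hfree, (hbase.one_add hr.1).congr hco⟩

theorem hasBase_growth_top [Fintype X] (hX : Fintype.card X = 1) :
    HasBase (growth (⊤ : LieSubalgebra F (FreeLieAlgebra F X)).toSubmodule) 1 := by
  rw [← range_lift_of]
  refine freeFamily_std.hasBase_growth le_rfl ?_
  have hc : ∀ n, count (fun _ : X => 1) n = if n = 1 then 1 else 0 := by
    intro n
    by_cases hn : n = 1
    · simp [count, hn, Set.ncard_univ, hX]
    · simp [count, hn, Ne.symm hn]
  simpa only [hc] using hasSum_single_one

/-- Elimination of the only generator leaves nothing: with `Z = ∅` the retract is zero and the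
cogrowth is `1` from degree one on. -/
theorem exists_subideal_hasBase_one [Fintype X] (hX : Fintype.card X = 1) :
    ∃ (M : LieIdeal F (FreeLieAlgebra F X)) (S : LieIdeal F M),
      HasCodimOne M ∧ IsFree F (M ⧸ S) ∧ HasBase (cogrowth (subidealSubspace M S)) 1 := by
  obtain ⟨x₀⟩ : Nonempty X := Fintype.card_pos_iff.1 (by omega)
  obtain ⟨M, S, hM, hfree, -, hco⟩ := exists_retract (F := F) x₀ (c := fun _ => 1) rfl ∅
  refine ⟨M, S, hM, hfree, hasBase_one.congr fun n hn => ?_⟩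
  rw [← hco n hn, range_lift, Set.range_eq_empty, LieSubalgebra.span_empty, growth]
  simp

end Bases

end FreeLieGrowth

/-! ### The main theorem. -/

theorem theorem3 {F X : Type*} [Field F] [Fintype X] (m : ℕ) (hm : Fintype.card X = m) :
    -- (i)
    (∀ H : LieSubalgebra F (FreeLieAlgebra F X), H ≠ ⊤ → ¬ IsLieAbelian H →
      FreeLieGrowth.IsExponential (FreeLieGrowth.growth H.toSubmodule)) ∧
    -- (ii)
    (∀ H : LieSubalgebra F (FreeLieAlgebra F X),
      FreeLieGrowth.IsFinitelyGenerated H → ¬ IsLieAbelian H →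
      ∃ β : ℝ, 1 < β ∧ FreeLieGrowth.HasBase (FreeLieGrowth.growth H.toSubmodule) β ∧
        IsIntegral ℤ β ∧
        (H ≠ ⊤ → β < (m : ℝ)) ∧
        (∃ Y : Finset (FreeLieAlgebra F X),
          FreeLieGrowth.IsIrreducible (Y : Set (FreeLieAlgebra F X)) ∧
          LieSubalgebra.lieSpan F (FreeLieAlgebra F X) (Y : Set (FreeLieAlgebra F X)) = H) ∧
        (∀ Y : Finset (FreeLieAlgebra F X),
          FreeLieGrowth.IsIrreducible (Y : Set (FreeLieAlgebra F X)) →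
          LieSubalgebra.lieSpan F (FreeLieAlgebra F X) (Y : Set (FreeLieAlgebra F X)) = H →
          ∀ (d : ℕ) (k : ℕ → ℕ), d = Y.sup FreeLieGrowth.degree →
            (∀ i, k i = (Y.filter (fun y => FreeLieGrowth.degree y = i)).card) →
            ∀ z : ℝ, 0 < z →
              (z ^ d = ∑ i ∈ Finset.Icc 1 d, (k i : ℝ) * z ^ (d - i) ↔ z = β))) ∧
    -- (iii)
    (∀ m₀ ∈ Set.Icc (1 : ℝ) (m : ℝ), ∃ H : LieSubalgebra F (FreeLieAlgebra F X),
      FreeLieGrowth.HasBase (FreeLieGrowth.growth H.toSubmodule) m₀ ∧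
      (2 ≤ m → ∃ I : LieIdeal F (FreeLieAlgebra F X),
        FreeLieGrowth.HasCodimOne I ∧ FreeLieGrowth.IsRetractOf H I)) ∧
    -- (iv)
    (∀ m₀ ∈ Set.Icc (1 : ℝ) (m : ℝ), ∃ (M : LieIdeal F (FreeLieAlgebra F X)) (S : LieIdeal F M),
      FreeLieGrowth.HasCodimOne M ∧ FreeLieGrowth.IsFree F (M ⧸ S) ∧
      FreeLieGrowth.HasBase
        (FreeLieGrowth.cogrowth (FreeLieGrowth.subidealSubspace M S)) m₀) := by
  subst hm
  refine ⟨fun H hH hab => FreeLieGrowth.isExponential_growth hab,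
    fun H hfg hab => FreeLieGrowth.exists_base_of_finitelyGenerated hfg hab,
    fun r hr => ?_, fun r hr => ?_⟩
  · have h1 : 1 ≤ Fintype.card X := by exact_mod_cast hr.1.trans hr.2
    -- The range of the base is empty for `m = 0` and the point `1` for `m = 1`; the digit
    -- construction starts at `m = 2`.
    rcases h1.eq_or_lt with h | h
    · obtain rfl : r = 1 := le_antisymm (by simpa [← h] using hr.2) hr.1
      exact ⟨⊤, FreeLieGrowth.hasBase_growth_top h.symm, fun h2 => by omega⟩
    · obtain ⟨H, M, -, hH, hM, hret, -⟩ := FreeLieGrowth.exists_retract_hasBase (F := F) h hr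
      exact ⟨H, hH, fun _ => ⟨M, hM, hret⟩⟩
  · have h1 : 1 ≤ Fintype.card X := by exact_mod_cast hr.1.trans hr.2
    rcases h1.eq_or_lt with h | h
    · obtain rfl : r = 1 := le_antisymm (by simpa [← h] using hr.2) hr.1
      exact FreeLieGrowth.exists_subideal_hasBase_one h.symm
    · obtain ⟨-, M, S, -, hM, -, hfree, hS⟩ :=
        FreeLieGrowth.exists_retract_hasBase (F := F) h hr
      exact ⟨M, S, hM, hfree, hS⟩
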